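/- **Theorem (reciprocal relations).** *BMW algebra.* For $q,\mu\in\mathbb C^\ast$ with $q^2\ne 1$, put $\eta=\frac{(q-\mu)(q^{-1}+\mu)}{\mu(q-q^{-1})}$ and $i_q=\frac{q^i-q^{-i}}{q-q^{-1}}$. The Birman–Murakami–Wenzl algebra $\mathcal W_n(q,\mu)$ is the unital associative $\mathbb C$-algebra generated by $\sigma_i^{\pm1},\kappa_i$ ($1\le i\le n-1$) with relations $\sigma_i\sigma_{i+1}\sigma_i=\sigma_{i+1}\sigma_i\sigma_{i+1}$; $\sigma_i\sigma_j=\sigma_j\sigma_i$ for $|i-j|>1$; $\kappa_i=\frac{(q-\sigma_i)(q^{-1}+\sigma_i)}{\mu(q-q^{-1})}$; $\sigma_i\kappa_i=\kappa_i\sigma_i=\mu\kappa_i$; $\kappa_i\sigma_{i\pm1}^{\epsilon}=\kappa_i\kappa_{i\pm1}\sigma_i^{-\epsilon}$ and $\sigma_{i\pm1}^{\epsilon}\kappa_i=\sigma_i^{-\epsilon}\kappa_{i\pm1}\kappa_i$ for $\epsilon=\pm1$; $\kappa_i\kappa_{i\pm1}\kappa_i=\kappa_i$; $\kappa_i^2=\eta\kappa_i$.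 Let $x^{\uparrow 1}$ denote the image of $x$ under $\mathcal W_n\to\mathcal W_{n+1}$, $\sigma_i\mapsto\sigma_{i+1}$. Put $\sigma_i^-(x)=1+\frac{x-1}{q-q^{-1}}\sigma_i+\frac{\mu(x-1)}{\mu+qx}\kappa_i$, and define the $q$-antisymmetrizers by $a^{(1)}=1$, $a^{(i+1)}=\frac{q^i}{(i+1)_q}\,a^{(i)}\sigma_i^-(q^{-2i})a^{(i)}$. *Yang–Baxter matrices.* Let $V$ be a finite-dimensional complex vector space with a fixed basis, $N=\dim V$. For an operator $X$ on $V^{\otimes 2}$, $X_i$ denotes $X$ acting in the $i$-th and $(i+1)$-st factors of a tensor power of $V$; for an operator $Z$ on $V$, $Z_i$ denotes $Z$ acting in the $i$-th factor. $P$ is the flip of $V\otimes V$. A Yang–Baxter matrix is $R\in\mathrm{Aut}(V^{\otimes2})$ with $R_1R_2R_1=R_2R_1R_2$. It is skew invertible if there is $\Psi_R\in\mathrm{End}(V^{\otimes 2})$ (necessarily unique) with $\mathrm{Tr}_{(2)}R_1(\Psi_R)_2=\mathrm{Tr}_{(2)}(\Psi_R)_1R_2=P$; then $D_R:=\mathrm{Tr}_{(2)}\Psi_R\in\mathrm{End}(V)$.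 It is strict skew invertible if $R$ and $R^{-1}$ are skew invertible. It is of BMW type with parameters $q,\mu$ if for every $n$ the map $\sigma_i\mapsto R_i$ extends to a homomorphism $\rho_R:\mathcal W_n(q,\mu)\to\mathrm{End}(V^{\otimes n})$ and $\mu$ is an eigenvalue of $R$ (equivalently, when $q^2\ne1$ and $\mu\notin\{0,q,-q^{-1}\}$, $\rho_R(\kappa_1)\neq0$). *Orthogonal type.* Let $k\ge2$, and let $q\neq0$, $\mu\ne 0,q$ satisfy $q^{2i}\ne1$ and $\mu\neq -q^{1-2i}$ for $i=1,\dots,k$. Let $R$ be a skew invertible Yang–Baxter matrix of BMW type with parameters $q,\mu$ which is of type $O(k)$, that is: - (height $k$) $\rho_R(a^{(i)})\neq0$ for $i=2,\dots,k$ and $\rho_R\bigl(a^{(k)\uparrow1}\sigma_1^-(q^{-2k})a^{(k)\uparrow1}\bigr)=0$; - $\mu=q^{1-k}$; - $\mathrm{rk}\,\rho_R(a^{(k)})=1$. *Quantum matrix algebra.* Let $F$ be a strict skew invertible Yang–Baxter matrix on $V^{\otimes2}$ compatible with $R$: $R_1F_2F_1=F_2F_1R_2$ and $R_2F_1F_2=F_1F_2R_1$.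 Let $\mathcal M(R,F)$ be the quotient of the free unital algebra $\mathbb C\langle M^a_b\rangle_{a,b=1}^{N}$ by the entries of $R_1M_{\overline1}M_{\overline2}=M_{\overline1}M_{\overline2}R_1$, where $M=\|M^a_b\|$, $M_{\overline1}=M_1$ and $M_{\overline{i+1}}=F_iM_{\overline i}F_i^{-1}$. Put $\mathfrak e_0=1$ and, for $i\ge1$, $$\mathfrak e_i=\mathrm{ch}(a^{(i)})=\mathrm{Tr}_{(1,\dots,i)}\Bigl((D_R)_1\cdots(D_R)_i\,M_{\overline1}\cdots M_{\overline i}\,\rho_R(a^{(i)})\Bigr),$$ and define the contraction $$g=\mu^2\,\mathrm{Tr}_{(1,2)}\bigl(M_{\overline1}M_{\overline2}\,\eta^{-1}\rho_R(\kappa_1)\bigr).$$ Then in $\mathcal M(R,F)$ $$g^{\,k-i}\,\mathfrak e_i=\mathfrak e_k\,\mathfrak e_{k-i}\qquad\text{for all } i=0,1,\dots,k-1 .$$ -/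

import Mathlib

noncomputable section

namespace QuantumMatrix

/-! ### The Birman--Murakami--Wenzl algebra -/

/-- The `q`-number `i_q = (q^i - q^{-i}) / (q - q^{-1})`. -/
def qNumber (q : ℂ) (i : ℕ) : ℂ := (q ^ i - (q⁻¹) ^ i) / (q - q⁻¹)

/-- The loop value `η = (q - μ)(q⁻¹ + μ) / (μ (q - q⁻¹))`. -/
def eta (q μ : ℂ) : ℂ := (q - μ) * (q⁻¹ + μ) / (μ * (q - q⁻¹))

/-- Letters of the presentation of the algebra on `n` strands: `σ_i`, `σ_i⁻¹`, `κ_i`.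
The `n - 1` positions are numbered from `0`, so position `i` concerns the strands `i` and `i + 1`
(strands numbered from `0` as well). -/
inductive BMWGen (n : ℕ) : Type
  | s (i : Fin (n - 1)) : BMWGen n
  | sInv (i : Fin (n - 1)) : BMWGen n
  | k (i : Fin (n - 1)) : BMWGen n

namespace BMWGen

/-- The letter `σ_i` in the free algebra. -/
abbrev S {n : ℕ} (i : Fin (n - 1)) : FreeAlgebra ℂ (BMWGen n) := FreeAlgebra.ι ℂ (s i)

/-- The letter `σ_i⁻¹` in the free algebra. -/
abbrev T {n : ℕ} (i : Fin (n - 1)) : FreeAlgebra ℂ (BMWGen n) := FreeAlgebra.ι ℂ (sInv i)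

/-- The letter `κ_i` in the free algebra. -/
abbrev K {n : ℕ} (i : Fin (n - 1)) : FreeAlgebra ℂ (BMWGen n) := FreeAlgebra.ι ℂ (k i)

end BMWGen

/-- Two positions are neighbours. -/
def Adjacent {m : ℕ} (i j : Fin m) : Prop := (i : ℕ) + 1 = j ∨ (j : ℕ) + 1 = i

open BMWGen in
/-- The defining relations of the Birman--Murakami--Wenzl algebra. -/
inductive BMWRel (q μ : ℂ) (n : ℕ) :
    FreeAlgebra ℂ (BMWGen n) → FreeAlgebra ℂ (BMWGen n) → Prop
  | s_sInv (i) : BMWRel q μ n (S i * T i) 1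
  | sInv_s (i) : BMWRel q μ n (T i * S i) 1
  | braid (i j) : Adjacent i j → BMWRel q μ n (S i * S j * S i) (S j * S i * S j)
  | comm (i j : Fin (n - 1)) : (i : ℕ) + 1 < j ∨ (j : ℕ) + 1 < i → BMWRel q μ n (S i * S j) (S j * S i)
  | kappa (i) : BMWRel q μ n (K i)
      ((μ * (q - q⁻¹))⁻¹ • ((q • 1 - S i) * (q⁻¹ • 1 + S i)))
  | s_k (i) : BMWRel q μ n (S i * K i) (μ • K i)
  | k_s (i) : BMWRel q μ n (K i * S i) (μ • K i)
  | k_s_adj (i j) : Adjacent i j → BMWRel q μ n (K i * S j) (K i * K j * T i)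
  | k_sInv_adj (i j) : Adjacent i j → BMWRel q μ n (K i * T j) (K i * K j * S i)
  | s_k_adj (i j) : Adjacent i j → BMWRel q μ n (S j * K i) (T i * K j * K i)
  | sInv_k_adj (i j) : Adjacent i j → BMWRel q μ n (T j * K i) (S i * K j * K i)
  | k_k_k (i j) : Adjacent i j → BMWRel q μ n (K i * K j * K i) (K i)
  | k_k (i) : BMWRel q μ n (K i * K i) (eta q μ • K i)

/-- The Birman--Murakami--Wenzl algebra `𝒲_n(q, μ)`. -/
def BMW (q μ : ℂ) (n : ℕ) : Type := RingQuot (BMWRel q μ n)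

instance (q μ : ℂ) (n : ℕ) : Ring (BMW q μ n) := inferInstanceAs (Ring (RingQuot (BMWRel q μ n)))

instance (q μ : ℂ) (n : ℕ) : Algebra ℂ (BMW q μ n) :=
  inferInstanceAs (Algebra ℂ (RingQuot (BMWRel q μ n)))

namespace BMW

variable (q μ : ℂ) (n : ℕ)

/-- The generator `σ_i` of `𝒲_n`. -/
def sigma (i : Fin (n - 1)) : BMW q μ n := RingQuot.mkAlgHom ℂ (BMWRel q μ n) (BMWGen.S i)

/-- The generator `κ_i` of `𝒲_n`. -/
def kappa (i : Fin (n - 1)) : BMW q μ n := RingQuot.mkAlgHom ℂ (BMWRel q μ n) (BMWGen.K i)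

/-- The baxterized element
`σ_i⁻(x) = 1 + (x - 1)/(q - q⁻¹) σ_i + μ (x - 1)/(μ + q x) κ_i`. -/
def baxterMinus (i : Fin (n - 1)) (x : ℂ) : BMW q μ n :=
  1 + ((x - 1) / (q - q⁻¹)) • sigma q μ n i + (μ * (x - 1) / (μ + q * x)) • kappa q μ n i

/-- The shifted `q`-antisymmetrizer `a^{(m)↑p}` as an element of `𝒲_n`, for `p + m ≤ n`:
`a^{(1)} = 1` and `a^{(m+1)} = q^m / (m+1)_q · a^{(m)} σ_m⁻(q^{-2m}) a^{(m)}`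
(generators numbered from `1` in this formula), every generator being moved `p` places up.
By convention `a^{(0)} = 1`. -/
def antisymm (p : ℕ) : (m : ℕ) → p + m ≤ n → BMW q μ n
  | 0, _ => 1
  | 1, _ => 1
  | m + 2, h =>
      (q ^ (m + 1) / qNumber q (m + 2)) •
        (antisymm p (m + 1) (by omega) *
          baxterMinus q μ n ⟨p + m, by omega⟩ ((q⁻¹) ^ (2 * (m + 1))) *
          antisymm p (m + 1) (by omega))

/-- The `q`-antisymmetrizer `a^{(n)}` in `𝒲_n`. -/
def antisymmetrizer : BMW q μ n := antisymm q μ n 0 n (by omega)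

/-- The second order contractor `c^{(2)} = η⁻¹ κ_1` in `𝒲_2`. -/
def contractor2 : BMW q μ 2 := (eta q μ)⁻¹ • kappa q μ 2 ⟨0, by norm_num⟩

end BMW

/-! ### Operators on tensor powers -/

/-- `End(V^{⊗n}) ⊗ A` for `V = ℂ^ι`: matrices with entries in `A` whose rows and columns are
indexed by multi-indices of length `n`. The tensor factors are numbered from `0`. -/
abbrev TensorMat (ι : Type*) (n : ℕ) (A : Type*) := Matrix (Fin n → ι) (Fin n → ι) A

section Tensor

variable {ι : Type*} [Fintype ι] [DecidableEq ι] {A : Type*}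

/-- The operator on `V^{⊗n}` which acts as `X` in the `m` consecutive factors
`i, i + 1, …, i + m - 1` and as the identity in all the other ones. -/
def embed [Zero A] {m : ℕ} (X : TensorMat ι m A) (n i : ℕ) (h : i + m ≤ n) :
    TensorMat ι n A :=
  Matrix.of fun x y =>
    if ∀ j : Fin n, ((j : ℕ) < i ∨ i + m ≤ (j : ℕ)) → x j = y j then
      X (fun t => x ⟨i + t, by omega⟩) (fun t => y ⟨i + t, by omega⟩)
    else 0

/-- A matrix regarded as an operator on the first tensor power. -/
def oneLeg (M : Matrix ι ι A) : TensorMat ι 1 A := Matrix.of fun x y => M (x 0) (y 0)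

/-- The partial trace over the tensor factor `j`. -/
def partialTrace [AddCommMonoid A] {n : ℕ} (j : Fin (n + 1)) (X : TensorMat ι (n + 1) A) :
    TensorMat ι n A :=
  Matrix.of fun x y =>
    ∑ c : ι, X (Fin.insertNth (α := fun _ => ι) j c x) (Fin.insertNth (α := fun _ => ι) j c y)

/-- The permutation operator `u ⊗ v ↦ v ⊗ u`. -/
def flip (ι : Type*) [DecidableEq ι] : TensorMat ι 2 ℂ :=
  Matrix.of fun x y => if x 0 = y 1 ∧ x 1 = y 0 then 1 else 0

/-- For `X` acting on `V ⊗ V`, the operator on `V^{⊗n}` acting as `X` in the factors `i, i + 1`. -/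
abbrev twoLegs (X : TensorMat ι 2 ℂ) (n i : ℕ) (h : i + 2 ≤ n := by omega) : TensorMat ι n ℂ :=
  embed X n i h

/-! ### Yang--Baxter matrices -/

/-- `R` is a Yang--Baxter matrix: an automorphism of `V ⊗ V` satisfying the braid relation. -/
structure IsYangBaxter (R : TensorMat ι 2 ℂ) : Prop where
  isUnit : IsUnit R
  braid : twoLegs R 3 0 * twoLegs R 3 1 * twoLegs R 3 0 =
    twoLegs R 3 1 * twoLegs R 3 0 * twoLegs R 3 1

/-- `Ψ` is the skew inverse of `R`: `Tr_(2) R_1 Ψ_2 = Tr_(2) Ψ_1 R_2 = P`, where the trace is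
over the middle factor of `V^{⊗3}`. -/
structure IsSkewInverse (R Ψ : TensorMat ι 2 ℂ) : Prop where
  right : partialTrace 1 (twoLegs R 3 0 * twoLegs Ψ 3 1) = flip ι
  left : partialTrace 1 (twoLegs Ψ 3 0 * twoLegs R 3 1) = flip ι

/-- `R` is skew invertible. -/
def IsSkewInvertible (R : TensorMat ι 2 ℂ) : Prop := ∃ Ψ, IsSkewInverse R Ψ

/-- A matrix `R` is strict skew invertible if both `R` and `R⁻¹` are skew invertible
(used for invertible `R` only). -/
structure IsStrictSkewInvertible (R : TensorMat ι 2 ℂ) : Prop where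
  skew : IsSkewInvertible R
  skew_inv : IsSkewInvertible R⁻¹

/-- The matrix `D_R = Tr_(2) Ψ_R`; the skew inverse `Ψ_R` is unique. -/
def matrixD {R : TensorMat ι 2 ℂ} (hR : IsSkewInvertible R) : Matrix ι ι ℂ :=
  Matrix.of fun a b => partialTrace 1 hR.choose (fun _ => a) (fun _ => b)

/-- `{R, F}` satisfies the twist relations
`R_1 F_2 F_1 = F_2 F_1 R_2` and `R_2 F_1 F_2 = F_1 F_2 R_1`. -/
structure IsCompatible (R F : TensorMat ι 2 ℂ) : Prop where
  twist₁ : twoLegs R 3 0 * twoLegs F 3 1 * twoLegs F 3 0 =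
    twoLegs F 3 1 * twoLegs F 3 0 * twoLegs R 3 1
  twist₂ : twoLegs R 3 1 * twoLegs F 3 0 * twoLegs F 3 1 =
    twoLegs F 3 0 * twoLegs F 3 1 * twoLegs R 3 0

/-- `R` is of BMW type with parameters `q, μ`: for all `n` the assignment `σ_i ↦ R_i` extends to a
representation of `𝒲_n(q, μ)` on `V^{⊗n}`, and `μ` is a spectral value of `R`. The
second condition says that `κ_1` does not act by zero (if it did, `R` would be of Hecke type and
`μ` would be arbitrary). -/
structure IsBMWType (q μ : ℂ) (R : TensorMat ι 2 ℂ) : Prop where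
  rep : ∀ n : ℕ, ∃ ρ : BMW q μ n →ₐ[ℂ] TensorMat ι n ℂ,
    ∀ i : Fin (n - 1), ρ (BMW.sigma q μ n i) = twoLegs R n i
  spectral : μ ∈ spectrum ℂ R

/-- The Yang--Baxter representation `ρ_R : 𝒲_n(q, μ) → End(V^{⊗n})`. It is determined by
`σ_i ↦ R_i`, since `κ_i` and `σ_i⁻¹` are determined by `σ_i`. -/
def ybRep {q μ : ℂ} {R : TensorMat ι 2 ℂ} (hR : IsBMWType q μ R) (n : ℕ) :
    BMW q μ n →ₐ[ℂ] TensorMat ι n ℂ := (hR.rep n).choose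

/-- The restrictions on the parameters under which `a^{(2)}, …, a^{(k+1)}` are defined. -/
structure AdmissibleParameters (q μ : ℂ) (k : ℕ) : Prop where
  q_ne_zero : q ≠ 0
  q_pow_ne_one : ∀ i : ℕ, 1 ≤ i → i ≤ k → q ^ (2 * i) ≠ 1
  mu_ne_zero : μ ≠ 0
  mu_ne_q : μ ≠ q
  mu_ne : ∀ i : ℕ, 1 ≤ i → i ≤ k → μ ≠ -q ^ (1 - 2 * (i : ℤ))

/-- `R` is a skew invertible BMW type Yang--Baxter matrix of height `k ≥ 2`: the
`q`-antisymmetrizers `a^{(2)}, …, a^{(k)}` act by nonzero operators, while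
`a^{(k)↑1} σ_1⁻(q^{-2k}) a^{(k)↑1}` acts by zero. -/
structure HasHeight (q μ : ℂ) (k : ℕ) (R : TensorMat ι 2 ℂ) : Prop where
  two_le : 2 ≤ k
  parameters : AdmissibleParameters q μ k
  bmw : IsBMWType q μ R
  skew : IsSkewInvertible R
  rank_ne_zero : ∀ i : ℕ, 2 ≤ i → i ≤ k →
    (ybRep bmw i (BMW.antisymmetrizer q μ i)).rank ≠ 0
  vanish : ybRep bmw (k + 1)
    (BMW.antisymm q μ (k + 1) 1 k (by omega) *
      BMW.baxterMinus q μ (k + 1) ⟨0, by omega⟩ ((q⁻¹) ^ (2 * k)) *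
      BMW.antisymm q μ (k + 1) 1 k (by omega)) = 0

/-- `R` is an orthogonal Yang--Baxter matrix of type `O(k)`. -/
structure IsOrthogonalType (q μ : ℂ) (k : ℕ) (R : TensorMat ι 2 ℂ) : Prop
    extends HasHeight q μ k R where
  mu_eq : μ = q ^ (1 - (k : ℤ))
  rank_one : (ybRep bmw k (BMW.antisymmetrizer q μ k)).rank = 1

/-! ### Quantum matrix algebras -/

section Copies

variable [Ring A] [Algebra ℂ A]

/-- A numerical operator regarded as an operator with entries in `A`. -/
abbrev scalars (A : Type*) [Ring A] [Algebra ℂ A] {n : ℕ} (X : TensorMat ι n ℂ) :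
    TensorMat ι n A := X.map (algebraMap ℂ A)

/-- The copies of a matrix `M` in `End(V^{⊗n}) ⊗ A`:
the first one is `M_1`, the next ones are given by `M ↦ F_i M F_i⁻¹`. -/
def copy (F : TensorMat ι 2 ℂ) (M : Matrix ι ι A) (n : ℕ) :
    (i : ℕ) → i < n → TensorMat ι n A
  | 0, h => embed (oneLeg M) n 0 (by omega)
  | i + 1, h =>
      scalars A (twoLegs F n i) * copy F M n i (by omega) * scalars A (twoLegs F⁻¹ n i)

/-- The ordered product `M_{\bar 1} M_{\bar 2} ⋯ M_{\bar n}` of the copies of `M`. -/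
def copyProd (F : TensorMat ι 2 ℂ) (M : Matrix ι ι A) (n : ℕ) : TensorMat ι n A :=
  (List.ofFn fun i : Fin n => copy F M n i i.isLt).prod

/-- The R-trace over all `n` factors, `Tr(D_1 ⋯ D_n X)`. -/
def rTrace (D : Matrix ι ι ℂ) {n : ℕ} (X : TensorMat ι n A) : A :=
  ∑ x : Fin n → ι, ∑ y : Fin n → ι, (∏ j, D (x j) (y j)) • X y x

end Copies

/-- The matrix of free generators. -/
def freeMatrix (ι : Type*) : Matrix ι ι (FreeAlgebra ℂ (ι × ι)) :=
  Matrix.of fun a b => FreeAlgebra.ι ℂ (a, b)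

/-- The entries of the matrix relation
`R_1 M_{\bar 1} M_{\bar 2} = M_{\bar 1} M_{\bar 2} R_1`. -/
inductive QMRel (R F : TensorMat ι 2 ℂ) :
    FreeAlgebra ℂ (ι × ι) → FreeAlgebra ℂ (ι × ι) → Prop
  | entry (x y : Fin 2 → ι) : QMRel R F
      ((scalars (FreeAlgebra ℂ (ι × ι)) R * copyProd F (freeMatrix ι) 2) x y)
      ((copyProd F (freeMatrix ι) 2 * scalars (FreeAlgebra ℂ (ι × ι)) R) x y)

/-- The quantum matrix algebra `ℳ(R, F)`. -/
def QMAlgebra (R F : TensorMat ι 2 ℂ) : Type _ := RingQuot (QMRel R F)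

instance (R F : TensorMat ι 2 ℂ) : Ring (QMAlgebra R F) :=
  inferInstanceAs (Ring (RingQuot (QMRel R F)))

instance (R F : TensorMat ι 2 ℂ) : Algebra ℂ (QMAlgebra R F) :=
  inferInstanceAs (Algebra ℂ (RingQuot (QMRel R F)))

/-- The quantum matrix: the matrix of generators of `ℳ(R, F)`. -/
def quantumMatrix (R F : TensorMat ι 2 ℂ) : Matrix ι ι (QMAlgebra R F) :=
  Matrix.of fun a b => RingQuot.mkAlgHom ℂ (QMRel R F) (FreeAlgebra.ι ℂ (a, b))

variable {q μ : ℂ} {R : TensorMat ι 2 ℂ}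

/-- The characteristic element
`ch(α) = Tr_{R (1,…,n)} (M_{\bar 1} ⋯ M_{\bar n} ρ_R(α))` for `α ∈ 𝒲_n`. -/
def ch (hB : IsBMWType q μ R) (hS : IsSkewInvertible R) (F : TensorMat ι 2 ℂ) {n : ℕ}
    (α : BMW q μ n) : QMAlgebra R F :=
  rTrace (matrixD hS)
    (copyProd F (quantumMatrix R F) n * scalars (QMAlgebra R F) (ybRep hB n α))

/-- The contraction `g = μ² Tr_(1,2) (M_{\bar 1} M_{\bar 2} ρ_R(c^{(2)}))`, an ordinary trace. -/
def contraction (hB : IsBMWType q μ R) (F : TensorMat ι 2 ℂ) : QMAlgebra R F :=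
  μ ^ 2 • Matrix.trace (copyProd F (quantumMatrix R F) 2 *
    scalars (QMAlgebra R F) (ybRep hB 2 (BMW.contractor2 q μ)))

/-- The elementary sums `e_0 = 1` and `e_i = ch(a^{(i)})` for `i ≥ 1`. -/
def elementarySum (hB : IsBMWType q μ R) (hS : IsSkewInvertible R) (F : TensorMat ι 2 ℂ) :
    ℕ → QMAlgebra R F
  | 0 => 1
  | i + 1 => ch hB hS F (BMW.antisymmetrizer q μ (i + 1))

end Tensor

end QuantumMatrix

end

noncomputable section

namespace QuantumMatrix

/-! ### Systems of generators satisfying the Birman--Murakami--Wenzl relations -/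

/-! Write k = j + m. On j + k strands let a be the antisymmetrizer on the first j strands, P the one
on the last k, and C the operator of j nested cups over j nested caps on the first 2j strands, so
that C pairs the strands of a with the first j strands of P. The R-trace of the copies of M times C
P is evaluated in two ways.

Algebraically, the cups contract j strands of P: C P C = α C a^(m), where a^(m) sits behind the cups
and α is a product of scalars `delta`, nonzero because μ = q^(1-k) (`cups_asym_cups`,
`delta_ne_zero`). Since C² = η^j C and the nested cups are conjugate to cups standing side by side,
each contributing η g, the trace of C P is α g^j e_m.

On the other hand P has rank one, so P C P = t P with an operator t on the first j strands only
(`cupTrace`). Generators slide through the cups from these strands into those of P, hence a t = t;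
the contraction formula gives t² = α t. Therefore a - α⁻¹ t a is idempotent, and its trace is, up to
a power of dim V, Tr a^(j) - Tr a^(m). The trace of an idempotent is a natural number, while
exchanging j and m reverses the sign of this one; so it vanishes and a = α⁻¹ t a
(`asym_eq_cupTrace_mul`). Now e_k e_j is the trace of a P, after a braid has interchanged the two
blocks, and this is α⁻¹ times the trace of t P = P C P, that is, of C P (`reciprocal_relation`).

The R-trace must be cyclic for braid operators, which holds because R commutes with D ⊗ D
(`commute_gen_weight_two`); invariant under shifting the copies, by compatibility of F with R
(`rtrN_twist`, `chi_succ`); and multiplicative on adjacent blocks (`chi_mul`). On the contractor it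
is μ² times the ordinary trace, since κ (D ⊗ D) = μ² κ (`kap_mul_weight`), a consequence of κ having
rank one (`exists_kappaMat_eq`). The antisymmetrizers are controlled by the fusion identity
`three_strand`.

All operators live in one algebra, the endomorphisms of A-valued functions of infinite sequences of
basis labels. Tensor powers of every size embed there at every position, and partial traces become
sums of E_xy T E_yx. -/

theorem opEquiv_symm_inv {B : Type*} [Ring B] (u : Bˣ) :
    (((Units.opEquiv.symm (MulOpposite.op u))⁻¹ : (Bᵐᵒᵖ)ˣ) : Bᵐᵒᵖ) = MulOpposite.op (↑u⁻¹ : B) :=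
  rfl

section System

variable {B : Type*} [Ring B] [Algebra ℂ B]

/-- An infinite sequence of elements of an algebra which satisfies the relations of the
Birman--Murakami--Wenzl algebras on all numbers of strands. -/
structure BMWSystem (q μ : ℂ) (s : ℕ → Bˣ) (e : ℕ → B) : Prop where
  braid (i : ℕ) : (s i : B) * s (i + 1) * s i = s (i + 1) * s i * s (i + 1)
  comm (i j : ℕ) : i + 1 < j → Commute (s i : B) (s j)
  kappa (i : ℕ) : e i = (μ * (q - q⁻¹))⁻¹ • ((q • 1 - (s i : B)) * (q⁻¹ • 1 + (s i : B)))
  s_e (i : ℕ) : (s i : B) * e i = μ • e i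
  e_s_adj (i j : ℕ) : i + 1 = j ∨ j + 1 = i → e i * s j = e i * e j * ↑(s i)⁻¹
  e_t_adj (i j : ℕ) : i + 1 = j ∨ j + 1 = i → e i * ↑(s j)⁻¹ = e i * e j * s i
  s_e_adj (i j : ℕ) : i + 1 = j ∨ j + 1 = i → (s j : B) * e i = ↑(s i)⁻¹ * e j * e i
  t_e_adj (i j : ℕ) : i + 1 = j ∨ j + 1 = i → (↑(s j)⁻¹ : B) * e i = s i * e j * e i
  e_e_e (i j : ℕ) : i + 1 = j ∨ j + 1 = i → e i * e j * e i = e i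
  e_e (i : ℕ) : e i * e i = eta q μ • e i

variable {q μ : ℂ} {s : ℕ → Bˣ} {e : ℕ → B}

namespace BMWSystem

theorem e_s (h : BMWSystem q μ s e) (i : ℕ) : e i * (s i : B) = μ • e i := by
  have hc : Commute (e i) (s i : B) := by
    rw [h.kappa]
    refine Commute.smul_left (Commute.mul_left ?_ ?_) _
    · exact ((Commute.one_left _).smul_left _).sub_left (Commute.refl _)
    · exact ((Commute.one_left _).smul_left _).add_left (Commute.refl _)
  rw [hc.eq, h.s_e]

theorem comm_s (h : BMWSystem q μ s e) {i j : ℕ} (hij : i + 1 < j ∨ j + 1 < i) :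
    Commute (s i : B) (s j) :=
  hij.elim (h.comm i j) fun hh => (h.comm j i hh).symm

theorem semiconj_e (h : BMWSystem q μ s e) {u : B} {i j : ℕ}
    (hu : SemiconjBy u (s i : B) (s j)) : SemiconjBy u (e i) (e j) := by
  rw [h.kappa, h.kappa]
  refine SemiconjBy.smul_right (SemiconjBy.mul_right ?_ ?_) _
  · exact ((SemiconjBy.one_right _).smul_right _).sub_right hu
  · exact ((SemiconjBy.one_right _).smul_right _).add_right hu

theorem comm_e (h : BMWSystem q μ s e) {u : B} {i : ℕ} (hu : Commute u (s i : B)) :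
    Commute u (e i) := h.semiconj_e hu

/-- The presentation is stable under reversal of words, which swaps the left-handed and right-handed
relations. This yields every right-sided statement below from its left-sided version. -/
theorem op (h : BMWSystem q μ s e) :
    BMWSystem q μ (fun i => Units.opEquiv.symm (MulOpposite.op (s i)))
      (fun i => MulOpposite.op (e i)) where
  braid i := MulOpposite.unop_injective (by simpa [mul_assoc] using h.braid i)
  comm i j hij := MulOpposite.unop_injective (by simpa using (h.comm i j hij).eq.symm)
  kappa i := MulOpposite.unop_injective (by
    have : Commute (q • 1 - (s i : B)) (q⁻¹ • 1 + (s i : B)) := by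
      refine Commute.add_right ?_ ?_
      · exact (Commute.one_right _).smul_right _
      · exact ((Commute.one_left _).smul_left _).sub_left (Commute.refl _)
    simpa [this.eq] using h.kappa i)
  s_e i := MulOpposite.unop_injective (by simpa using h.e_s i)
  e_s_adj i j hij := MulOpposite.unop_injective (by
    simpa [mul_assoc, opEquiv_symm_inv] using h.s_e_adj i j hij)
  e_t_adj i j hij := MulOpposite.unop_injective (by
    simpa [mul_assoc, opEquiv_symm_inv] using h.t_e_adj i j hij)
  s_e_adj i j hij := MulOpposite.unop_injective (by
    simpa [mul_assoc, opEquiv_symm_inv] using h.e_s_adj i j hij)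
  t_e_adj i j hij := MulOpposite.unop_injective (by
    simpa [mul_assoc, opEquiv_symm_inv] using h.e_t_adj i j hij)
  e_e_e i j hij := MulOpposite.unop_injective (by simpa [mul_assoc] using h.e_e_e i j hij)
  e_e i := MulOpposite.unop_injective (by simpa using h.e_e i)

theorem t_e (h : BMWSystem q μ s e) (hμ : μ ≠ 0) (i : ℕ) :
    (↑(s i)⁻¹ : B) * e i = μ⁻¹ • e i := by
  rw [Units.inv_mul_eq_iff_eq_mul, mul_smul_comm, h.s_e, smul_smul, inv_mul_cancel₀ hμ, one_smul]

/-- The quadratic relation with the defect term. -/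
theorem s_mul_s (h : BMWSystem q μ s e) (hq : q ≠ 0) (hl : q - q⁻¹ ≠ 0) (hμ : μ ≠ 0) (i : ℕ) :
    (s i : B) * s i = 1 + (q - q⁻¹) • (s i : B) - (μ * (q - q⁻¹)) • e i := by
  have h1 : (μ * (q - q⁻¹)) • e i = (q • 1 - (s i : B)) * (q⁻¹ • 1 + (s i : B)) := by
    rw [h.kappa, smul_smul, mul_inv_cancel₀ (mul_ne_zero hμ hl), one_smul]
  rw [h1]
  have h2 : q * q⁻¹ = 1 := mul_inv_cancel₀ hq
  simp only [sub_mul, mul_add, smul_mul_assoc, mul_smul_comm, one_mul, mul_one]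
  linear_combination (norm := module) h2 • (1 : B)

/-- The Kauffman skein relation: the quadratic relation divided by the generator. -/
theorem t_eq (h : BMWSystem q μ s e) (hq : q ≠ 0) (hl : q - q⁻¹ ≠ 0) (hμ : μ ≠ 0) (i : ℕ) :
    (↑(s i)⁻¹ : B) = s i - (q - q⁻¹) • 1 + (q - q⁻¹) • e i := by
  have h1 := congrArg (fun z => (↑(s i)⁻¹ : B) * z) (h.s_mul_s hq hl hμ i)
  simp only [mul_sub, mul_add, mul_smul_comm, Units.inv_mul_cancel_left, Units.inv_mul, mul_one,
    h.t_e hμ, smul_smul] at h1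
  have h2 : (μ * q - μ * q⁻¹) * μ⁻¹ = q - q⁻¹ := by field_simp
  rw [h2] at h1
  linear_combination (norm := module) (-1 : ℂ) • h1

/-- Two strands pass a cup. -/
theorem s_s_e (h : BMWSystem q μ s e) {i j : ℕ} (hij : i + 1 = j ∨ j + 1 = i) :
    (s i : B) * s j * e i = e j * e i := by
  rw [mul_assoc, h.s_e_adj i j hij]
  simp [mul_assoc]

theorem e_s_s (h : BMWSystem q μ s e) {i j : ℕ} (hij : i + 1 = j ∨ j + 1 = i) :
    e i * (s j : B) * s i = e i * e j := by
  rw [h.e_s_adj i j hij]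
  simp [mul_assoc]

theorem e_s_e (h : BMWSystem q μ s e) (hμ : μ ≠ 0) {i j : ℕ} (hij : i + 1 = j ∨ j + 1 = i) :
    e i * (s j : B) * e i = μ⁻¹ • e i := by
  rw [h.e_s_adj i j hij, mul_assoc, h.t_e hμ, mul_smul_comm, h.e_e_e i j hij]

end BMWSystem

/-! ### Antisymmetrizers -/

variable (q μ s e)

/-- The baxterized elements of a system of generators. -/
def bax (i : ℕ) (x : ℂ) : B :=
  1 + ((x - 1) / (q - q⁻¹)) • (s i : B) + (μ * (x - 1) / (μ + q * x)) • e i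

/-- The shifted `q`-antisymmetrizers of a system of generators. -/
def asym (p : ℕ) : ℕ → B
  | 0 => 1
  | 1 => 1
  | m + 2 => (q ^ (m + 1) / qNumber q (m + 2)) •
      (asym p (m + 1) * bax q μ s e (p + m) ((q⁻¹) ^ (2 * (m + 1))) * asym p (m + 1))

variable {q μ s e}

namespace BMWSystem

/-- The fusion mechanism: antisymmetry in position i is turned into antisymmetry in the neighbouring
position j. It plays the role of the Yang–Baxter equation for baxterized generators, but is checked
directly on the module generated by `a`. -/
theorem three_strand (h : BMWSystem q μ s e) (hq : q ≠ 0) (hl : q - q⁻¹ ≠ 0) (hμ : μ ≠ 0)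
    {i j : ℕ} (hij : i + 1 = j ∨ j + 1 = i) (x : ℂ) (hx : μ + q * x ≠ 0)
    (hx' : μ + q * (q ^ 2 * x) ≠ 0) (a : B) (ha : (s i : B) * a = -q⁻¹ • a) :
    (s j : B) * (bax q μ s e i (q ^ 2 * x) * bax q μ s e j x * a) =
      -q⁻¹ • (bax q μ s e i (q ^ 2 * x) * bax q μ s e j x * a) := by
  have hij' := hij.symm
  have hea : e i * a = 0 := by
    rw [h.kappa, smul_mul_assoc, mul_assoc, add_mul, ha]
    simp
  have hta : (↑(s i)⁻¹ : B) * a = -q • a := by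
    rw [Units.inv_mul_eq_iff_eq_mul, mul_smul_comm, ha, smul_smul]
    simp [hq]
  obtain ⟨α, hα⟩ : ∃ α, α = (x - 1) / (q - q⁻¹) := ⟨_, rfl⟩
  obtain ⟨α', hα'⟩ : ∃ α', α' = (q ^ 2 * x - 1) / (q - q⁻¹) := ⟨_, rfl⟩
  obtain ⟨β, hβ⟩ : ∃ β, β = μ * (x - 1) / (μ + q * x) := ⟨_, rfl⟩
  obtain ⟨β', hβ'⟩ : ∃ β', β' = μ * (q ^ 2 * x - 1) / (μ + q * (q ^ 2 * x)) := ⟨_, rfl⟩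
  have e1 : e i * ((s j : B) * a) = -q • (e i * (e j * a)) := by
    rw [← mul_assoc, h.e_s_adj i j hij, mul_assoc, hta, mul_smul_comm, mul_assoc]
  -- Everything lies in the span of the six vectors a, s_j a, e_j a, s_i s_j a, s_i e_j a, e_i e_j
  -- a, and `f1` to `f5` give the action of s_j on them.
  have hexp : bax q μ s e i (q ^ 2 * x) * bax q μ s e j x * a =
      (1 - α' * q⁻¹) • a + α • ((s j : B) * a) + β • (e j * a) +
        (α' * α) • ((s i : B) * ((s j : B) * a)) + (α' * β) • ((s i : B) * (e j * a)) +
        (-q * β' * α + β' * β) • (e i * (e j * a)) := by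
    rw [bax, bax, ← hα, ← hα', ← hβ, ← hβ']
    simp only [mul_add, add_mul, smul_mul_assoc, mul_smul_comm, one_mul, mul_one, mul_assoc, ha,
      hea, e1, smul_zero]
    module
  have f1 : (s j : B) * ((s j : B) * a) =
      a + (q - q⁻¹) • ((s j : B) * a) - (μ * (q - q⁻¹)) • (e j * a) := by
    rw [← mul_assoc, h.s_mul_s hq hl hμ]
    simp only [sub_mul, add_mul, smul_mul_assoc, one_mul]
  have f2 : (s j : B) * (e j * a) = μ • (e j * a) := by
    rw [← mul_assoc, h.s_e, smul_mul_assoc]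
  have hbr : (s j : B) * s i * s j = s i * s j * s i := by
    rcases hij with rfl | rfl
    · exact (h.braid i).symm
    · exact h.braid j
  have f3 : (s j : B) * ((s i : B) * ((s j : B) * a)) = -q⁻¹ • ((s i : B) * ((s j : B) * a)) := by
    rw [← mul_assoc, ← mul_assoc, hbr, mul_assoc, ha, mul_smul_comm, mul_assoc]
  have f4 : (s j : B) * ((s i : B) * (e j * a)) = e i * (e j * a) := by
    have := h.s_s_e hij'
    rw [← mul_assoc, ← mul_assoc, this, mul_assoc]
  have f5 : (s j : B) * (e i * (e j * a)) =
      (s i : B) * (e j * a) - (q - q⁻¹) • (e j * a) + (q - q⁻¹) • (e i * (e j * a)) := by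
    have := h.t_e_adj j i hij'
    rw [← mul_assoc, ← mul_assoc, ← this, h.t_eq hq hl hμ]
    simp only [sub_mul, add_mul, smul_mul_assoc, one_mul, mul_assoc]
  rw [hexp]
  simp only [mul_add, mul_smul_comm, f1, f2, f3, f4, f5]
  have hx3 : μ + q ^ 3 * x ≠ 0 := by convert hx' using 2; ring
  have hx4 : μ + x * q ≠ 0 := by rwa [mul_comm x]
  have hq1 : q ^ 2 - 1 ≠ 0 := by
    intro h0
    apply hl
    field_simp
    simpa using h0
  -- Comparison of coefficients. These scalar identities hold because the two spectral parameters
  -- have ratio q².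
  have c1 : α = -q⁻¹ * (1 - α' * q⁻¹) := by
    rw [hα, hα']; field_simp; ring
  have c2 : 1 - α' * q⁻¹ + α * (q - q⁻¹) = -q⁻¹ * α := by
    rw [hα, hα']; field_simp; ring
  have c3 : -q * β' * α + β' * β = -q⁻¹ * (α' * β) := by
    rw [hα, hα', hβ, hβ']; field_simp; ring
  have c4 : -(α * (μ * (q - q⁻¹))) + β * μ - (q - q⁻¹) * (-q * β' * α + β' * β) = -q⁻¹ * β := by
    rw [c3, hα, hα', hβ]; field_simp; ring
  have c5 : α' * β + (q - q⁻¹) * (-q * β' * α + β' * β) = -q⁻¹ * (-q * β' * α + β' * β) := by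
    rw [c3]; field_simp; ring
  set γ := -q * β' * α + β' * β
  clear_value γ
  linear_combination (norm := module) c1 • a + c2 • ((s j : B) * a) + c4 • (e j * a) +
    c3 • ((s i : B) * (e j * a)) + c5 • (e i * (e j * a))

end BMWSystem
end System
section System

variable {B : Type*} [Ring B] [Algebra ℂ B] {q μ : ℂ} {s : ℕ → Bˣ} {e : ℕ → B}

/-! ### Consequences of the restrictions on the parameters -/

namespace AdmissibleParameters

variable {k : ℕ}

theorem sub_ne (h : AdmissibleParameters q μ k) (hk : 1 ≤ k) : q - q⁻¹ ≠ 0 := by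
  have h1 := h.q_pow_ne_one 1 le_rfl hk
  intro h0
  apply h1
  have hq := h.q_ne_zero
  field_simp at h0
  linear_combination h0

theorem qNumber_ne (h : AdmissibleParameters q μ k) {m : ℕ} (h1 : 1 ≤ m) (hm : m ≤ k) :
    qNumber q m ≠ 0 := by
  have hq := h.q_ne_zero
  refine div_ne_zero ?_ (h.sub_ne (h1.trans hm))
  intro h0
  apply h.q_pow_ne_one m h1 hm
  rw [sub_eq_zero, inv_pow, ← mul_eq_one_iff_eq_inv₀ (pow_ne_zero _ hq)] at h0
  rw [two_mul, pow_add, h0]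

theorem add_ne (h : AdmissibleParameters q μ k) {m : ℕ} (h1 : 1 ≤ m) (hm : m ≤ k) :
    μ + q * (q⁻¹) ^ (2 * m) ≠ 0 := by
  have hq := h.q_ne_zero
  intro h0
  apply h.mu_ne m h1 hm
  rw [zpow_sub₀ hq, zpow_one, div_eq_mul_inv, ← zpow_neg]
  have : q ^ (-(2 * (m : ℤ))) = (q⁻¹) ^ (2 * m) := by
    rw [zpow_neg, inv_pow]
    norm_cast
  rw [this]
  linear_combination h0

theorem eta_ne (h : AdmissibleParameters q μ k) (hk : 1 ≤ k) : eta q μ ≠ 0 := by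
  have hq := h.q_ne_zero
  refine div_ne_zero (mul_ne_zero (sub_ne_zero.2 h.mu_ne_q.symm) ?_)
    (mul_ne_zero h.mu_ne_zero (h.sub_ne hk))
  intro h0
  apply h.mu_ne 1 le_rfl hk
  norm_num
  linear_combination h0

end AdmissibleParameters

/-! ### Properties of antisymmetrizers -/

theorem sq_sub_one_ne (hl : q - q⁻¹ ≠ 0) (hq : q ≠ 0) : q ^ 2 - 1 ≠ 0 := by
  intro h0
  apply hl
  field_simp
  simpa using h0

theorem qNumber_mul (hl : q - q⁻¹ ≠ 0) (m : ℕ) :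
    q ^ m - q⁻¹ ^ m = (q - q⁻¹) * qNumber q m := by
  rw [qNumber, mul_div_assoc', mul_div_cancel_left₀ _ hl]

theorem semiconj_bax (h : BMWSystem q μ s e) {u : B} {i j : ℕ} (x : ℂ)
    (hu : SemiconjBy u (s i : B) (s j)) : SemiconjBy u (bax q μ s e i x) (bax q μ s e j x) :=
  ((SemiconjBy.one_right _).add_right (hu.smul_right _)).add_right
    ((h.semiconj_e hu).smul_right _)

/-- Antisymmetrizers are words in the generators, so whatever transports the generators transports
them. This one principle gives commutation with distant elements, shifts along the chain, and
interchange of blocks. -/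
theorem semiconj_asym (h : BMWSystem q μ s e) {u : B} {p p' : ℕ} :
    ∀ m : ℕ, (∀ i, i + 1 < m → SemiconjBy u (s (p + i) : B) (s (p' + i))) →
      SemiconjBy u (asym q μ s e p m) (asym q μ s e p' m)
  | 0, _ => SemiconjBy.one_right _
  | 1, _ => SemiconjBy.one_right _
  | m + 2, hu => by
    have ih := semiconj_asym h (m + 1) fun i hi => hu i (by omega)
    exact SemiconjBy.smul_right ((ih.mul_right (semiconj_bax h _ (hu m (by omega)))).mul_right ih) _

theorem commute_asym (h : BMWSystem q μ s e) {u : B} {p : ℕ} (m : ℕ)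
    (hu : ∀ i, p ≤ i → i + 1 < p + m → Commute u (s i : B)) : Commute u (asym q μ s e p m) :=
  semiconj_asym h m fun i hi => hu (p + i) (by omega) (by omega)

theorem asym_op (p : ℕ) : ∀ m : ℕ,
    asym q μ (fun i => Units.opEquiv.symm (MulOpposite.op (s i)))
      (fun i => MulOpposite.op (e i)) p m = MulOpposite.op (asym q μ s e p m)
  | 0 => rfl
  | 1 => rfl
  | m + 2 => by
    simp only [asym, asym_op p (m + 1), bax, Units.coe_opEquiv_symm, MulOpposite.op_smul,
      MulOpposite.op_mul, MulOpposite.op_add, MulOpposite.op_one, mul_assoc, MulOpposite.unop_op]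

theorem e_mul_eq_zero (h : BMWSystem q μ s e) {i : ℕ} {a : B} (ha : (s i : B) * a = -q⁻¹ • a) :
    e i * a = 0 := by
  rw [h.kappa, smul_mul_assoc, mul_assoc, add_mul, ha]
  simp

/-- On an antisymmetric vector the generator acts by -q⁻¹ and the contractor, which has q⁻¹ + σ as a
factor, by zero. -/
theorem bax_mul (h : BMWSystem q μ s e) (hl : q - q⁻¹ ≠ 0) (hq : q ≠ 0) {i : ℕ} {a : B}
    (ha : (s i : B) * a = -q⁻¹ • a) (x : ℂ) :
    bax q μ s e i x * a = ((q - q⁻¹ * x) / (q - q⁻¹)) • a := by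
  have hq1 := sq_sub_one_ne hl hq
  rw [bax, add_mul, add_mul, smul_mul_assoc, smul_mul_assoc, e_mul_eq_zero h ha, ha, one_mul,
    smul_zero, add_zero, smul_smul, show (q - q⁻¹ * x) / (q - q⁻¹) =
      1 + (x - 1) / (q - q⁻¹) * -q⁻¹ by field_simp; ring]
  module

/-- The normalization in the recursion is the inverse of the scalar in `bax_mul`; this is what makes
the antisymmetrizers idempotent. -/
theorem coeff_mul_coeff (hl : q - q⁻¹ ≠ 0) (hq : q ≠ 0) (m : ℕ) (hm : qNumber q (m + 1) ≠ 0) :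
    q ^ m / qNumber q (m + 1) * ((q - q⁻¹ * (q⁻¹) ^ (2 * m)) / (q - q⁻¹)) = 1 := by
  rw [div_mul_div_comm, div_eq_one_iff_eq (mul_ne_zero hm hl), mul_comm (qNumber _ _),
    ← qNumber_mul hl]
  rw [mul_sub, ← pow_succ, ← pow_succ']
  congr 1
  rw [show 2 * m + 1 = m + (m + 1) by ring, pow_add q⁻¹ m, ← mul_assoc, ← mul_pow,
    mul_inv_cancel₀ hq, one_pow, one_mul]

/-- The fusion step. -/
theorem fuse (h : BMWSystem q μ s e) (hq : q ≠ 0) (hl : q - q⁻¹ ≠ 0) (hμ : μ ≠ 0)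
    {i j : ℕ} (hij : i + 1 = j ∨ j + 1 = i) (x : ℂ) (hx : μ + q * x ≠ 0)
    (hx' : μ + q * (q ^ 2 * x) ≠ 0) (a b : B) (c : ℂ) (ha : (s i : B) * a = -q⁻¹ • a)
    (hab : a = c • (b * bax q μ s e i (q ^ 2 * x) * b)) (hb : b * b = b)
    (hbj : Commute b (s j : B)) :
    (s j : B) * (a * bax q μ s e j x * a) = -q⁻¹ • (a * bax q μ s e j x * a) := by
  have hba : b * a = a := by
    rw [hab, mul_smul_comm]
    simp only [← mul_assoc, hb]
  have hbax : Commute b (bax q μ s e j x) := semiconj_bax h x hbj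
  have key : a * bax q μ s e j x * a =
      c • (b * (bax q μ s e i (q ^ 2 * x) * bax q μ s e j x * a)) := by
    conv_lhs => rw [hab]
    rw [smul_mul_assoc, smul_mul_assoc, ← hab]
    congr 1
    simp only [mul_assoc]
    rw [← mul_assoc b (bax q μ s e j x), hbax.eq, mul_assoc, hba]
  rw [key, mul_smul_comm, ← mul_assoc, ← hbj.eq, mul_assoc,
    h.three_strand hq hl hμ hij x hx hx' a ha, mul_smul_comm, smul_comm]

theorem fuse_right (h : BMWSystem q μ s e) (hq : q ≠ 0) (hl : q - q⁻¹ ≠ 0) (hμ : μ ≠ 0)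
    {i j : ℕ} (hij : i + 1 = j ∨ j + 1 = i) (x : ℂ) (hx : μ + q * x ≠ 0)
    (hx' : μ + q * (q ^ 2 * x) ≠ 0) (a b : B) (c : ℂ) (ha : a * (s i : B) = -q⁻¹ • a)
    (hab : a = c • (b * bax q μ s e i (q ^ 2 * x) * b)) (hb : b * b = b)
    (hbj : Commute b (s j : B)) :
    a * bax q μ s e j x * a * (s j : B) = -q⁻¹ • (a * bax q μ s e j x * a) := by
  have hbx : ∀ (i : ℕ) (x : ℂ), bax q μ (fun i => Units.opEquiv.symm (MulOpposite.op (s i)))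
      (fun i => MulOpposite.op (e i)) i x = MulOpposite.op (bax q μ s e i x) := fun i x => rfl
  have := fuse h.op hq hl hμ hij x hx hx' (MulOpposite.op a) (MulOpposite.op b) c
    (MulOpposite.unop_injective (by simpa using ha))
    (MulOpposite.unop_injective (by simpa [hbx, mul_assoc] using hab))
    (MulOpposite.unop_injective (by simpa using hb))
    (MulOpposite.unop_injective (by simpa using hbj.eq.symm))
  have := congrArg MulOpposite.unop this
  simpa [hbx, mul_assoc] using this

/-- The main properties of the antisymmetrizer on `m` strands. -/
structure IsAntisymmetric (q μ : ℂ) (s : ℕ → Bˣ) (e : ℕ → B) (p m : ℕ) (a : B) : Prop where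
  left (i : ℕ) : p ≤ i → i + 1 < p + m → (s i : B) * a = -q⁻¹ • a
  right (i : ℕ) : p ≤ i → i + 1 < p + m → a * (s i : B) = -q⁻¹ • a
  idem : a * a = a

/-- Each factor of the recursion acts on an antisymmetric vector by a scalar, and the normalization
makes the total scalar 1. -/
theorem asym_mul_of_left (h : BMWSystem q μ s e) {k : ℕ}
    (hp : AdmissibleParameters q μ k) {p m : ℕ} {a : B}
    (ha : ∀ i, p ≤ i → i + 1 < p + m → (s i : B) * a = -q⁻¹ • a) :
    ∀ (p' m' : ℕ), m' ≤ k → p ≤ p' → p' + m' ≤ p + m → asym q μ s e p' m' * a = a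
  | _, 0, _, _, _ => one_mul a
  | _, 1, _, _, _ => one_mul a
  | p', m' + 2, hm, h1, h2 => by
    have ih := asym_mul_of_left h hp ha p' (m' + 1) (by omega) h1 (by omega)
    have hl := hp.sub_ne (by omega)
    rw [asym, smul_mul_assoc, mul_assoc, mul_assoc, ih,
      bax_mul h hl hp.q_ne_zero (ha _ (by omega) (by omega)), mul_smul_comm, ih, smul_smul,
      coeff_mul_coeff hl hp.q_ne_zero _ (hp.qNumber_ne (by omega) hm), one_smul]

theorem IsAntisymmetric.mul_asym (h : BMWSystem q μ s e) {k : ℕ}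
    (hp : AdmissibleParameters q μ k) {p m : ℕ} {a : B} (ha : IsAntisymmetric q μ s e p m a)
    (p' m' : ℕ) (hm : m' ≤ k) (h1 : p ≤ p') (h2 : p' + m' ≤ p + m) :
    asym q μ s e p' m' * a = a :=
  asym_mul_of_left h hp ha.left p' m' hm h1 h2

theorem isAntisymmetric_op {p m : ℕ} {a : B}
    (ha : IsAntisymmetric q μ s e p m a) :
    IsAntisymmetric q μ (fun i => Units.opEquiv.symm (MulOpposite.op (s i)))
      (fun i => MulOpposite.op (e i)) p m (MulOpposite.op a) where
  left i h1 h2 := MulOpposite.unop_injective (by simpa using ha.right i h1 h2)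
  right i h1 h2 := MulOpposite.unop_injective (by simpa using ha.left i h1 h2)
  idem := MulOpposite.unop_injective (by simpa using ha.idem)

theorem IsAntisymmetric.asym_mul (h : BMWSystem q μ s e) {k : ℕ}
    (hp : AdmissibleParameters q μ k) {p m : ℕ} {a : B} (ha : IsAntisymmetric q μ s e p m a)
    (p' m' : ℕ) (hm : m' ≤ k) (h1 : p ≤ p') (h2 : p' + m' ≤ p + m) :
    a * asym q μ s e p' m' = a := by
  have := (isAntisymmetric_op ha).mul_asym h.op hp p' m' hm h1 h2
  rw [asym_op] at this
  exact MulOpposite.op_injective this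

/-- Both recursions for the antisymmetrizers give the same elements. -/
theorem isAntisymmetric_asym (h : BMWSystem q μ s e) {k : ℕ} (hp : AdmissibleParameters q μ k) :
    ∀ (m : ℕ), m ≤ k → ∀ p : ℕ, IsAntisymmetric q μ s e p m (asym q μ s e p m) ∧
      ∀ n, m = n + 2 → asym q μ s e p m = (q ^ (n + 1) / qNumber q (n + 2)) •
        (asym q μ s e (p + 1) (n + 1) * bax q μ s e p ((q⁻¹) ^ (2 * (n + 1))) *
          asym q μ s e (p + 1) (n + 1))
  | 0, _, p => ⟨⟨fun i _ _ => by omega, fun i _ _ => by omega, one_mul _⟩, by simp⟩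
  | 1, _, p => ⟨⟨fun i _ _ => by omega, fun i _ _ => by omega, one_mul _⟩, by simp⟩
  | m + 2, hm, p => by
    have IH := isAntisymmetric_asym h hp (m + 1) (by omega)
    have IH' : ∀ n, n < m → ∀ p, asym q μ s e p (n + 1) * asym q μ s e p (n + 1) =
        asym q μ s e p (n + 1) := fun n hn p =>
      (isAntisymmetric_asym h hp (n + 1) (by omega) p).1.idem
    have hq := hp.q_ne_zero
    have hl := hp.sub_ne (by omega)
    have hμ := hp.mu_ne_zero
    have hx := hp.add_ne (m := m + 1) (by omega) (by omega)
    have hqx : ∀ r, q ^ 2 * q⁻¹ ^ (2 * (r + 1)) = q⁻¹ ^ (2 * r) := by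
      intro r
      rw [show 2 * (r + 1) = 2 + 2 * r by ring, pow_add, ← mul_assoc, ← mul_pow,
        mul_inv_cancel₀ hq, one_pow, one_mul]
    -- Base of the fusion, on two strands: at x = q⁻² the baxterized generator is itself
    -- antisymmetric, by the quadratic relation.
    have hsing : ∀ i j : ℕ, j + 1 = i ∨ i + 1 = j → m = 0 →
        (s i : B) * bax q μ s e i (q⁻¹ ^ (2 * (m + 1))) =
          -q⁻¹ • bax q μ s e i (q⁻¹ ^ (2 * (m + 1))) := by
      rintro i j - rfl
      have hx0 : q⁻¹ ^ (2 * (0 + 1)) = (q ^ 2)⁻¹ := by norm_num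
      have hx1 : μ + q * (q ^ 2)⁻¹ ≠ 0 := hx0 ▸ hx
      have hx2 : μ * q + 1 ≠ 0 := by
        intro h0
        apply hx1
        field_simp
        linear_combination h0
      have hx3 : q * μ + 1 ≠ 0 := by rwa [mul_comm]
      have hq1 := sq_sub_one_ne hl hq
      simp only [hx0, bax, mul_add, mul_smul_comm, mul_one, h.s_e, h.s_mul_s hq hl hμ]
      match_scalars
      all_goals field_simp
      all_goals ring
    -- The two alternatives add a strand on the right, (p, p + m), or on the left, (p + 1, p), of a
    -- shorter antisymmetrizer.
    have build : ∀ (p' j : ℕ), (p' = p ∧ j = p + m ∨ p' = p + 1 ∧ j = p) →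
        IsAntisymmetric q μ s e p (m + 2) ((q ^ (m + 1) / qNumber q (m + 2)) •
          (asym q μ s e p' (m + 1) * bax q μ s e j (q⁻¹ ^ (2 * (m + 1))) *
            asym q μ s e p' (m + 1))) := by
      intro p' j hpj
      have A := (IH p').1
      have hL : (s j : B) * (asym q μ s e p' (m + 1) * bax q μ s e j (q⁻¹ ^ (2 * (m + 1))) *
            asym q μ s e p' (m + 1)) = -q⁻¹ • (asym q μ s e p' (m + 1) *
              bax q μ s e j (q⁻¹ ^ (2 * (m + 1))) * asym q μ s e p' (m + 1)) ∧
          (asym q μ s e p' (m + 1) * bax q μ s e j (q⁻¹ ^ (2 * (m + 1))) *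
            asym q μ s e p' (m + 1)) * (s j : B) = -q⁻¹ • (asym q μ s e p' (m + 1) *
              bax q μ s e j (q⁻¹ ^ (2 * (m + 1))) * asym q μ s e p' (m + 1)) := by
        rcases m with - | n
        · have h1 := hsing j (j + 1) (by omega) rfl
          have hc : Commute (bax q μ s e j (q⁻¹ ^ (2 * (0 + 1)))) (s j : B) :=
            (semiconj_bax h _ (Commute.refl (s j : B))).symm
          simp only [asym, one_mul, mul_one]
          exact ⟨h1, hc.eq.trans h1⟩
        · have hx' : μ + q * (q ^ 2 * q⁻¹ ^ (2 * (n + 1 + 1))) ≠ 0 := by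
            rw [hqx]
            exact hp.add_ne (by omega) (by omega)
          rcases hpj with ⟨rfl, rfl⟩ | ⟨rfl, rfl⟩
          · have hb := IH' n (by omega) p'
            have hc : Commute (asym q μ s e p' (n + 1)) (s (p' + (n + 1)) : B) :=
              (commute_asym h _ fun i h1 h2 => h.comm_s (by omega)).symm
            have hab : asym q μ s e p' (n + 2) = (q ^ (n + 1) / qNumber q (n + 2)) •
                (asym q μ s e p' (n + 1) *
                  bax q μ s e (p' + n) (q ^ 2 * q⁻¹ ^ (2 * (n + 1 + 1))) *
                  asym q μ s e p' (n + 1)) := by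
              rw [hqx, asym]
            exact ⟨fuse h hq hl hμ (by omega) _ hx hx' _ _ _ (A.left _ (by omega) (by omega))
                hab hb hc,
              fuse_right h hq hl hμ (by omega) _ hx hx' _ _ _ (A.right _ (by omega) (by omega))
                hab hb hc⟩
          · have hb := IH' n (by omega) (j + 1 + 1)
            have hc : Commute (asym q μ s e (j + 1 + 1) (n + 1)) (s j : B) :=
              (commute_asym h _ fun i h1 h2 => h.comm_s (by omega)).symm
            have hab : asym q μ s e (j + 1) (n + 2) = (q ^ (n + 1) / qNumber q (n + 2)) •
                (asym q μ s e (j + 1 + 1) (n + 1) *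
                  bax q μ s e (j + 1) (q ^ 2 * q⁻¹ ^ (2 * (n + 1 + 1))) *
                  asym q μ s e (j + 1 + 1) (n + 1)) := by
              rw [hqx]
              exact (IH (j + 1)).2 n rfl
            exact ⟨fuse h hq hl hμ (by omega) _ hx hx' _ _ _ (A.left _ (by omega) (by omega))
                hab hb hc,
              fuse_right h hq hl hμ (by omega) _ hx hx' _ _ _ (A.right _ (by omega) (by omega))
                hab hb hc⟩
      have hleft : ∀ i, p ≤ i → i + 1 < p + (m + 2) →
          (s i : B) * ((q ^ (m + 1) / qNumber q (m + 2)) •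
          (asym q μ s e p' (m + 1) * bax q μ s e j (q⁻¹ ^ (2 * (m + 1))) *
            asym q μ s e p' (m + 1))) = -q⁻¹ • ((q ^ (m + 1) / qNumber q (m + 2)) •
          (asym q μ s e p' (m + 1) * bax q μ s e j (q⁻¹ ^ (2 * (m + 1))) *
            asym q μ s e p' (m + 1))) := by
        intro i h1 h2
        rw [mul_smul_comm, smul_comm]
        congr 1
        -- Only the new generator needs fusion; every other one already acts on the shorter
        -- antisymmetrizer.
        by_cases hi : i = j
        · rw [hi, hL.1]
        · rw [← mul_assoc, ← mul_assoc, A.left i (by omega) (by omega), smul_mul_assoc,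
            smul_mul_assoc]
      refine ⟨hleft, ?_, ?_⟩
      · intro i h1 h2
        rw [smul_mul_assoc, smul_comm]
        congr 1
        by_cases hi : i = j
        · rw [hi, hL.2]
        · rw [mul_assoc, A.right i (by omega) (by omega), mul_smul_comm]
      · have hsub : asym q μ s e p' (m + 1) * ((q ^ (m + 1) / qNumber q (m + 2)) •
          (asym q μ s e p' (m + 1) * bax q μ s e j (q⁻¹ ^ (2 * (m + 1))) *
            asym q μ s e p' (m + 1))) = (q ^ (m + 1) / qNumber q (m + 2)) •
          (asym q μ s e p' (m + 1) * bax q μ s e j (q⁻¹ ^ (2 * (m + 1))) *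
            asym q μ s e p' (m + 1)) := by
          rw [mul_smul_comm, ← mul_assoc, ← mul_assoc, A.idem]
        have hj := hleft j (by omega) (by omega)
        conv_lhs => rw [smul_mul_assoc, mul_assoc, mul_assoc, hsub]
        rw [bax_mul h hl hq hj, mul_smul_comm, hsub, smul_smul,
          coeff_mul_coeff hl hq (m + 1) (hp.qNumber_ne (by omega) hm), one_smul]
    have b1 := build p (p + m) (Or.inl ⟨rfl, rfl⟩)
    have b2 := build (p + 1) p (Or.inr ⟨rfl, rfl⟩)
    refine ⟨b1, fun n hn => ?_⟩
    obtain rfl : n = m := by omega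
    -- The product of the left-built and the right-built element equals each of them, because either
    -- one absorbs the other.
    have c1 := b2.asym_mul h hp p (n + 2) hm le_rfl le_rfl
    have c2 := b1.asym_mul h hp (p + 1) (n + 1) (by omega) (by omega) (by omega)
    rw [← c1]
    have hj := b1.left p (by omega) (by omega)
    have c3 := b1.mul_asym h hp (p + 1) (n + 1) (by omega) (by omega) (by omega)
    change asym q μ s e p (n + 2) = _ * asym q μ s e p (n + 2)
    rw [← asym] at c3 hj
    rw [smul_mul_assoc, mul_assoc, mul_assoc, c3, bax_mul h hl hq hj, mul_smul_comm, c3, smul_smul,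
      coeff_mul_coeff hl hq (n + 1) (hp.qNumber_ne (by omega) hm), one_smul]
  termination_by m => m

end System
/-! ### Braids moving blocks of strands -/

/-- The braid `s_{p+n-1} ⋯ s_p`, which moves the strand `p` across the next `n` strands. -/
def desc {G : Type*} [Monoid G] (s : ℕ → G) (p : ℕ) : ℕ → G
  | 0 => 1
  | n + 1 => s (p + n) * desc s p n

/-- The braid which moves the first `j` strands across the next `k` strands. -/
def swapBraid {G : Type*} [Monoid G] (s : ℕ → G) (k : ℕ) : ℕ → G
  | 0 => 1
  | j + 1 => swapBraid s k j * desc s j k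

theorem desc_succ' {G : Type*} [Monoid G] (s : ℕ → G) (p : ℕ) : ∀ n : ℕ,
    desc s p (n + 1) = desc s (p + 1) n * s p
  | 0 => by simp [desc]
  | n + 1 => by
    rw [desc, desc_succ' s p n, desc, mul_assoc, show p + (n + 1) = p + 1 + n by ring]

section Monoid

variable {B : Type*} [Monoid B] {s : ℕ → Bˣ}

theorem commute_desc {u : B} {p : ℕ} : ∀ {n : ℕ},
    (∀ i, p ≤ i → i < p + n → Commute u (s i : B)) → Commute u (desc s p n : Bˣ)
  | 0, _ => by simp [desc]
  | n + 1, hu => by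
    rw [desc, Units.val_mul]
    exact (hu _ (by omega) (by omega)).mul_right (commute_desc fun i h1 h2 => hu i h1 (by omega))

theorem semiconj_desc_right {u : B} {p p' : ℕ} : ∀ {n : ℕ},
    (∀ i, i < n → SemiconjBy u (s (p + i) : B) (s (p' + i))) →
      SemiconjBy u (desc s p n : Bˣ) (desc s p' n : Bˣ)
  | 0, _ => by simp [desc]
  | n + 1, hu => by
    rw [desc, Units.val_mul, desc, Units.val_mul]
    exact (hu _ (by omega)).mul_right (semiconj_desc_right fun i h1 => hu i (by omega))

theorem commute_swapBraid {u : B} {k : ℕ} : ∀ {j : ℕ},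
    (∀ i, i + 1 < j + k → Commute u (s i : B)) → Commute u (swapBraid s k j : Bˣ)
  | 0, _ => by simp [swapBraid]
  | j + 1, hu => by
    rw [swapBraid, Units.val_mul]
    exact (commute_swapBraid fun i h1 => hu i (by omega)).mul_right
      (commute_desc fun i h1 h2 => hu i (by omega))

end Monoid

section System

variable {B : Type*} [Ring B] [Algebra ℂ B] {q μ : ℂ} {s : ℕ → Bˣ} {e : ℕ → B}

/-- A strand passing across a row of strands moves each crossing of that row by one place; the only
non-trivial case is a single braid relation. -/
theorem semiconj_desc (h : BMWSystem q μ s e) {p i : ℕ} (hi : p ≤ i) : ∀ {n : ℕ}, i + 1 < p + n →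
    SemiconjBy ((desc s p n : Bˣ) : B) (s (i + 1) : B) (s i)
  | 0, h1 => by omega
  | 1, h1 => by omega
  | n + 2, h1 => by
    rw [desc, Units.val_mul]
    by_cases h2 : i + 1 < p + (n + 1)
    · exact SemiconjBy.mul_left (h.comm_s (by omega)) (semiconj_desc h hi h2)
    · obtain rfl : i = p + n := by omega
      rw [desc, Units.val_mul, ← mul_assoc]
      refine SemiconjBy.mul_left ?_ (commute_desc fun i h3 h4 => h.comm_s (by omega)).symm
      have := h.braid (p + n)
      rw [SemiconjBy, ← mul_assoc, ← add_assoc, ← this]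

/-- Two neighbouring strands carried together across n others keep their mutual crossing. -/
theorem semiconj_desc_desc (h : BMWSystem q μ s e) (p : ℕ) : ∀ n : ℕ,
    SemiconjBy ((desc s p n : Bˣ) * (desc s (p + 1) n : Bˣ) : B) (s p : B) (s (p + n))
  | 0 => by simp [desc, SemiconjBy]
  | n + 1 => by
    have hc : Commute ((desc s p n : Bˣ) : B) (s (p + 1 + n) : B) :=
      (commute_desc fun i h3 h4 => h.comm_s (by omega)).symm
    have : ((desc s p (n + 1) : Bˣ) * (desc s (p + 1) (n + 1) : Bˣ) : B) =
        s (p + n) * s (p + 1 + n) * ((desc s p n : Bˣ) * (desc s (p + 1) n : Bˣ)) := by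
      simp only [desc, Units.val_mul, mul_assoc]
      rw [← mul_assoc ((desc s p n : Bˣ) : B) (s (p + 1 + n) : B), hc.eq, mul_assoc]
    rw [this]
    refine SemiconjBy.mul_left ?_ (semiconj_desc_desc h p n)
    have := h.braid (p + n)
    rw [SemiconjBy, show p + 1 + n = p + n + 1 by ring, this, ← mul_assoc]
    rfl

/-- The block braid carries the crossings of the second block to the front; `semiconj_swapBraid'`
does the same for the first block, which goes to the back. -/
theorem semiconj_swapBraid (h : BMWSystem q μ s e) {k i : ℕ} (hi : i + 1 < k) : ∀ j : ℕ,
    SemiconjBy ((swapBraid s k j : Bˣ) : B) (s (j + i) : B) (s i)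
  | 0 => by simp [swapBraid]
  | j + 1 => by
    rw [swapBraid, Units.val_mul]
    refine SemiconjBy.mul_left (semiconj_swapBraid h hi j) ?_
    rw [show j + 1 + i = j + i + 1 by ring]
    exact semiconj_desc h (by omega) (by omega)

theorem semiconj_swapBraid' (h : BMWSystem q μ s e) {k i : ℕ} : ∀ j : ℕ, i + 1 < j →
    SemiconjBy ((swapBraid s k j : Bˣ) : B) (s i : B) (s (k + i))
  | 0, _ => by omega
  | 1, _ => by omega
  | j + 2, hi => by
    rw [swapBraid, Units.val_mul]
    by_cases h2 : i + 1 < j + 1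
    · exact SemiconjBy.mul_left (semiconj_swapBraid' h (j + 1) h2)
        (commute_desc fun i h3 h4 => h.comm_s (by omega)).symm
    · obtain rfl : i = j := by omega
      rw [swapBraid, Units.val_mul, mul_assoc]
      refine SemiconjBy.mul_left (commute_swapBraid fun r hr => h.comm_s (by omega)).symm ?_
      rw [add_comm k]
      exact semiconj_desc_desc h i k

/-! ### Nested cups -/

/-- The product of `j` nested cups and `j` nested caps on the strands `p, …, p + 2 j - 1`. -/
def cups (s : ℕ → Bˣ) (e : ℕ → B) : ℕ → ℕ → B
  | 0, _ => 1
  | j + 1, p => (desc s (p + 1) (2 * j) : Bˣ) * (e p * cups s e j (p + 2)) *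
      (↑(desc s (p + 1) (2 * j))⁻¹ : B)

theorem semiconj_cups (h : BMWSystem q μ s e) {u : B} : ∀ {j p p' : ℕ},
    (∀ i, i + 1 < 2 * j → SemiconjBy u (s (p + i) : B) (s (p' + i))) →
      SemiconjBy u (cups s e j p) (cups s e j p')
  | 0, _, _, _ => SemiconjBy.one_right _
  | j + 1, p, p', hu => by
    have h1 : SemiconjBy u ((desc s (p + 1) (2 * j) : Bˣ) : B)
        ((desc s (p' + 1) (2 * j) : Bˣ) : B) := semiconj_desc_right fun i hi => by
      have := hu (1 + i) (by omega)
      rwa [← add_assoc, ← add_assoc] at this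
    have h2 : SemiconjBy u (cups s e j (p + 2)) (cups s e j (p' + 2)) :=
      semiconj_cups h fun i hi => by
        have := hu (2 + i) (by omega)
        rwa [← add_assoc, ← add_assoc] at this
    exact (h1.mul_right ((h.semiconj_e (hu 0 (by omega))).mul_right h2)).mul_right
      h1.units_inv_right

theorem commute_cups (h : BMWSystem q μ s e) {u : B} {j p : ℕ}
    (hu : ∀ i, p ≤ i → i + 1 < p + 2 * j → Commute u (s i : B)) : Commute u (cups s e j p) :=
  semiconj_cups h fun i hi => hu (p + i) (by omega) (by omega)

theorem desc_cups (h : BMWSystem q μ s e) (j p : ℕ) :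
    SemiconjBy ((desc s (p + 1) (2 * j) : Bˣ) : B) (cups s e j (p + 2)) (cups s e j (p + 1)) :=
  semiconj_cups h fun i hi => by
    rw [show p + 2 + i = p + 1 + i + 1 by ring]
    exact semiconj_desc h (by omega) (by omega)

theorem commute_e_cups (h : BMWSystem q μ s e) (j p : ℕ) : Commute (e p) (cups s e j (p + 2)) :=
  commute_cups h fun i h1 h2 => (h.comm_e (h.comm_s (by omega))).symm

/-- The outermost cup splits off. -/
theorem cups_succ (h : BMWSystem q μ s e) (j p : ℕ) :
    cups s e (j + 1) p = (desc s (p + 1) (2 * j) : Bˣ) * e p * (↑(desc s (p + 1) (2 * j))⁻¹ : B) *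
      cups s e j (p + 1) := by
  have := (desc_cups h j p).units_inv_symm_left
  rw [cups, mul_assoc, mul_assoc, mul_assoc, mul_assoc, this.eq]

theorem cups_succ' (h : BMWSystem q μ s e) (j p : ℕ) :
    cups s e (j + 1) p = cups s e j (p + 1) *
      ((desc s (p + 1) (2 * j) : Bˣ) * e p * (↑(desc s (p + 1) (2 * j))⁻¹ : B)) := by
  rw [cups, (commute_e_cups h j p).eq, ← mul_assoc, (desc_cups h j p).eq]
  simp only [mul_assoc]

/-- After the conjugating braids cancel, each of the j cups closes against its cap to a loop of
value η. -/
theorem cups_mul_cups (h : BMWSystem q μ s e) : ∀ j p : ℕ,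
    cups s e j p * cups s e j p = eta q μ ^ j • cups s e j p
  | 0, p => by simp [cups]
  | j + 1, p => by
    have h1 : e p * cups s e j (p + 2) * (e p * cups s e j (p + 2)) =
        eta q μ ^ (j + 1) • (e p * cups s e j (p + 2)) := by
      rw [(commute_e_cups h j p).symm.mul_mul_mul_comm, h.e_e, cups_mul_cups h j, smul_mul_smul_comm,
        pow_succ']
    rw [cups]
    set D := desc s (p + 1) (2 * j)
    set X := e p * cups s e j (p + 2)
    calc (D : B) * X * ↑D⁻¹ * (D * X * ↑D⁻¹) = D * (X * X) * ↑D⁻¹ := by simp [mul_assoc]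
      _ = _ := by rw [h1]; simp

/-- The scalars obtained by contracting a strand of an antisymmetrizer. -/
def delta (q μ : ℂ) : ℕ → ℂ
  | 0 => 1
  | 1 => eta q μ
  | n + 2 => q ^ (n + 1) / qNumber q (n + 2) * (eta q μ +
      ((q⁻¹) ^ (2 * (n + 1)) - 1) / (q - q⁻¹) * μ⁻¹ +
      μ * ((q⁻¹) ^ (2 * (n + 1)) - 1) / (μ + q * (q⁻¹) ^ (2 * (n + 1))))

/-- The scalar factorizes; one factor is excluded by μ ≠ -q^(1-2m), the other by μ = q^(1-k)
together with q^(2i) ≠ 1 for i ≤ k. -/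
theorem delta_ne_zero {k : ℕ} (hp : AdmissibleParameters q μ k) (hμ : μ = q ^ (1 - (k : ℤ))) :
    ∀ {m : ℕ}, 1 ≤ m → m ≤ k → delta q μ m ≠ 0
  | 0, h1, _ => by omega
  | 1, _, hm => hp.eta_ne hm
  | n + 2, _, hm => by
    have hq := hp.q_ne_zero
    have hl := hp.sub_ne (by omega)
    have hμ0 := hp.mu_ne_zero
    have hx := hp.add_ne (m := n + 1) (by omega) (by omega)
    have hx2 := hp.add_ne (m := n + 2) (by omega) (by omega)
    set x := q⁻¹ ^ (2 * (n + 1)) with hxd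
    have hx0 : x ≠ 0 := pow_ne_zero _ (inv_ne_zero hq)
    have h1 : x + q * μ ≠ 0 := by
      intro h0
      apply hx2
      rw [show 2 * (n + 1 + 1) = 2 * (n + 1) + 2 by ring, pow_add, ← hxd]
      field_simp
      linear_combination h0
    have h2 : q * x - q⁻¹ * μ ^ 2 ≠ 0 := by
      intro h0
      -- With μ = q^(1-k) the equation q² x = μ² reads q^(2(k-n-1)) = 1, and k - (n + 1) lies
      -- between 1 and k.
      apply hp.q_pow_ne_one (k - (n + 1)) (by omega) (by omega)
      obtain ⟨r, rfl⟩ := Nat.exists_eq_add_of_le (show n + 2 ≤ k by omega)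
      have h3 : n + 2 + r - (n + 1) = r + 1 := by omega
      rw [h3]
      have h4 : μ * q ^ (n + 1 + r) = 1 := by
        rw [hμ, ← zpow_natCast, ← zpow_add₀ hq]
        push_cast
        ring_nf
        simp
      have h5 : x * q ^ (2 * (n + 1)) = 1 := by
        rw [hxd, ← mul_pow, inv_mul_cancel₀ hq, one_pow]
      have h6 : q ^ 2 * x = μ ^ 2 := by
        field_simp at h0
        linear_combination h0
      calc q ^ (2 * (r + 1)) = q ^ 2 * (x * q ^ (2 * (n + 1))) * q ^ (2 * r) := by rw [h5]; ring
        _ = (μ * q ^ (n + 1 + r)) ^ 2 := by rw [← mul_assoc, h6]; ring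
        _ = 1 := by rw [h4, one_pow]
    rw [delta, ← hxd]
    refine mul_ne_zero (div_ne_zero (pow_ne_zero _ hq) (hp.qNumber_ne (by omega) hm)) ?_
    have h7 : eta q μ + (x - 1) / (q - q⁻¹) * μ⁻¹ + μ * (x - 1) / (μ + q * x) =
        (x + q * μ) * (q * x - q⁻¹ * μ ^ 2) / (μ * (q - q⁻¹) * (μ + q * x)) := by
      have hq1 := sq_sub_one_ne hl hq
      rw [eta]
      field_simp
      ring
    rw [h7]
    exact div_ne_zero (mul_ne_zero h1 h2) (mul_ne_zero (mul_ne_zero hμ0 hl) hx)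

/-- Contraction of the first strand of an antisymmetrizer with a strand further to the left. -/
theorem e_asym_e (h : BMWSystem q μ s e) {k : ℕ} (hp : AdmissibleParameters q μ k)
    (p j m : ℕ) (hm : m + 1 ≤ k) :
    e p * ((↑(desc s (p + 1) (2 * j))⁻¹ : B) * asym q μ s e (p + 2 * j + 1) (m + 1) *
      (desc s (p + 1) (2 * j) : Bˣ)) * e p =
      delta q μ (m + 1) • (e p * asym q μ s e (p + 2 * j + 2) m) := by
  set D := desc s (p + 1) (2 * j) with hD
  rcases m with - | n
  · simp [asym, delta, h.e_e]
  · have hμ := hp.mu_ne_zero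
    -- The left-hand recursion is needed: it isolates the contracted strand, leaving an
    -- antisymmetrizer that commutes with `D` and with e_p.
    rw [((isAntisymmetric_asym h hp (n + 2) hm (p + 2 * j + 1)).2 n rfl)]
    have hcD : Commute (D : B) (asym q μ s e (p + 2 * j + 1 + 1) (n + 1)) :=
      commute_asym h _ fun i h1 h2 =>
        (commute_desc fun r h3 h4 => h.comm_s (by omega)).symm
    have hcD' : Commute (↑D⁻¹ : B) (asym q μ s e (p + 2 * j + 1 + 1) (n + 1)) :=
      hcD.units_inv_left
    have hce : Commute (e p) (asym q μ s e (p + 2 * j + 1 + 1) (n + 1)) :=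
      commute_asym h _ fun i h1 h2 => (h.comm_e (h.comm_s (by omega))).symm
    have ha := (isAntisymmetric_asym h hp (n + 1) (by omega) (p + 2 * j + 1 + 1)).1.idem
    set D' := desc s (p + 2) (2 * j) with hD'
    have hDD : SemiconjBy ((D : B) * D') (s (p + 1) : B) (s (p + 2 * j + 1)) := by
      have := semiconj_desc_desc h (p + 1) (2 * j)
      rwa [show p + 1 + 2 * j = p + 2 * j + 1 by ring] at this
    have heD : Commute (e p) (D' : B) :=
      commute_desc fun i h1 h2 => (h.comm_e (h.comm_s (by omega))).symm
    -- D D' carries s_{p+1}, the neighbour of e_p, to s_{p+2j+1}, and D' commutes with e_p. So the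
    -- contraction over a distance is conjugate to one on three consecutive strands.
    have hconj : ∀ y y' : B, SemiconjBy ((D : B) * D') y y' →
        e p * ((↑D⁻¹ : B) * y' * D) * e p = D' * (e p * y * e p) * (↑D'⁻¹ : B) := by
      intro y y' hy
      have h1 : (↑D⁻¹ : B) * y' * D = D' * y * (↑D'⁻¹ : B) := by
        rw [Units.eq_mul_inv_iff_mul_eq, mul_assoc, mul_assoc, Units.inv_mul_eq_iff_eq_mul,
          ← hy.eq, mul_assoc]
      rw [h1]
      have h2 : Commute (e p) (↑D'⁻¹ : B) := heD.units_inv_right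
      calc e p * (D' * y * (↑D'⁻¹ : B)) * e p = (e p * D') * y * ((↑D'⁻¹ : B) * e p) := by
            simp only [mul_assoc]
        _ = _ := by rw [heD.eq, ← h2.eq]; simp only [mul_assoc]
    have hb : e p * ((↑D⁻¹ : B) * bax q μ s e (p + 2 * j + 1) ((q⁻¹) ^ (2 * (n + 1))) * D) * e p =
        (eta q μ + ((q⁻¹) ^ (2 * (n + 1)) - 1) / (q - q⁻¹) * μ⁻¹ +
          μ * ((q⁻¹) ^ (2 * (n + 1)) - 1) / (μ + q * (q⁻¹) ^ (2 * (n + 1)))) • e p := by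
      rw [hconj _ _ (semiconj_bax h _ hDD), bax, mul_add, mul_add, add_mul, add_mul,
        mul_smul_comm, mul_smul_comm, smul_mul_assoc, smul_mul_assoc, mul_one, h.e_e,
        h.e_s_e hμ (Or.inl rfl), h.e_e_e _ _ (Or.inl rfl), smul_smul, ← add_smul, ← add_smul,
        mul_smul_comm, smul_mul_assoc, ← heD.eq, mul_assoc, Units.mul_inv, mul_one]
    rw [delta, mul_smul]
    set a := asym q μ s e (p + 2 * j + 1 + 1) (n + 1)
    set b := bax q μ s e (p + 2 * j + 1) ((q⁻¹) ^ (2 * (n + 1)))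
    simp only [mul_smul_comm, smul_mul_assoc]
    congr 1
    calc e p * ((↑D⁻¹ : B) * (a * b * a) * D) * e p
        = e p * (((↑D⁻¹ : B) * a) * b * (a * D)) * e p := by simp only [mul_assoc]
      _ = (e p * a) * ((↑D⁻¹ : B) * b * D) * (a * e p) := by
          rw [hcD'.eq, ← hcD.eq]; simp only [mul_assoc]
      _ = a * (e p * ((↑D⁻¹ : B) * b * D) * e p) * a := by
          rw [hce.eq]; nth_rewrite 2 [← hce.eq]; simp only [mul_assoc]
      _ = _ := by rw [hb, mul_smul_comm, smul_mul_assoc, ← hce.eq, mul_assoc, ha]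

/-- Contraction from the inside out: the j inner cups remove j strands of the antisymmetrizer, after
which the outermost cup meets the first remaining strand and `e_asym_e` applies. -/
theorem cups_asym_cups (h : BMWSystem q μ s e) {k : ℕ} (hp : AdmissibleParameters q μ k) :
    ∀ (j p m : ℕ), j + m ≤ k →
      cups s e j p * asym q μ s e (p + j) (j + m) * cups s e j p =
        (∏ i ∈ Finset.range j, delta q μ (m + i + 1)) •
          (cups s e j p * asym q μ s e (p + 2 * j) m)
  | 0, p, m, _ => by simp [cups]
  | j + 1, p, m, hm => by
    have ih := cups_asym_cups h hp j (p + 1) (m + 1) (by omega)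
    have hc := e_asym_e h hp p j m (by omega)
    have hcD : Commute ((desc s (p + 1) (2 * j) : Bˣ) : B) (asym q μ s e (p + 2 * j + 2) m) :=
      commute_asym h _ fun i h1 h2 =>
        (commute_desc fun r h3 h4 => h.comm_s (by omega)).symm
    have hD := desc_cups h j p
    have hE := commute_e_cups h j p
    have e1 := cups_succ h j p
    have e2 := cups_succ' h j p
    rw [show p + 1 + j = p + (j + 1) by ring, show j + (m + 1) = j + 1 + m by ring,
      show p + 1 + 2 * j = p + 2 * j + 1 by ring] at ih
    conv_lhs => rw [e2]
    conv_lhs =>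
      enter [2]
      rw [← e2, e1]
    set D := desc s (p + 1) (2 * j)
    rw [← e2, e1]
    have hprod : ∏ i ∈ Finset.range (j + 1), delta q μ (m + i + 1) =
        (∏ i ∈ Finset.range j, delta q μ (m + 1 + i + 1)) * delta q μ (m + 1) := by
      rw [Finset.prod_range_succ', add_zero]
      congr 1
      exact Finset.prod_congr rfl fun i _ => by rw [show m + (i + 1) + 1 = m + 1 + i + 1 by ring]
    set c := cups s e j (p + 1)
    set c' := cups s e j (p + 2)
    calc _ = (D * e p * (↑D⁻¹ : B)) * (c * asym q μ s e (p + (j + 1)) (j + 1 + m) * c) *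
          (D * e p * (↑D⁻¹ : B)) := by
            conv_lhs =>
              enter [2]
              rw [← e1, e2]
            simp only [mul_assoc]
      _ = (∏ i ∈ Finset.range j, delta q μ (m + 1 + i + 1)) • ((D * e p * (↑D⁻¹ : B)) *
          (c * asym q μ s e (p + 2 * j + 1) (m + 1)) * (D * e p * (↑D⁻¹ : B))) := by
            rw [ih, mul_smul_comm, smul_mul_assoc]
      _ = _ := by
        rw [hprod, mul_smul]
        congr 1
        have h1 : (↑D⁻¹ : B) * c = c' * (↑D⁻¹ : B) := (hD.units_inv_symm_left).eq
        calc _ = D * e p * ((↑D⁻¹ : B) * c) * asym q μ s e (p + 2 * j + 1) (m + 1) *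
              (D * e p * (↑D⁻¹ : B)) := by simp only [mul_assoc]
          _ = D * (e p * c') * ((↑D⁻¹ : B) * asym q μ s e (p + 2 * j + 1) (m + 1) * D) * e p *
              (↑D⁻¹ : B) := by rw [h1]; simp only [mul_assoc]
          _ = D * c' * (e p * ((↑D⁻¹ : B) * asym q μ s e (p + 2 * j + 1) (m + 1) * D) * e p) *
              (↑D⁻¹ : B) := by rw [hE.eq]; simp only [mul_assoc]
          _ = delta q μ (m + 1) • (D * (c' * e p) * (asym q μ s e (p + 2 * j + 2) m *
              (↑D⁻¹ : B))) := by
                rw [hc, mul_smul_comm, smul_mul_assoc]; simp only [mul_assoc]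
          _ = _ := by
            have h2 : Commute (↑D⁻¹ : B) (asym q μ s e (p + 2 * j + 2) m) := hcD.units_inv_left
            rw [← hE.eq, ← h2.eq, show p + 2 * (j + 1) = p + 2 * j + 2 by ring]
            congr 1
            rw [mul_assoc _ (↑D⁻¹ : B) c, h1]
            simp only [mul_assoc]

/-- A generator slides through nested cups. -/
theorem s_mul_cups (h : BMWSystem q μ s e) : ∀ (j p i i' : ℕ), i + 1 < j → i + i' + 2 = 2 * j →
    (s (p + i) : B) * cups s e j p = s (p + i') * cups s e j p
  | 0, _, _, _, h1, _ => by omega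
  | 1, _, _, _, h1, _ => by omega
  | j + 2, p, 0, i', _, h2 => by
    obtain rfl : i' = 2 * j + 2 := by omega
    have hdd := semiconj_desc_desc h (p + 2) (2 * j)
    set G : Bˣ := desc s (p + 2) (2 * j) * desc s (p + 3) (2 * j) with hG
    have hGs : SemiconjBy (G : B) (s (p + 2) : B) (s (p + 2 + 2 * j)) := by
      rw [hG, Units.val_mul]
      exact hdd
    have hGp : Commute (G : B) (s p : B) := by
      rw [hG, Units.val_mul]
      exact ((commute_desc fun i h3 h4 => h.comm_s (by omega)).mul_right
        (commute_desc fun i h3 h4 => h.comm_s (by omega))).symm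
    have hsE : Commute (s (p + 1) : B) (desc s (p + 3) (2 * j) : Bˣ) :=
      commute_desc fun i h3 h4 => h.comm_s (by omega)
    have heE : Commute (e p) ((desc s (p + 3) (2 * j) : Bˣ) : B) :=
      commute_desc fun i h3 h4 => (h.comm_e (h.comm_s (by omega))).symm
    -- Only the two outermost cups matter here. They are brought to the core s_{p+2} s_{p+1} e_p
    -- e_{p+2}, with a braid G on the left that commutes with s_p and moves s_{p+2} to the last
    -- crossing.
    obtain ⟨X, hX⟩ : ∃ X, cups s e (j + 2) p =
        G * (s (p + 2) * s (p + 1) * e p * e (p + 2)) * X := by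
      refine ⟨cups s e j (p + 4) * (↑(desc s (p + 3) (2 * j))⁻¹ : B) *
        (↑(desc s (p + 1) (2 * (j + 1)))⁻¹ : B), ?_⟩
      have h3 : desc s (p + 1) (2 * (j + 1)) = s (p + 2 + 2 * j) * (desc s (p + 2) (2 * j) *
          s (p + 1)) := by
        rw [show 2 * (j + 1) = 2 * j + 1 + 1 by ring, desc, desc_succ',
          show p + 1 + (2 * j + 1) = p + 2 + 2 * j by ring]
      rw [cups, cups]
      have h4 : ((desc s (p + 1) (2 * (j + 1)) : Bˣ) : B) * (desc s (p + 3) (2 * j) : Bˣ) =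
          G * (s (p + 2) * s (p + 1)) := by
        rw [h3, Units.val_mul, Units.val_mul, ← mul_assoc (G : B), hGs.eq, hG, Units.val_mul,
          mul_assoc, mul_assoc, hsE.eq]
        simp only [mul_assoc]
      calc _ = ((desc s (p + 1) (2 * (j + 1)) : Bˣ) : B) *
              (e p * (desc s (p + 3) (2 * j) : Bˣ)) * e (p + 2) * (cups s e j (p + 4) *
              (↑(desc s (p + 3) (2 * j))⁻¹ : B) *
              (↑(desc s (p + 1) (2 * (j + 1)))⁻¹ : B)) := by
            simp only [mul_assoc]
        _ = ((desc s (p + 1) (2 * (j + 1)) : Bˣ) * (desc s (p + 3) (2 * j) : Bˣ) : B) * e p *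
              e (p + 2) * (cups s e j (p + 4) * (↑(desc s (p + 3) (2 * j))⁻¹ : B) *
              (↑(desc s (p + 1) (2 * (j + 1)))⁻¹ : B)) := by
            rw [heE.eq]; simp only [mul_assoc]
        _ = _ := by rw [h4]; simp only [mul_assoc]
    have hee : Commute (e p) (e (p + 2)) :=
      h.comm_e (h.comm_e (h.comm_s (by omega))).symm
    have hss : Commute (s p : B) (s (p + 2)) := h.comm_s (by omega)
    have h5 := h.s_s_e (i := p) (j := p + 1) (Or.inl rfl)
    have h6 := h.s_s_e (i := p + 2) (j := p + 1) (Or.inr rfl)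
    rw [hX, add_zero, show p + (2 * j + 2) = p + 2 + 2 * j by ring, ← mul_assoc, ← mul_assoc]
    conv_rhs => rw [← mul_assoc, ← mul_assoc, ← hGs.eq, mul_assoc (G : B)]
    rw [← hGp.eq, mul_assoc (G : B)]
    congr 2
    -- The slide for two nested cups on four strands: each single-cup passage trades s_p s_{p+1} or
    -- s_{p+2} s_{p+1} for e_{p+1}.
    calc (s p : B) * (s (p + 2) * s (p + 1) * e p * e (p + 2))
        = (s p * s (p + 2)) * s (p + 1) * e p * e (p + 2) := by simp only [mul_assoc]
      _ = s (p + 2) * (s p * s (p + 1) * e p) * e (p + 2) := by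
          rw [hss.eq]; simp only [mul_assoc]
      _ = s (p + 2) * e (p + 1) * (e p * e (p + 2)) := by rw [h5]; simp only [mul_assoc]
      _ = s (p + 2) * (e (p + 1) * e (p + 2)) * e p := by rw [hee.eq]; simp only [mul_assoc]
      _ = s (p + 2) * s (p + 2) * s (p + 1) * (e (p + 2) * e p) := by
          rw [← h6]; simp only [mul_assoc]
      _ = _ := by rw [← hee.eq]; simp only [mul_assoc]
  -- A crossing of inner strands commutes with the outermost cup, so the slide takes place in the
  -- inner cups.
  | j + 2, p, i + 1, i', h1, h2 => by
    obtain ⟨r, rfl⟩ : ∃ r, i' = r + 1 := ⟨i' - 1, by omega⟩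
    have ih := s_mul_cups h (j + 1) (p + 1) i r (by omega) (by omega)
    have hc : ∀ t, t < 2 * (j + 1) - 1 → Commute (s (p + 1 + t) : B)
        ((desc s (p + 1) (2 * (j + 1)) : Bˣ) * e p *
          (↑(desc s (p + 1) (2 * (j + 1)))⁻¹ : B)) := by
      intro t ht
      have h3 := semiconj_desc h (p := p + 1) (i := p + 1 + t) (n := 2 * (j + 1))
        (by omega) (by omega)
      have h4 := h3.units_inv_symm_left
      have h5 : Commute (e p) (s (p + 1 + t + 1) : B) := (h.comm_e (h.comm_s (by omega))).symm
      exact ((h3.mul_left h5).mul_left h4).symm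
    rw [cups_succ h, ← add_assoc, ← add_assoc, add_right_comm p i, add_right_comm p r]
    rw [← mul_assoc, (hc i (by omega)).eq, mul_assoc, ih, ← mul_assoc, ← (hc r (by omega)).eq,
      mul_assoc]

end System

/-! ### Partial traces along a system of matrix units -/

section PartialTrace

open Matrix

variable {B : Type*} [Ring B] [Algebra ℂ B] {X : Type*} [Fintype X] [DecidableEq X]
  (φ : Matrix X X ℂ →ₐ[ℂ] B)

/-- The partial trace along the matrix algebra embedded by `φ`. -/
def ptr : B →ₗ[ℂ] B :=
  ∑ x, ∑ y, (LinearMap.mulLeft ℂ (φ (single x y 1))).comp (LinearMap.mulRight ℂ (φ (single y x 1)))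

variable {φ}

theorem ptr_apply (T : B) :
    ptr φ T = ∑ x, ∑ y, φ (single x y 1) * T * φ (single y x 1) := by
  simp [ptr, mul_assoc]

theorem ptr_mul_left {C : B} (hC : ∀ Z, Commute C (φ Z)) (T : B) : ptr φ (C * T) = C * ptr φ T := by
  simp only [ptr_apply, Finset.mul_sum]
  refine Finset.sum_congr rfl fun x _ => Finset.sum_congr rfl fun y _ => ?_
  rw [← mul_assoc, ← (hC _).eq]
  simp only [mul_assoc]

theorem ptr_mul_right {C : B} (hC : ∀ Z, Commute C (φ Z)) (T : B) :
    ptr φ (T * C) = ptr φ T * C := by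
  simp only [ptr_apply, Finset.sum_mul]
  refine Finset.sum_congr rfl fun x _ => Finset.sum_congr rfl fun y _ => ?_
  rw [mul_assoc _ _ C, ← (hC _).eq]
  simp only [mul_assoc]

theorem ptr_cyc (Z : Matrix X X ℂ) (T : B) : ptr φ (φ Z * T) = ptr φ (T * φ Z) := by
  rw [Matrix.matrix_eq_sum_single Z]
  simp only [map_sum, Finset.sum_mul, Finset.mul_sum]
  refine Finset.sum_congr rfl fun a _ => Finset.sum_congr rfl fun b _ => ?_
  have h1 : single a b (Z a b) = Z a b • single a b (1 : ℂ) := by simp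
  rw [h1, map_smul, smul_mul_assoc, mul_smul_comm, map_smul, map_smul]
  congr 1
  simp only [ptr_apply]
  have e1 : ∀ x y, φ (single x y 1) * (φ (single a b 1) * T) * φ (single y x 1) =
      if y = a then φ (single x b 1) * T * φ (single a x 1) else 0 := by
    intro x y
    rw [← mul_assoc, ← map_mul]
    split_ifs with h
    · subst h
      rw [single_mul_single_same, one_mul]
    · rw [single_mul_single_of_ne _ _ _ _ h, map_zero, zero_mul, zero_mul]
  have e2 : ∀ x y, φ (single x y 1) * (T * φ (single a b 1)) * φ (single y x 1) =
      if y = b then φ (single x b 1) * T * φ (single a x 1) else 0 := by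
    intro x y
    rw [mul_assoc, mul_assoc, ← map_mul]
    split_ifs with h
    · subst h
      rw [single_mul_single_same, one_mul, mul_assoc]
    · rw [single_mul_single_of_ne _ _ _ _ (Ne.symm h), map_zero, mul_zero, mul_zero]
  simp only [e1, e2, Finset.sum_ite_eq', Finset.mem_univ, if_true]

theorem ptr_single_mul (a b : X) (T : B) :
    ptr φ (φ (single a b 1) * T) = ∑ x, φ (single x b 1) * T * φ (single a x 1) := by
  rw [ptr_apply]
  refine Finset.sum_congr rfl fun x _ => ?_
  rw [Finset.sum_eq_single a]
  · rw [← mul_assoc, ← map_mul, single_mul_single_same, one_mul]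
  · intro y _ h
    rw [← mul_assoc, ← map_mul, single_mul_single_of_ne _ _ _ _ h, map_zero, zero_mul, zero_mul]
  · simp

theorem sum_single_eq_one : ∑ x, φ (single x x 1) = 1 := by
  rw [← map_sum, ← map_one φ]
  congr 1
  ext i j
  simp [Matrix.sum_apply, single_apply, Matrix.one_apply, ite_and]

theorem commute_ptr (T : B) (Z : Matrix X X ℂ) : Commute (ptr φ T) (φ Z) := by
  rw [Matrix.matrix_eq_sum_single Z]
  simp only [map_sum]
  refine Commute.sum_right _ _ _ fun a _ => Commute.sum_right _ _ _ fun b _ => ?_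
  have h1 : single a b (Z a b) = Z a b • single a b (1 : ℂ) := by simp
  rw [h1, map_smul]
  refine Commute.smul_right ?_ _
  rw [Commute, SemiconjBy, ptr_apply, Finset.sum_comm, Finset.sum_mul, Finset.mul_sum]
  refine Finset.sum_congr rfl fun y _ => ?_
  rw [Finset.sum_mul, Finset.mul_sum, Finset.sum_eq_single a, Finset.sum_eq_single b]
  · rw [mul_assoc, ← map_mul, single_mul_single_same, ← mul_assoc, ← mul_assoc, ← map_mul,
      single_mul_single_same, one_mul]
  · intro x _ h
    rw [← mul_assoc, ← mul_assoc, ← map_mul, single_mul_single_of_ne _ _ _ _ h.symm, map_zero,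
      zero_mul, zero_mul]
  · simp
  · intro x _ h
    rw [mul_assoc, ← map_mul, single_mul_single_of_ne _ _ _ _ h, map_zero, mul_zero]
  · simp

theorem ptr_one_map (Z : Matrix X X ℂ) : ptr φ (φ Z) = Z.trace • 1 := by
  simp only [ptr_apply, ← map_mul]
  have : ∀ x y, single x y (1 : ℂ) * Z * single y x 1 = Z y y • single x x 1 := by
    intro x y
    rw [Matrix.single_mul_mul_single, smul_single, smul_eq_mul, one_mul, mul_one]
  simp only [this, map_smul, ← Finset.sum_smul, ← Finset.smul_sum, sum_single_eq_one]
  rfl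

theorem ptr_mul_map {C : B} (hC : ∀ Z, Commute C (φ Z)) (Z : Matrix X X ℂ) :
    ptr φ (C * φ Z) = Z.trace • C := by
  rw [ptr_mul_left hC, ptr_one_map, mul_smul_comm, mul_one]

/-- An element is determined by its coefficients along the matrix units. -/
theorem eq_sum_ptr (T : B) :
    T = ∑ x, ∑ y, ptr φ (φ (single y x 1) * T) * φ (single x y 1) := by
  conv_lhs => rw [← one_mul T, ← mul_one (1 * T), ← sum_single_eq_one (φ := φ)]
  rw [Finset.sum_mul, Finset.sum_mul]
  refine Finset.sum_congr rfl fun x _ => ?_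
  rw [Finset.mul_sum]
  refine Finset.sum_congr rfl fun y _ => ?_
  rw [ptr_single_mul, Finset.sum_mul, Finset.sum_eq_single x]
  · rw [mul_assoc, mul_assoc, mul_assoc, ← map_mul, single_mul_single_same, one_mul]
  · intro a _ h
    rw [mul_assoc, ← map_mul, single_mul_single_of_ne _ _ _ _ h, map_zero, mul_zero]
  · simp

/-- The coefficients of T along the matrix units commute with the embedded matrix algebra, so the
identity P Z P = Tr(P Z) P for matrices extends coefficientwise. -/
theorem map_mul_map_of_rank_one {P : Matrix X X ℂ}
    (hP : ∀ Z, P * Z * P = (P * Z).trace • P) (T : B) :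
    φ P * T * φ P = ptr φ (φ P * T) * φ P := by
  have h1 := eq_sum_ptr (φ := φ) T
  set t : X → X → B := fun x y => ptr φ (φ (single y x 1) * T) with ht
  have hc : ∀ x y Z, Commute (t x y) (φ Z) := fun x y Z => commute_ptr _ Z
  rw [h1]
  simp only [Finset.mul_sum, Finset.sum_mul, map_sum]
  refine Finset.sum_congr rfl fun x _ => Finset.sum_congr rfl fun y _ => ?_
  have h2 : φ P * (ptr φ (φ (single y x 1) * T) * φ (single x y 1)) =
      t x y * φ (P * single x y 1) := by
    rw [← mul_assoc, ← (hc x y P).eq, mul_assoc, ← map_mul]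
  rw [h2, mul_assoc, ← map_mul, hP, ptr_mul_map (hc x y), map_smul, mul_smul_comm, smul_mul_assoc]

theorem ptr_comm {Y : Type*} [Fintype Y] [DecidableEq Y] {ψ : Matrix Y Y ℂ →ₐ[ℂ] B}
    (h : ∀ Z W, Commute (φ Z) (ψ W)) (T : B) : ptr φ (ptr ψ T) = ptr ψ (ptr φ T) := by
  rw [ptr_apply (φ := ψ) T, ptr_apply (φ := ψ) (ptr φ T)]
  simp only [map_sum]
  refine Finset.sum_congr rfl fun x _ => Finset.sum_congr rfl fun y _ => ?_
  rw [ptr_mul_right fun Z => (h Z _).symm, ptr_mul_left fun Z => (h Z _).symm]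

end PartialTrace

/-! ### Local operators on infinitely many strands -/

section Operators

open Matrix

variable {ι : Type*}

/-- Replace the entries `i, …, i + m - 1` of a sequence. -/
def upd (x : ℕ → ι) (i : ℕ) {m : ℕ} (y : Fin m → ι) : ℕ → ι := fun n =>
  if h : i ≤ n ∧ n < i + m then y ⟨n - i, by omega⟩ else x n

/-- The entries `i, …, i + m - 1` of a sequence. -/
def window (x : ℕ → ι) (i m : ℕ) : Fin m → ι := fun t => x (i + t)

theorem upd_of_lt {x : ℕ → ι} {i m n : ℕ} {y : Fin m → ι} (h : n < i) : upd x i y n = x n :=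
  dif_neg (by omega)

theorem upd_of_ge {x : ℕ → ι} {i m n : ℕ} {y : Fin m → ι} (h : i + m ≤ n) : upd x i y n = x n :=
  dif_neg (by omega)

theorem upd_add (x : ℕ → ι) (i : ℕ) {m : ℕ} (y : Fin m → ι) (t : Fin m) :
    upd x i y (i + t) = y t := by
  rw [upd, dif_pos ⟨by omega, by omega⟩]
  congr 1
  ext
  simp

theorem window_upd (x : ℕ → ι) (i : ℕ) {m : ℕ} (y : Fin m → ι) : window (upd x i y) i m = y :=
  funext fun t => upd_add x i y t

theorem upd_upd (x : ℕ → ι) (i : ℕ) {m : ℕ} (y z : Fin m → ι) :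
    upd (upd x i y) i z = upd x i z := by
  funext n
  by_cases h : i ≤ n ∧ n < i + m <;> simp [upd, h]

theorem upd_window (x : ℕ → ι) (i m : ℕ) : upd x i (window x i m) = x := by
  funext n
  by_cases h : i ≤ n ∧ n < i + m
  · simp only [upd, h, and_self, dite_true, window]
    congr 1
    omega
  · simp [upd, h]

theorem window_upd_of_le {x : ℕ → ι} {i j m n : ℕ} {y : Fin m → ι} (h : i + m ≤ j) :
    window (upd x i y) j n = window x j n :=
  funext fun t => upd_of_ge (by omega)

theorem window_upd_of_ge {x : ℕ → ι} {i j m n : ℕ} {y : Fin m → ι} (h : j + n ≤ i) :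
    window (upd x i y) j n = window x j n :=
  funext fun t => upd_of_lt (by omega)

theorem upd_comm {x : ℕ → ι} {i j m n : ℕ} {y : Fin m → ι} {z : Fin n → ι} (h : i + m ≤ j) :
    upd (upd x i y) j z = upd (upd x j z) i y := by
  funext r
  by_cases h1 : i ≤ r ∧ r < i + m
  · have h2 : ¬ (j ≤ r ∧ r < j + n) := by omega
    simp [upd, h1, h2]
  · simp [upd, h1]

theorem upd_snoc (x : ℕ → ι) (i n : ℕ) (y : Fin n → ι) (c : ι) :
    upd x i (Fin.snoc (α := fun _ => ι) y c : Fin (n + 1) → ι) =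
      upd (upd x i y) (i + n) (fun _ : Fin 1 => c) := by
  funext r
  by_cases h1 : r < i
  · rw [upd_of_lt h1, upd_of_lt (by omega), upd_of_lt h1]
  by_cases h2 : i + (n + 1) ≤ r
  · rw [upd_of_ge h2, upd_of_ge (by omega), upd_of_ge (by omega)]
  obtain ⟨t, rfl⟩ : ∃ t : Fin (n + 1), r = i + t := ⟨⟨r - i, by omega⟩, by simp; omega⟩
  rw [upd_add]
  refine Fin.lastCases ?_ (fun t => ?_) t
  · rw [Fin.snoc_last, Fin.val_last]
    exact (upd_add (upd x i y) (i + n) (fun _ : Fin 1 => c) 0).symm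
  · rw [Fin.snoc_castSucc, upd_of_lt (by simp), Fin.val_castSucc, upd_add]

variable {A : Type*} [Ring A] [Algebra ℂ A]

variable (ι A) in
/-- The algebra in which the local operators on infinitely many strands live. -/
abbrev Oper : Type _ := Module.End ℂ ((ℕ → ι) → A)

instance : Ring (Oper ι A) := inferInstance

instance : Algebra ℂ (Oper ι A) := inferInstance

instance : Semiring (Oper ι A) := inferInstance

instance : Mul (Oper ι A) := inferInstance

instance : AddCommMonoid (Oper ι A) := inferInstance

instance : Module ℂ (Oper ι A) := inferInstance

instance : SMul ℂ (Oper ι A) := inferInstance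

variable (ι A) in
/-- Left multiplication by elements of the coefficient algebra. -/
def lmul : A →ₐ[ℂ] Oper ι A :=
  AlgHom.ofLinearMap
    { toFun := fun a =>
        { toFun := fun f x => a * f x
          map_add' := fun f g => by funext x; simp [mul_add]
          map_smul' := fun c f => by funext x; simp }
      map_add' := fun a b => by ext f x; simp [add_mul]
      map_smul' := fun c a => by ext f x; simp }
    (by ext f x; simp)
    (fun a b => by ext f x; simp [mul_assoc])

theorem lmul_apply (a : A) (f : (ℕ → ι) → A) (x : ℕ → ι) : lmul ι A a f x = a * f x := rfl

theorem lmul_injective [Nonempty ι] : Function.Injective (lmul ι A) := by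
  intro a b h
  have x : ℕ → ι := fun _ => Classical.arbitrary ι
  have := congrFun (LinearMap.congr_fun h fun _ => 1) x
  simpa [lmul_apply] using this

theorem scalars_embed [DecidableEq ι] {j m n : ℕ} (h : j + m ≤ n) (X : TensorMat ι m ℂ) :
    scalars A (embed X n j h) = embed (scalars A X) n j h := by
  ext x y
  simp only [embed, scalars, Matrix.map_apply, Matrix.of_apply]
  split_ifs <;> simp

variable [Fintype ι]

/-- The operator which acts as `X` in the factors `i, …, i + m - 1`. -/
def opFun (i : ℕ) {m : ℕ} (X : TensorMat ι m A) : Oper ι A where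
  toFun f x := ∑ y, X (window x i m) y * f (upd x i y)
  map_add' f g := by
    funext x
    simp [mul_add, Finset.sum_add_distrib]
  map_smul' c f := by
    funext x
    simp [Finset.smul_sum]

variable [DecidableEq ι]

variable (ι A) in
/-- The embedding of operators on a finite tensor power as local operators. -/
def op (i m : ℕ) : TensorMat ι m A →ₐ[ℂ] Oper ι A :=
  AlgHom.ofLinearMap
    { toFun := opFun i
      map_add' := fun X Y => by
        ext f x
        simp [opFun, add_mul, Finset.sum_add_distrib]
      map_smul' := fun c X => by
        ext f x
        simp [opFun, Finset.smul_sum] }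
    (by
      ext f x
      simp [opFun, Matrix.one_apply, upd_window])
    (by
      intro X Y
      ext f x
      simp only [LinearMap.coe_mk, AddHom.coe_mk, opFun, Module.End.mul_apply, Matrix.mul_apply,
        window_upd, upd_upd, Finset.sum_mul, Finset.mul_sum, mul_assoc]
      rw [Finset.sum_comm])

theorem op_apply (i m : ℕ) (X : TensorMat ι m A) (f : (ℕ → ι) → A) (x : ℕ → ι) :
    op ι A i m X f x = ∑ y, X (window x i m) y * f (upd x i y) := rfl

variable (ι A) in
/-- The embedding of numerical operators as local operators. -/
def num (i m : ℕ) : TensorMat ι m ℂ →ₐ[ℂ] Oper ι A :=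
  (op ι A i m).comp (Algebra.ofId ℂ A).mapMatrix

theorem op_scalars (i m : ℕ) (X : TensorMat ι m ℂ) : op ι A i m (scalars A X) = num ι A i m X := rfl

theorem num_apply (i m : ℕ) (X : TensorMat ι m ℂ) (f : (ℕ → ι) → A) (x : ℕ → ι) :
    num ι A i m X f x = ∑ y, X (window x i m) y • f (upd x i y) := by
  rw [← op_scalars, op_apply]
  simp [Algebra.smul_def]

theorem commute_lmul_num (a : A) (i m : ℕ) (X : TensorMat ι m ℂ) :
    Commute (lmul ι A a) (num ι A i m X) := by
  ext f x
  simp [lmul_apply, num_apply, Finset.mul_sum]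

theorem op_injective [Nonempty ι] (i m : ℕ) : Function.Injective (op ι A i m) := by
  intro X Y h
  ext a b
  have x : ℕ → ι := fun _ => Classical.arbitrary ι
  have h1 := congrFun (LinearMap.congr_fun h fun z => if window z i m = b then 1 else 0) (upd x i a)
  simpa [op_apply, window_upd, upd_upd] using h1

theorem num_injective [Nonempty ι] [Nontrivial A] (i m : ℕ) :
    Function.Injective (num ι A i m) := by
  intro X Y h
  have := op_injective i m h
  ext a b
  have := congrFun (congrFun this a) b
  exact (algebraMap ℂ A).injective this

theorem op_eq_sum (i m : ℕ) (X : TensorMat ι m A) :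
    op ι A i m X =
      ∑ x : Fin m → ι, ∑ y : Fin m → ι, lmul ι A (X x y) * num ι A i m (single x y 1) := by
  ext f z
  simp only [op_apply, LinearMap.sum_apply, Finset.sum_apply, Module.End.mul_apply, lmul_apply,
    num_apply]
  refine Eq.symm ((Finset.sum_eq_single (window z i m) ?_ ?_).trans ?_)
  · intro x _ h
    simp [single_apply_of_row_ne h]
  · simp
  · refine Finset.sum_congr rfl fun y _ => ?_
    rw [Finset.sum_eq_single y, single_apply_same, one_smul]
    · intro c _ h
      rw [single_apply_of_col_ne _ _ (Ne.symm h), zero_smul]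
    · simp

/-- Disjoint supports alone do not suffice when A is noncommutative; one of the two operators has to
be numerical. -/
theorem commute_op_num {i j m n : ℕ} (h : i + m ≤ j ∨ j + n ≤ i) (X : TensorMat ι m A)
    (Y : TensorMat ι n ℂ) : Commute (op ι A i m X) (num ι A j n Y) := by
  ext f x
  simp only [Module.End.mul_apply, op_apply, num_apply, Finset.mul_sum, Finset.smul_sum]
  rw [Finset.sum_comm]
  refine Finset.sum_congr rfl fun y _ => Finset.sum_congr rfl fun z _ => ?_
  rcases h with h | h
  · rw [window_upd_of_le h, window_upd_of_ge h, upd_comm h, mul_smul_comm]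
  · rw [window_upd_of_ge h, window_upd_of_le h, upd_comm h, mul_smul_comm]

theorem commute_num_num {i j m n : ℕ} (h : i + m ≤ j ∨ j + n ≤ i) (X : TensorMat ι m ℂ)
    (Y : TensorMat ι n ℂ) : Commute (num ι A i m X) (num ι A j n Y) :=
  commute_op_num h _ Y

theorem op_embed {i j m n : ℕ} (h : j + m ≤ n) (X : TensorMat ι m A) :
    op ι A i n (embed X n j h) = op ι A (i + j) m X := by
  ext f x
  simp only [op_apply, embed, Matrix.of_apply, ite_mul, zero_mul]
  rw [← Finset.sum_filter]
  symm
  refine Finset.sum_bij' (fun y _ => window (upd x (i + j) y) i n)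
    (fun z _ => fun t => z ⟨j + t, by omega⟩) ?_ ?_ ?_ ?_ ?_
  · intro y _
    simp only [Finset.mem_filter, Finset.mem_univ, true_and]
    intro t ht
    simp only [window]
    rcases ht with ht | ht
    · rw [upd_of_lt (by omega)]
    · rw [upd_of_ge (by omega)]
  · intro z _
    exact Finset.mem_univ _
  · intro y _
    funext t
    simp only [window]
    rw [← add_assoc, upd_add]
  · intro z hz
    simp only [Finset.mem_filter, Finset.mem_univ, true_and] at hz
    funext t
    by_cases ht : (t : ℕ) < j ∨ j + m ≤ t
    · rw [← hz t ht]
      simp only [window]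
      rcases ht with ht | ht
      · rw [upd_of_lt (by omega)]
      · rw [upd_of_ge (by omega)]
    · obtain ⟨r, hr⟩ : ∃ r : Fin m, (t : ℕ) = j + r := ⟨⟨t - j, by omega⟩, by simp; omega⟩
      simp only [window]
      rw [hr, ← add_assoc, upd_add]
      congr 1
      exact Fin.ext hr.symm
  · intro y _
    congr 1
    · congr 1
      · funext t
        simp [window, add_assoc]
      · funext t
        simp only [window]
        rw [← add_assoc, upd_add]
    · congr 1
      funext r
      by_cases hr : i ≤ r ∧ r < i + n
      · obtain ⟨t, rfl⟩ : ∃ t : Fin n, r = i + t := ⟨⟨r - i, by omega⟩, by simp; omega⟩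
        rw [upd_add]
        rfl
      · rcases not_and_or.1 hr with hr | hr
        · rw [upd_of_lt (by omega), upd_of_lt (by omega)]
        · rw [upd_of_ge (by omega), upd_of_ge (by omega)]

theorem num_embed {i j m n : ℕ} (h : j + m ≤ n) (X : TensorMat ι m ℂ) :
    num ι A i n (embed X n j h) = num ι A (i + j) m X := by
  rw [← op_scalars, scalars_embed, op_embed, op_scalars]

/-- One-legged operators form an algebra. -/
def oneLegHom : Matrix ι ι A →ₐ[ℂ] TensorMat ι 1 A :=
  (Matrix.reindexAlgEquiv ℂ A (Equiv.funUnique (Fin 1) ι).symm).toAlgHom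

variable (ι A) in
/-- The numerical operators acting in the factor `i`. -/
def site (i : ℕ) : Matrix ι ι ℂ →ₐ[ℂ] Oper ι A := (num ι A i 1).comp oneLegHom

theorem site_eq (i : ℕ) (Z : Matrix ι ι ℂ) : site ι A i Z = num ι A i 1 (oneLeg Z) := rfl

theorem site_injective [Nonempty ι] [Nontrivial A] (i : ℕ) :
    Function.Injective (site ι A i) := by
  intro X Y h
  have := num_injective i 1 h
  ext a b
  exact congrFun (congrFun this fun _ => a) fun _ => b

theorem commute_site_site {i j : ℕ} (h : i ≠ j) (X Y : Matrix ι ι ℂ) :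
    Commute (site ι A i X) (site ι A j Y) :=
  commute_num_num (by omega) _ _

theorem commute_op_site {i j m : ℕ} (h : i + m ≤ j ∨ j + 1 ≤ i) (X : TensorMat ι m A)
    (Y : Matrix ι ι ℂ) : Commute (op ι A i m X) (site ι A j Y) :=
  commute_op_num h _ _

theorem commute_num_site {i j m : ℕ} (h : i + m ≤ j ∨ j + 1 ≤ i) (X : TensorMat ι m ℂ)
    (Y : Matrix ι ι ℂ) : Commute (num ι A i m X) (site ι A j Y) :=
  commute_num_num h _ _

/-- The tensor product of an operator on `n` factors and an operator on one more factor. -/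
def tensorSnoc {n : ℕ} (X : TensorMat ι n ℂ) (Z : Matrix ι ι ℂ) : TensorMat ι (n + 1) ℂ :=
  Matrix.of fun x y => X (Fin.init x) (Fin.init y) * Z (x (Fin.last n)) (y (Fin.last n))

theorem num_tensorSnoc (i : ℕ) {n : ℕ} (X : TensorMat ι n ℂ) (Z : Matrix ι ι ℂ) :
    num ι A i (n + 1) (tensorSnoc X Z) = num ι A i n X * site ι A (i + n) Z := by
  ext f x
  simp only [site_eq, Module.End.mul_apply, num_apply, Finset.smul_sum, smul_smul, tensorSnoc,
    Matrix.of_apply, oneLeg]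
  rw [← (Fin.snocEquiv fun _ => ι).sum_comp, Fintype.sum_prod_type, Finset.sum_comm]
  refine Finset.sum_congr rfl fun y _ => ?_
  rw [← (Equiv.funUnique (Fin 1) ι).symm.sum_comp]
  refine Finset.sum_congr rfl fun c _ => ?_
  have h1 : (Fin.snocEquiv fun _ => ι) (c, y) = (Fin.snoc (α := fun _ => ι) y c : Fin (n + 1) → ι) :=
    rfl
  rw [h1, Fin.init_snoc, Fin.snoc_last, upd_snoc, window_upd_of_le (by omega)]
  rfl

end Operators

/-! ### Consequences of skew invertibility -/

section SkewInverse

open Matrix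

variable {ι : Type*}

theorem flip_apply [DecidableEq ι] (a c a' c' : ι) :
    flip ι ![a, c] ![a', c'] = if a = c' ∧ c = a' then 1 else 0 := rfl

variable [Fintype ι]

theorem sum_fin_succ {n : ℕ} {M : Type*} [AddCommMonoid M] (f : (Fin (n + 1) → ι) → M) :
    ∑ z, f z = ∑ a, ∑ y : Fin n → ι, f (vecCons a y) := by
  rw [← (Fin.consEquiv fun _ => ι).sum_comp, Fintype.sum_prod_type]
  rfl

theorem sum_fin_two {M : Type*} [AddCommMonoid M] (f : (Fin 2 → ι) → M) :
    ∑ z, f z = ∑ a, ∑ b, f ![a, b] := by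
  simp only [sum_fin_succ, Fintype.sum_unique]
  rfl

theorem sum_fin_three {M : Type*} [AddCommMonoid M] (f : (Fin 3 → ι) → M) :
    ∑ z, f z = ∑ a, ∑ b, ∑ c, f ![a, b, c] := by
  simp only [sum_fin_succ, Fintype.sum_unique]
  rfl

variable [DecidableEq ι]

theorem partialTrace_mul (X Y : TensorMat ι 2 ℂ) (a c a' c' : ι) :
    partialTrace 1 (twoLegs X 3 0 * twoLegs Y 3 1) ![a, c] ![a', c'] =
      ∑ b, ∑ b', X ![a, b] ![a', b'] * Y ![b', c] ![b, c'] := by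
  have h1 : ∀ a b c : ι, (Fin.insertNth (α := fun _ => ι) (1 : Fin 3) b ![a, c]) = ![a, b, c] := by
    intro a b c
    ext i
    fin_cases i <;> rfl
  simp only [partialTrace, Matrix.of_apply, h1, Matrix.mul_apply, sum_fin_three, twoLegs, embed]
  refine Finset.sum_congr rfl fun b _ => ?_
  have e1 : ∀ x y z : ι, (∀ j : Fin 3, ((j : ℕ) < 0 ∨ 0 + 2 ≤ (j : ℕ)) →
      (![a, b, c] : Fin 3 → ι) j = ![x, y, z] j) ↔ z = c := by
    intro x y z
    constructor
    · intro h
      exact (h 2 (by simp)).symm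
    · rintro rfl j hj
      fin_cases j <;> simp at hj ⊢
  have e2 : ∀ x y z : ι, (∀ j : Fin 3, ((j : ℕ) < 1 ∨ 1 + 2 ≤ (j : ℕ)) →
      (![x, y, z] : Fin 3 → ι) j = ![a', b, c'] j) ↔ x = a' := by
    intro x y z
    constructor
    · intro h
      exact h 0 (by simp)
    · rintro rfl j hj
      fin_cases j <;> simp at hj ⊢
  have w0 : ∀ x y z : ι, (fun t : Fin 2 => (![x, y, z] : Fin 3 → ι) ⟨0 + t, by omega⟩) = ![x, y] := by
    intro x y z
    ext i
    fin_cases i <;> rfl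
  have w1 : ∀ x y z : ι, (fun t : Fin 2 => (![x, y, z] : Fin 3 → ι) ⟨1 + t, by omega⟩) = ![y, z] := by
    intro x y z
    ext i
    fin_cases i <;> rfl
  simp only [e1, e2, w0, w1, ite_mul, mul_ite, zero_mul, mul_zero]
  rw [Finset.sum_eq_single a']
  · simp
  · intro x _ hx
    simp [hx]
  · simp

/-- What is used of a skew inverse. -/
structure SkewData (R : TensorMat ι 2 ℂ) (D : Matrix ι ι ℂ) : Prop where
  trace (a c : ι) : ∑ b, ∑ d, D d b * R ![a, b] ![c, d] = (1 : Matrix ι ι ℂ) a c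
  right (E : Matrix ι ι ℂ) : ∃ Z : Matrix ι ι ℂ, ∀ a c,
    ∑ b, ∑ d, Z d b * R ![a, b] ![c, d] = E a c
  left (E : Matrix ι ι ℂ) : ∃ Z : Matrix ι ι ℂ, ∀ b d,
    ∑ a, ∑ c, Z c a * R ![a, b] ![c, d] = E b d

/-- The weight solving either equation is E contracted with Ψ, and the skew inverse identities
collapse the sum; for E = 1 the right-hand weight is D itself. Thus weighted partial traces of R
over either factor produce every operator on the remaining one. -/
theorem skewData {R : TensorMat ι 2 ℂ} (hR : IsSkewInvertible R) : SkewData R (matrixD hR) := by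
  have hΨ := hR.choose_spec
  set Ψ := hR.choose
  have hr : ∀ a c a' c' : ι, ∑ b, ∑ b', R ![a, b] ![a', b'] * Ψ ![b', c] ![b, c'] =
      if a = c' ∧ c = a' then 1 else 0 := by
    intro a c a' c'
    rw [← partialTrace_mul, hΨ.right, flip_apply]
  have hl : ∀ a c a' c' : ι, ∑ b, ∑ b', Ψ ![a, b] ![a', b'] * R ![b', c] ![b, c'] =
      if a = c' ∧ c = a' then 1 else 0 := by
    intro a c a' c'
    rw [← partialTrace_mul, hΨ.left, flip_apply]
  have hD : ∀ a b, matrixD hR a b = ∑ c, Ψ ![a, c] ![b, c] := by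
    intro a b
    have h1 : ∀ a c : ι, Fin.insertNth (α := fun _ => ι) (1 : Fin 2) c (fun _ => a) = ![a, c] := by
      intro a c
      ext i
      fin_cases i <;> rfl
    simp only [matrixD, partialTrace, Matrix.of_apply, h1]
    rfl
  refine ⟨fun a c => ?_, fun E => ⟨Matrix.of fun d b => ∑ x, ∑ y, E y x * Ψ ![d, x] ![b, y],
    fun a c => ?_⟩, fun E => ⟨Matrix.of fun b b' => ∑ x, ∑ y, E y x * Ψ ![x, b] ![y, b'],
    fun c c' => ?_⟩⟩
  · simp only [hD, Finset.sum_mul]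
    have : ∀ b, ∑ d, ∑ x, Ψ ![d, x] ![b, x] * R ![a, b] ![c, d] =
        ∑ x, ∑ d, R ![a, b] ![c, d] * Ψ ![d, x] ![b, x] := by
      intro b
      rw [Finset.sum_comm]
      simp only [mul_comm]
    simp only [this]
    rw [Finset.sum_comm]
    simp only [hr]
    simp [Matrix.one_apply, ite_and]
  · simp only [Matrix.of_apply, Finset.sum_mul]
    calc _ = ∑ x, ∑ y, E y x * ∑ b, ∑ d, R ![a, b] ![c, d] * Ψ ![d, x] ![b, y] := by
          simp only [Finset.mul_sum]
          rw [Finset.sum_congr rfl fun b _ => Finset.sum_comm]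
          rw [Finset.sum_comm]
          refine Finset.sum_congr rfl fun x _ => ?_
          rw [Finset.sum_congr rfl fun b _ => Finset.sum_comm]
          rw [Finset.sum_comm]
          refine Finset.sum_congr rfl fun y _ => Finset.sum_congr rfl fun b _ =>
            Finset.sum_congr rfl fun d _ => by ring
      _ = _ := by
          simp only [hr]
          simp [ite_and]
  · simp only [Matrix.of_apply, Finset.sum_mul]
    calc _ = ∑ x, ∑ y, E y x * ∑ b, ∑ d, Ψ ![x, b] ![y, d] * R ![d, c] ![b, c'] := by
          simp only [Finset.mul_sum]
          rw [Finset.sum_comm]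
          rw [Finset.sum_congr rfl fun b _ => Finset.sum_congr rfl fun d _ => rfl]
          rw [Finset.sum_congr rfl fun b _ => Finset.sum_comm]
          rw [Finset.sum_comm]
          refine Finset.sum_congr rfl fun x _ => ?_
          rw [Finset.sum_congr rfl fun b _ => Finset.sum_comm]
          rw [Finset.sum_comm]
          refine Finset.sum_congr rfl fun y _ => Finset.sum_congr rfl fun b _ =>
            Finset.sum_congr rfl fun d _ => by ring
      _ = _ := by
          simp only [hl]
          simp [ite_and]

end SkewInverse

/-! ### Weighted partial traces of local operators -/

section RTrace

open Matrix

variable {ι : Type*} [Fintype ι] [DecidableEq ι] {A : Type*} [Ring A] [Algebra ℂ A]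

theorem num_two (i : ℕ) (X : TensorMat ι 2 ℂ) :
    num ι A i 2 X = ∑ a, ∑ b, ∑ c, ∑ d, X ![a, b] ![c, d] •
      (site ι A i (single a c 1) * site ι A (i + 1) (single b d 1)) := by
  have h : ∀ a b c d : ι, site ι A i (single a c 1) * site ι A (i + 1) (single b d 1) =
      num ι A i 2 (single ![a, b] ![c, d] 1) := by
    intro a b c d
    rw [site_eq i, ← num_tensorSnoc]
    congr 1
    ext x y
    have hx : x = ![x 0, x 1] := by ext i; fin_cases i <;> rfl
    have hy : y = ![y 0, y 1] := by ext i; fin_cases i <;> rfl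
    have e1 : ∀ a b x0 x1 : ι, ((![a, b] : Fin 2 → ι) = ![x0, x1]) ↔ a = x0 ∧ b = x1 := by
      intro a b x0 x1
      simp
    rw [hx, hy]
    simp only [tensorSnoc, Matrix.of_apply, oneLeg, single_apply, e1]
    have l1 : ∀ x0 x1 : ι, (![x0, x1] : Fin 2 → ι) (Fin.last 1) = x1 := fun _ _ => rfl
    have l2 : ∀ x0 x1 : ι, (Fin.init (![x0, x1] : Fin 2 → ι) : Fin 1 → ι) 0 = x0 := fun _ _ => rfl
    simp only [l1, l2]
    clear hx hy
    generalize x 0 = x0, x 1 = x1, y 0 = y0, y 1 = y1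
    have e3 : ((a = x0 ∧ b = x1) ∧ c = y0 ∧ d = y1) ↔ ((a = x0 ∧ c = y0) ∧ b = x1 ∧ d = y1) := by
      tauto
    rw [if_congr e3 rfl rfl]
    by_cases h1 : a = x0 ∧ c = y0 <;> by_cases h2 : b = x1 ∧ d = y1 <;> simp only [h1, h2] <;> simp
  simp only [h, ← map_smul, ← map_sum]
  congr 1
  conv_lhs => rw [Matrix.matrix_eq_sum_single X]
  simp only [sum_fin_two, smul_single, smul_eq_mul, mul_one]

theorem commute_num_two {C : Oper ι A} {i : ℕ} (h1 : ∀ Z, Commute C (site ι A i Z))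
    (h2 : ∀ Z, Commute C (site ι A (i + 1) Z)) (X : TensorMat ι 2 ℂ) :
    Commute C (num ι A i 2 X) := by
  rw [num_two]
  refine Commute.sum_right _ _ _ fun a _ => Commute.sum_right _ _ _ fun b _ =>
    Commute.sum_right _ _ _ fun c _ => Commute.sum_right _ _ _ fun d _ => Commute.smul_right ?_ _
  exact (h1 _).mul_right (h2 _)

variable (A) in
/-- The weighted partial trace over the factor `i`. -/
def rtr (D : Matrix ι ι ℂ) (i : ℕ) : Oper ι A →ₗ[ℂ] Oper ι A :=
  (ptr (site ι A i)).comp (LinearMap.mulLeft ℂ (site ι A i D))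

variable {D : Matrix ι ι ℂ}

theorem rtr_apply (i : ℕ) (T : Oper ι A) : rtr A D i T = ptr (site ι A i) (site ι A i D * T) := rfl

theorem rtr_mul_left {C : Oper ι A} {i : ℕ} (hC : ∀ Z, Commute C (site ι A i Z)) (T : Oper ι A) :
    rtr A D i (C * T) = C * rtr A D i T := by
  rw [rtr_apply, ← mul_assoc, ← (hC D).eq, mul_assoc, ptr_mul_left hC, rtr_apply]

theorem rtr_mul_right {C : Oper ι A} {i : ℕ} (hC : ∀ Z, Commute C (site ι A i Z)) (T : Oper ι A) :
    rtr A D i (T * C) = rtr A D i T * C := by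
  rw [rtr_apply, ← mul_assoc, ptr_mul_right hC, rtr_apply]

theorem rtr_site (i : ℕ) (Z : Matrix ι ι ℂ) : rtr A D i (site ι A i Z) = (D * Z).trace • 1 := by
  rw [rtr_apply, ← map_mul, ptr_one_map]

theorem rtr_of_commute {C : Oper ι A} {i : ℕ} (hC : ∀ Z, Commute C (site ι A i Z)) :
    rtr A D i C = D.trace • C := by
  have := rtr_mul_left (D := D) hC (site ι A i 1)
  rwa [rtr_site, map_one, mul_one, mul_one, mul_smul_comm, mul_one] at this

theorem commute_rtr_site {C : Oper ι A} {i j : ℕ} (hij : i ≠ j)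
    (hC : ∀ Z, Commute C (site ι A j Z)) (Z : Matrix ι ι ℂ) :
    Commute (rtr A D i C) (site ι A j Z) := by
  have hc : ∀ Y, Commute (site ι A j Z) (site ι A i Y) := fun Y => commute_site_site hij.symm _ _
  have h1 := rtr_mul_left (D := D) hc C
  rw [← (hC Z).eq, rtr_mul_right hc] at h1
  exact h1

theorem commute_rtr_self (C : Oper ι A) (i : ℕ) (Z : Matrix ι ι ℂ) :
    Commute (rtr A D i C) (site ι A i Z) := commute_ptr _ _

theorem rtr_comm {D' : Matrix ι ι ℂ} {i j : ℕ} (hij : i ≠ j) (T : Oper ι A) :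
    rtr A D i (rtr A D' j T) = rtr A D' j (rtr A D i T) := by
  rw [rtr_apply, rtr_apply, rtr_apply, rtr_apply,
    ← ptr_mul_left (φ := site ι A j) fun Z => commute_site_site hij _ _,
    ← ptr_mul_left (φ := site ι A i) fun Z => commute_site_site hij.symm _ _, ptr_comm fun Z W => commute_site_site hij _ _,
    ← mul_assoc, ← mul_assoc, (commute_site_site hij D D').eq]

theorem rtr_num_right (i : ℕ) (X : TensorMat ι 2 ℂ) :
    rtr A D (i + 1) (num ι A i 2 X) =
      site ι A i (Matrix.of fun a c => ∑ b, ∑ d, D d b * X ![a, b] ![c, d]) := by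
  rw [num_two]
  simp only [map_sum, map_smul]
  have h1 : ∀ a b c d : ι, rtr A D (i + 1)
      (site ι A i (single a c 1) * site ι A (i + 1) (single b d 1)) =
        D d b • site ι A i (single a c 1) := by
    intro a b c d
    rw [rtr_mul_left fun Z => commute_site_site (by omega) _ _, rtr_site, mul_smul_comm, mul_one,
      trace_mul_single, MulOpposite.op_one, one_smul]
  simp only [h1, ← map_smul, ← map_sum]
  congr 1
  conv_rhs => rw [Matrix.matrix_eq_sum_single (Matrix.of _)]
  refine Finset.sum_congr rfl fun a _ => ?_
  rw [Finset.sum_comm]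
  refine Finset.sum_congr rfl fun c _ => ?_
  ext x y
  simp only [Matrix.sum_apply, Matrix.smul_apply, Matrix.single_apply, Matrix.of_apply]
  split_ifs
  · simp [mul_comm]
  · simp

theorem rtr_num_left (i : ℕ) (X : TensorMat ι 2 ℂ) :
    rtr A D i (num ι A i 2 X) =
      site ι A (i + 1) (Matrix.of fun b d => ∑ a, ∑ c, D c a * X ![a, b] ![c, d]) := by
  rw [num_two]
  simp only [map_sum, map_smul]
  have h1 : ∀ a b c d : ι, rtr A D i
      (site ι A i (single a c 1) * site ι A (i + 1) (single b d 1)) =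
        D c a • site ι A (i + 1) (single b d 1) := by
    intro a b c d
    rw [rtr_mul_right fun Z => commute_site_site (by omega) _ _, rtr_site, smul_mul_assoc, one_mul,
      trace_mul_single, MulOpposite.op_one, one_smul]
  simp only [h1, ← map_smul, ← map_sum]
  congr 1
  conv_rhs => rw [Matrix.matrix_eq_sum_single (Matrix.of _)]
  rw [Finset.sum_comm]
  refine Finset.sum_congr rfl fun b _ => ?_
  rw [Finset.sum_congr rfl fun a _ => Finset.sum_comm, Finset.sum_comm]
  refine Finset.sum_congr rfl fun d _ => ?_
  ext x y
  simp only [Matrix.sum_apply, Matrix.smul_apply, Matrix.single_apply, Matrix.of_apply]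
  split_ifs
  · simp [mul_comm]
  · simp

end RTrace

section RTrace

open Matrix

theorem single_snoc {ι : Type*} [DecidableEq ι] {n : ℕ} (x y : Fin n → ι) (c d : ι) :
    single (Fin.snoc (α := fun _ => ι) x c : Fin (n + 1) → ι)
      (Fin.snoc (α := fun _ => ι) y d : Fin (n + 1) → ι) (1 : ℂ) =
        tensorSnoc (single x y 1) (single c d 1) := by
  ext a b
  obtain ⟨⟨a1, a0⟩, rfl⟩ := (Fin.snocEquiv fun _ => ι).surjective a
  obtain ⟨⟨b1, b0⟩, rfl⟩ := (Fin.snocEquiv fun _ => ι).surjective b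
  have e1 : ∀ (p : ι × (Fin n → ι)), (Fin.snocEquiv fun _ => ι) p =
    (Fin.snoc (α := fun _ => ι) p.2 p.1 : Fin (n + 1) → ι) := fun _ => rfl
  simp only [e1, tensorSnoc, Matrix.of_apply, Fin.init_snoc, Fin.snoc_last, single_apply,
    Fin.snoc_inj]
  by_cases h1 : x = a0 <;> by_cases h2 : c = a1 <;> by_cases h3 : y = b0 <;>
    by_cases h4 : d = b1 <;> simp [h1, h2, h3, h4]

variable {ι : Type*} [Fintype ι] [DecidableEq ι] {A : Type*} [Ring A] [Algebra ℂ A]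

variable (A) in
/-- An automorphism of `V ⊗ V` acting in the factors `i, i + 1`. -/
def gen (u : (TensorMat ι 2 ℂ)ˣ) (i : ℕ) : (Oper ι A)ˣ :=
  Units.map (num ι A i 2 : TensorMat ι 2 ℂ →* Oper ι A) u

theorem gen_val (u : (TensorMat ι 2 ℂ)ˣ) (i : ℕ) : (gen A u i : Oper ι A) = num ι A i 2 u := rfl

theorem gen_unit_inv (u : (TensorMat ι 2 ℂ)ˣ) (i : ℕ) : gen A u⁻¹ i = (gen A u i)⁻¹ := rfl

theorem commute_gen_gen (u v : (TensorMat ι 2 ℂ)ˣ) {i j : ℕ} (h : i + 1 < j ∨ j + 1 < i) :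
    Commute (gen A u i : Oper ι A) (gen A v j) :=
  commute_num_num (by omega) _ _

theorem commute_gen_site (u : (TensorMat ι 2 ℂ)ˣ) {i j : ℕ} (h : j < i ∨ i + 1 < j)
    (Z : Matrix ι ι ℂ) : Commute (gen A u i : Oper ι A) (site ι A j Z) :=
  commute_num_site (by omega) _ _

theorem commute_gen_inv_site (u : (TensorMat ι 2 ℂ)ˣ) {i j : ℕ} (h : j < i ∨ i + 1 < j)
    (Z : Matrix ι ι ℂ) : Commute (↑(gen A u i)⁻¹ : Oper ι A) (site ι A j Z) :=
  (commute_gen_site u h Z).units_inv_left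

variable {D : Matrix ι ι ℂ} {R F : (TensorMat ι 2 ℂ)ˣ}

theorem rtr_gen (hR : SkewData (R : TensorMat ι 2 ℂ) D) (i : ℕ) :
    rtr A D (i + 1) (gen A R i : Oper ι A) = 1 := by
  rw [gen_val, rtr_num_right, ← map_one (site ι A i)]
  congr 1
  ext a c
  exact hR.trace a c

/-- Write E on strand 1 as a weighted trace of R_0 over strand 0. Compatibility turns the conjugate
of R_0 by F_1 into a conjugate of R_1 by F_0, whose trace over strand 2 is 1 since the trace of R_1
is. What remains is the trace of the auxiliary weight, which equals Tr(D E) by taking the two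
partial traces of R_0 in the other order. -/
theorem rtr_twist_one (hR : SkewData (R : TensorMat ι 2 ℂ) D)
    (hF : (gen A F 1 : Oper ι A) * gen A R 0 * (↑(gen A F 1)⁻¹ : Oper ι A) =
      (↑(gen A F 0)⁻¹ : Oper ι A) * gen A R 1 * gen A F 0) (E : Matrix ι ι ℂ) :
    rtr A D 2 ((gen A F 1 : Oper ι A) * site ι A 1 E * (↑(gen A F 1)⁻¹ : Oper ι A)) =
      (D * E).trace • 1 := by
  obtain ⟨Z, hZ⟩ := hR.left E
  have hE : site ι A 1 E = rtr A Z 0 (gen A R 0 : Oper ι A) := by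
    rw [gen_val, rtr_num_left]
    congr 1
    ext b d
    exact (hZ b d).symm
  have h1 : (D * E).trace • (1 : Oper ι A) = Z.trace • 1 := by
    rw [← rtr_site 1, hE, rtr_comm (by omega), rtr_gen hR,
      rtr_of_commute fun _ => Commute.one_left _]
  have c1 : ∀ Z, Commute (gen A F 1 : Oper ι A) (site ι A 0 Z) := commute_gen_site F (by omega)
  have c2 : ∀ Z, Commute (↑(gen A F 1)⁻¹ : Oper ι A) (site ι A 0 Z) :=
    commute_gen_inv_site F (by omega)
  have c3 : ∀ Z, Commute (gen A F 0 : Oper ι A) (site ι A 2 Z) := commute_gen_site F (by omega)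
  have c4 : ∀ Z, Commute (↑(gen A F 0)⁻¹ : Oper ι A) (site ι A 2 Z) :=
    commute_gen_inv_site F (by omega)
  rw [h1, hE, ← rtr_mul_left c1, ← rtr_mul_right c2, rtr_comm (by omega), hF, rtr_mul_right c3,
    rtr_mul_left c4, rtr_gen hR, mul_one, Units.inv_mul, rtr_of_commute fun _ => Commute.one_left _]

/-- Weighted traces of conjugates by a compatible Yang--Baxter matrix. -/
theorem rtr_twist_site [Nonempty ι] [Nontrivial A] (hR : SkewData (R : TensorMat ι 2 ℂ) D)
    (hF : (gen A F 1 : Oper ι A) * gen A R 0 * (↑(gen A F 1)⁻¹ : Oper ι A) =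
      (↑(gen A F 0)⁻¹ : Oper ι A) * gen A R 1 * gen A F 0) (i : ℕ) (E : Matrix ι ι ℂ) :
    rtr A D (i + 1) ((gen A F i : Oper ι A) * site ι A i E * (↑(gen A F i)⁻¹ : Oper ι A)) =
      (D * E).trace • 1 := by
  have h1 : ∀ i, (gen A F i : Oper ι A) * site ι A i E * (↑(gen A F i)⁻¹ : Oper ι A) =
      num ι A i 2 ((F : TensorMat ι 2 ℂ) * embed (oneLeg E) 2 0 (by omega) *
        (↑F⁻¹ : TensorMat ι 2 ℂ)) := by
    intro i
    rw [map_mul, map_mul, num_embed, add_zero]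
    rfl
  -- The auxiliary strand used at position 1 is gone from the result, which is an identity between
  -- two-factor matrices and so holds at every position.
  have h2 := rtr_twist_one hR hF E
  rw [h1 1, rtr_num_right, ← map_one (site ι A 1), ← map_smul] at h2
  have h3 := site_injective 1 h2
  rw [h1 i, rtr_num_right, h3, map_smul, map_one]

/-- Expansion along the matrix units of strand i reduces to one-strand operators: the coefficients
commute with both strands, hence with F_i. -/
theorem rtr_twist [Nonempty ι] [Nontrivial A] (hR : SkewData (R : TensorMat ι 2 ℂ) D)
    (hF : (gen A F 1 : Oper ι A) * gen A R 0 * (↑(gen A F 1)⁻¹ : Oper ι A) =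
      (↑(gen A F 0)⁻¹ : Oper ι A) * gen A R 1 * gen A F 0) (i : ℕ) (T : Oper ι A)
    (hT : ∀ Z, Commute T (site ι A (i + 1) Z)) :
    rtr A D (i + 1) ((gen A F i : Oper ι A) * T * (↑(gen A F i)⁻¹ : Oper ι A)) = rtr A D i T := by
  have hsum := eq_sum_ptr (φ := site ι A i) T
  have hc1 : ∀ x y Z, Commute (ptr (site ι A i) (site ι A i (single y x 1) * T))
      (site ι A i Z) := fun x y Z => commute_ptr _ _
  have hc2 : ∀ x y Z, Commute (ptr (site ι A i) (site ι A i (single y x 1) * T))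
      (site ι A (i + 1) Z) := fun x y Z =>
    commute_rtr_site (D := single y x 1) (by omega) hT Z
  have hc3 : ∀ x y, Commute (ptr (site ι A i) (site ι A i (single y x 1) * T))
      (gen A F i : Oper ι A) := fun x y => commute_num_two (hc1 x y) (hc2 x y) _
  generalize (fun x y => ptr (site ι A i) (site ι A i (single y x 1) * T)) = t at *
  rw [hsum]
  simp only [Finset.mul_sum, Finset.sum_mul, map_sum]
  refine Finset.sum_congr rfl fun x _ => Finset.sum_congr rfl fun y _ => ?_
  rw [rtr_mul_left (hc1 x y), rtr_site, ← mul_assoc, ← (hc3 x y).eq, mul_assoc, mul_assoc,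
    rtr_mul_left (hc2 x y), ← mul_assoc, rtr_twist_site hR hF]

/-! ### Traces over several factors -/

variable (A) in
/-- The weighted partial trace over the factors `i, …, i + n - 1`. -/
def rtrN (D : Matrix ι ι ℂ) (i : ℕ) : ℕ → Oper ι A →ₗ[ℂ] Oper ι A
  | 0 => LinearMap.id
  | n + 1 => (rtrN D i n).comp (rtr A D (i + n))

variable (A) in
/-- The product of the weights in the factors `i, …, i + n - 1`. -/
def weight (D : Matrix ι ι ℂ) (i : ℕ) : ℕ → Oper ι A
  | 0 => 1
  | n + 1 => weight D i n * site ι A (i + n) D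

theorem rtrN_zero (i : ℕ) (T : Oper ι A) : rtrN A D i 0 T = T := rfl

theorem rtrN_succ (i n : ℕ) (T : Oper ι A) :
    rtrN A D i (n + 1) T = rtrN A D i n (rtr A D (i + n) T) := rfl

theorem rtrN_add (i m : ℕ) : ∀ (n : ℕ) (T : Oper ι A),
    rtrN A D i (m + n) T = rtrN A D i m (rtrN A D (i + m) n T)
  | 0, T => rfl
  | n + 1, T => by
    rw [← add_assoc, rtrN_succ, rtrN_add i m n, rtrN_succ, add_assoc]

theorem rtrN_mul_left {C : Oper ι A} {i : ℕ} : ∀ {n : ℕ}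
    (_ : ∀ j, i ≤ j → j < i + n → ∀ Z, Commute C (site ι A j Z)) (T : Oper ι A),
    rtrN A D i n (C * T) = C * rtrN A D i n T
  | 0, _, T => rfl
  | n + 1, hC, T => by
    rw [rtrN_succ, rtr_mul_left (hC _ (by omega) (by omega)),
      rtrN_mul_left fun j h1 h2 => hC j h1 (by omega), rtrN_succ]

theorem rtrN_mul_right {C : Oper ι A} {i : ℕ} : ∀ {n : ℕ}
    (_ : ∀ j, i ≤ j → j < i + n → ∀ Z, Commute C (site ι A j Z)) (T : Oper ι A),
    rtrN A D i n (T * C) = rtrN A D i n T * C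
  | 0, _, T => rfl
  | n + 1, hC, T => by
    rw [rtrN_succ, rtr_mul_right (hC _ (by omega) (by omega)),
      rtrN_mul_right fun j h1 h2 => hC j h1 (by omega), rtrN_succ]

/-- The product `f_i f_{i+1} ⋯ f_{i+n-1}`. -/
def asc {G : Type*} [Monoid G] (f : ℕ → G) (i : ℕ) : ℕ → G
  | 0 => 1
  | n + 1 => asc f i n * f (i + n)

theorem commute_asc {B : Type*} [Monoid B] {f : ℕ → Bˣ} {u : B} {i : ℕ} : ∀ {n : ℕ}
    (_ : ∀ j, i ≤ j → j < i + n → Commute u (f j : B)), Commute u (asc f i n : Bˣ)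
  | 0, _ => by simp [asc]
  | n + 1, hu => by
    rw [asc, Units.val_mul]
    exact (commute_asc fun j h1 h2 => hu j h1 (by omega)).mul_right (hu _ (by omega) (by omega))

theorem rtrN_twist [Nonempty ι] [Nontrivial A] (hR : SkewData (R : TensorMat ι 2 ℂ) D)
    (hF : (gen A F 1 : Oper ι A) * gen A R 0 * (↑(gen A F 1)⁻¹ : Oper ι A) =
      (↑(gen A F 0)⁻¹ : Oper ι A) * gen A R 1 * gen A F 0) (i : ℕ) : ∀ (n : ℕ) (T : Oper ι A)
    (_ : ∀ j, i + n ≤ j → ∀ Z, Commute T (site ι A j Z)),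
    rtrN A D (i + 1) n ((asc (gen A F) i n : (Oper ι A)ˣ) * T *
      (↑(asc (gen A F) i n)⁻¹ : Oper ι A)) = rtrN A D i n T
  | 0, T, _ => by simp [asc, rtrN_zero]
  | n + 1, T, hT => by
    have hc : ∀ Z, Commute ((asc (gen A F) i n : (Oper ι A)ˣ) : Oper ι A)
        (site ι A (i + n + 1) Z) := fun Z =>
      (commute_asc fun j h1 h2 => (commute_gen_site F (by omega) Z).symm).symm
    have hc' : ∀ Z, Commute (↑(asc (gen A F) i n)⁻¹ : Oper ι A)
        (site ι A (i + n + 1) Z) := fun Z => (hc Z).units_inv_left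
    rw [rtrN_succ, rtrN_succ, asc, _root_.mul_inv_rev, Units.val_mul, Units.val_mul,
      show i + 1 + n = i + n + 1 by ring]
    have h1 : ∀ a b c d : Oper ι A, a * b * T * (c * d) = a * (b * T * c) * d := by
      intro a b c d
      simp only [mul_assoc]
    rw [h1, rtr_mul_right hc', rtr_mul_left hc, rtr_twist hR hF _ _ (hT _ (by omega))]
    refine rtrN_twist hR hF i n _ fun j hj Z => ?_
    by_cases hj' : i + n = j
    · subst hj'
      exact commute_rtr_self _ _ _
    · exact commute_rtr_site hj' (hT j (by omega)) Z

theorem ptr_num_zero (i : ℕ) (T : Oper ι A) : ptr (num ι A i 0) T = T := by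
  have h : ∀ x y : Fin 0 → ι, single x y (1 : ℂ) = 1 := by
    intro x y
    ext a b
    obtain rfl := Subsingleton.elim x a
    obtain rfl := Subsingleton.elim y x
    obtain rfl := Subsingleton.elim b y
    simp
  rw [ptr_apply]
  simp [h]

theorem ptr_num_succ (i n : ℕ) (T : Oper ι A) :
    ptr (num ι A i (n + 1)) T = ptr (num ι A i n) (ptr (site ι A (i + n)) T) := by
  rw [ptr_apply, ptr_apply (φ := num ι A i n)]
  rw [← (Fin.snocEquiv fun _ => ι).sum_comp, Fintype.sum_prod_type, Finset.sum_comm]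
  refine Finset.sum_congr rfl fun x _ => ?_
  have h1 : ∀ c, ∑ y : Fin (n + 1) → ι,
      num ι A i (n + 1) (single ((Fin.snocEquiv fun _ => ι) (c, x)) y 1) * T *
        num ι A i (n + 1) (single y ((Fin.snocEquiv fun _ => ι) (c, x)) 1) =
      ∑ y : Fin n → ι, ∑ d, num ι A i n (single x y 1) *
        (site ι A (i + n) (single c d 1) * T * site ι A (i + n) (single d c 1)) *
          num ι A i n (single y x 1) := by
    intro c
    rw [← (Fin.snocEquiv fun _ => ι).sum_comp, Fintype.sum_prod_type, Finset.sum_comm]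
    refine Finset.sum_congr rfl fun y _ => Finset.sum_congr rfl fun d _ => ?_
    have e1 : ∀ (p : ι × (Fin n → ι)), (Fin.snocEquiv fun _ => ι) p =
      (Fin.snoc (α := fun _ => ι) p.2 p.1 : Fin (n + 1) → ι) := fun _ => rfl
    have hc : Commute (num ι A i n (single y x 1)) (site ι A (i + n) (single d c 1)) :=
      commute_num_site (by omega) _ _
    rw [e1, e1, single_snoc, single_snoc, num_tensorSnoc, num_tensorSnoc, hc.eq]
    simp only [mul_assoc]
  simp only [h1]
  rw [Finset.sum_comm]
  refine Finset.sum_congr rfl fun y _ => ?_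
  rw [ptr_apply]
  simp only [Finset.mul_sum, Finset.sum_mul]

theorem commute_weight {C : Oper ι A} {i : ℕ} : ∀ {n : ℕ}
    (_ : ∀ j, i ≤ j → j < i + n → ∀ Z, Commute C (site ι A j Z)), Commute C (weight A D i n)
  | 0, _ => Commute.one_right _
  | n + 1, hC => (commute_weight fun j h1 h2 => hC j h1 (by omega)).mul_right
      (hC _ (by omega) (by omega) _)

theorem rtrN_eq (i : ℕ) : ∀ (n : ℕ) (T : Oper ι A),
    rtrN A D i n T = ptr (num ι A i n) (weight A D i n * T)
  | 0, T => by rw [rtrN_zero, ptr_num_zero, weight, one_mul]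
  | n + 1, T => by
    have hc : ∀ Z, Commute (weight A D i n) (site ι A (i + n) Z) := fun Z =>
      (commute_weight fun j h1 h2 Y => commute_site_site (by omega) _ _).symm
    rw [rtrN_succ, rtrN_eq i n, ptr_num_succ, rtr_apply, weight, mul_assoc, ptr_mul_left hc]

theorem weight_one (i : ℕ) : ∀ n : ℕ, weight A (1 : Matrix ι ι ℂ) i n = 1
  | 0 => rfl
  | n + 1 => by rw [weight, weight_one i n, map_one, mul_one]

theorem rtrN_one (i n : ℕ) (T : Oper ι A) : rtrN A (1 : Matrix ι ι ℂ) i n T = ptr (num ι A i n) T := by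
  rw [rtrN_eq, weight_one, one_mul]

/-- The tensor power of the weight. -/
def weightMat (D : Matrix ι ι ℂ) (n : ℕ) : TensorMat ι n ℂ := Matrix.of fun x y => ∏ j, D (x j) (y j)

theorem num_weightMat (i : ℕ) : ∀ n : ℕ, num ι A i n (weightMat D n) = weight A D i n
  | 0 => by
    have : weightMat D 0 = 1 := by
      ext a b
      obtain rfl := Subsingleton.elim a b
      simp [weightMat]
    rw [this, map_one, weight]
  | n + 1 => by
    have : weightMat D (n + 1) = tensorSnoc (weightMat D n) D := by
      ext a b
      simp only [weightMat, tensorSnoc, Matrix.of_apply, Fin.prod_univ_castSucc]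
      rfl
    rw [this, num_tensorSnoc, num_weightMat i n, weight]

/-- Bridge to the finite formulation: the operator trace over all strands is left multiplication by
the element `rTrace` of A. -/
theorem rtrN_op (n : ℕ) (X : TensorMat ι n A) :
    rtrN A D 0 n (op ι A 0 n X) = lmul ι A (rTrace D X) := by
  rw [op_eq_sum, rTrace, Finset.sum_comm]
  simp only [map_sum]
  refine Finset.sum_congr rfl fun x _ => Finset.sum_congr rfl fun y _ => ?_
  have hl : ∀ Z, Commute (lmul ι A (X y x)) (num ι A 0 n Z) := fun Z => commute_lmul_num _ _ _ _
  rw [rtrN_eq, ← num_weightMat, ← mul_assoc, ← (hl _).eq, mul_assoc, ← map_mul, ptr_mul_map hl,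
    trace_mul_single, MulOpposite.op_one, one_smul, map_smul]
  rfl

theorem num_mem_range {i j m n : ℕ} (h1 : i ≤ j) (h2 : j + m ≤ i + n) (X : TensorMat ι m ℂ) :
    num ι A j m X ∈ (num ι A i n).range :=
  ⟨embed X n (j - i) (by omega), by
    change num ι A i n _ = _
    rw [num_embed, Nat.add_sub_cancel' h1]⟩

/-- The unweighted trace is cyclic for numerical X; commuting with the weight is exactly what the
weighted trace needs in addition. -/
theorem rtrN_cyc {i n : ℕ} {X : Oper ι A} (hX : X ∈ (num ι A i n).range)
    (hc : Commute X (weight A D i n)) (T : Oper ι A) :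
    rtrN A D i n (X * T) = rtrN A D i n (T * X) := by
  obtain ⟨Z, rfl⟩ := hX
  change Commute (num ι A i n Z) _ at hc
  change rtrN A D i n (num ι A i n Z * T) = rtrN A D i n (T * num ι A i n Z)
  rw [rtrN_eq, rtrN_eq, ← mul_assoc, ← hc.eq, mul_assoc, ptr_cyc, mul_assoc]

theorem commute_gen_weight {u : (TensorMat ι 2 ℂ)ˣ} {l i : ℕ}
    (hu : Commute (gen A u l : Oper ι A) (site ι A l D * site ι A (l + 1) D)) (h1 : i ≤ l) :
    ∀ {n : ℕ}, l + 2 ≤ i + n → Commute (gen A u l : Oper ι A) (weight A D i n)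
  | 0, h2 => by omega
  | 1, h2 => by omega
  | n + 2, h2 => by
    by_cases h3 : l + 2 ≤ i + (n + 1)
    · rw [weight]
      exact (commute_gen_weight hu h1 h3).mul_right (commute_gen_site u (by omega) _)
    · obtain rfl : l = i + n := by omega
      rw [weight, weight, mul_assoc]
      exact (commute_weight fun j h1 h2 Z => commute_gen_site u (by omega) _).mul_right hu

end RTrace

/-! ### Invariance of the weight under the braid generators -/

section RTrace

open Matrix

variable {ι : Type*} [Fintype ι] [DecidableEq ι] {A : Type*} [Ring A] [Algebra ℂ A]
  {D : Matrix ι ι ℂ} {R : (TensorMat ι 2 ℂ)ˣ}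

theorem rtr_mul_site (D : Matrix ι ι ℂ) {i j : ℕ} (h : i ≠ j) (Z : Matrix ι ι ℂ) (T : Oper ι A) :
    rtr A D i (T * site ι A j Z) = rtr A D i T * site ι A j Z :=
  rtr_mul_right (fun _ => commute_site_site h.symm _ _) T

theorem rtr_site_mul (D : Matrix ι ι ℂ) {i j : ℕ} (h : i ≠ j) (Z : Matrix ι ι ℂ) (T : Oper ι A) :
    rtr A D i (site ι A j Z * T) = site ι A j Z * rtr A D i T :=
  rtr_mul_left (fun _ => commute_site_site h.symm _ _) T

/-- Twisting by R and by R⁻¹ shows that s⁻¹ and X_i s Z_i may be interchanged under the weighted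
trace, both orders giving Tr(D X) Tr(D Z). Weighted traces of s over strand i give all operators on
strand i + 1, so the same holds for every two-strand operator, and nondegeneracy of the trace form
gives the claim. -/
theorem commute_gen_weight_two [Nonempty ι] [Nontrivial A]
    (hR : SkewData (R : TensorMat ι 2 ℂ) D)
    (hb : (gen A R 0 : Oper ι A) * gen A R 1 * gen A R 0 = gen A R 1 * gen A R 0 * gen A R 1)
    (i : ℕ) : Commute (gen A R i : Oper ι A) (site ι A i D * site ι A (i + 1) D) := by
  -- For F = R or F = R⁻¹ the compatibility condition is the braid relation.
  have h1 := rtr_twist_site (F := R) hR (A := A) (by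
    rw [Units.mul_inv_eq_iff_eq_mul, mul_assoc, mul_assoc, Units.eq_inv_mul_iff_mul_eq]
    simpa only [mul_assoc] using hb) i
  have h2 := rtr_twist_site (F := R⁻¹) hR (A := A) (by
    simp only [gen_unit_inv, inv_inv]
    rw [Units.eq_mul_inv_iff_mul_eq, mul_assoc, mul_assoc, Units.inv_mul_eq_iff_eq_mul]
    simpa only [mul_assoc] using hb) i
  simp only [gen_unit_inv, inv_inv] at h2
  set s := gen A R i
  have hs : ∀ E, ∃ Z, site ι A (i + 1) E = rtr A Z i (s : Oper ι A) := by
    intro E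
    obtain ⟨Z, hZ⟩ := hR.left E
    refine ⟨Z, ?_⟩
    rw [gen_val, rtr_num_left]
    congr 1
    ext b d
    exact (hZ b d).symm
  let τ : Oper ι A →ₗ[ℂ] Oper ι A := rtrN A D i 2
  have hτ : ∀ T, τ T = rtr A D i (rtr A D (i + 1) T) := fun T => rfl
  have k1 : ∀ X Z, τ ((↑s⁻¹ : Oper ι A) * (site ι A i X * s * site ι A i Z)) =
      τ ((site ι A i X * s * site ι A i Z) * (↑s⁻¹ : Oper ι A)) := by
    intro X Z
    rw [hτ, hτ, ← mul_assoc, ← mul_assoc, rtr_mul_site _ (by omega), h2, mul_assoc _ (s : Oper ι A),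
      mul_assoc, rtr_site_mul _ (by omega), h1]
    simp only [smul_mul_assoc, mul_smul_comm, one_mul, mul_one, map_smul, rtr_site, smul_smul]
    rw [mul_comm]
  have k2 : ∀ X E, τ ((↑s⁻¹ : Oper ι A) * (site ι A i X * site ι A (i + 1) E)) =
      τ ((site ι A i X * site ι A (i + 1) E) * (↑s⁻¹ : Oper ι A)) := by
    intro X E
    -- Replacing E by a weighted trace of s turns the operator into a sum of terms covered by `k1`.
    obtain ⟨Z, hZ⟩ := hs E
    rw [hZ, rtr_apply, ptr_apply]
    simp only [Finset.mul_sum, Finset.sum_mul, map_sum]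
    refine Finset.sum_congr rfl fun x _ => Finset.sum_congr rfl fun y _ => ?_
    have := k1 (X * (single x y 1 * Z)) (single y x 1)
    simpa only [map_mul, mul_assoc] using this
  have k3 : ∀ Y, τ ((↑s⁻¹ : Oper ι A) * num ι A i 2 Y) = τ (num ι A i 2 Y * (↑s⁻¹ : Oper ι A)) := by
    intro Y
    rw [num_two]
    simp only [Finset.mul_sum, Finset.sum_mul, map_sum, mul_smul_comm, smul_mul_assoc, map_smul, k2]
  have hw : weight A D i 2 = site ι A i D * site ι A (i + 1) D := by
    rw [weight, weight, weight, one_mul]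
    rfl
  have k4 : weightMat D 2 * (↑R⁻¹ : TensorMat ι 2 ℂ) = ↑R⁻¹ * weightMat D 2 := by
    refine Matrix.ext_iff_trace_mul_right.2 fun Y => ?_
    have := k3 Y
    have hinv : (↑s⁻¹ : Oper ι A) = num ι A i 2 (↑R⁻¹ : TensorMat ι 2 ℂ) := rfl
    simp only [τ, rtrN_eq, ← num_weightMat, hinv, ← map_mul, ptr_one_map] at this
    have h3 := smul_left_injective ℂ (one_ne_zero (α := Oper ι A)) this
    rw [mul_assoc, h3, ← mul_assoc, trace_mul_comm, mul_assoc]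
  have k5 : Commute (↑s⁻¹ : Oper ι A) (weight A D i 2) := by
    have := congrArg (num ι A i 2) k4
    rw [map_mul, map_mul, num_weightMat] at this
    exact this.symm
  rw [← hw]
  simpa only [inv_inv] using k5.units_inv_left

end RTrace

/-! ### The Yang–Baxter representation on infinitely many strands -/

section Representation

open Matrix

theorem embed_self {ι A : Type*} [DecidableEq ι] [Zero A] {n : ℕ} (X : TensorMat ι n A) (h : 0 + n ≤ n) :
    embed X n 0 h = X := by
  ext x y
  simp only [embed, Matrix.of_apply]
  rw [if_pos fun j hj => by omega]
  simp only [zero_add]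

variable {ι : Type*} [Fintype ι] [DecidableEq ι]

variable {q μ : ℂ} {R : TensorMat ι 2 ℂ}

theorem ybRep_sigma (hB : IsBMWType q μ R) (n : ℕ) (i : Fin (n - 1)) :
    ybRep hB n (BMW.sigma q μ n i) = twoLegs R n i :=
  (hB.rep n).choose_spec i

theorem IsBMWType.isUnit (hB : IsBMWType q μ R) : IsUnit R := by
  have h0 := ybRep_sigma hB 2 ⟨0, by norm_num⟩
  rw [twoLegs, embed_self] at h0
  have h1 := RingQuot.mkAlgHom_rel ℂ (BMWRel.s_sInv (q := q) (μ := μ) (n := 2) ⟨0, by norm_num⟩)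
  have h2 := RingQuot.mkAlgHom_rel ℂ (BMWRel.sInv_s (q := q) (μ := μ) (n := 2) ⟨0, by norm_num⟩)
  rw [map_mul, map_one] at h1 h2
  have h3 := congrArg (ybRep hB 2) h1
  have h4 := congrArg (ybRep hB 2) h2
  rw [← h0]
  exact ⟨⟨ybRep hB 2 (BMW.sigma q μ 2 ⟨0, by norm_num⟩),
    ybRep hB 2 (RingQuot.mkAlgHom ℂ (BMWRel q μ 2) (BMWGen.T ⟨0, by norm_num⟩)),
    (map_mul (ybRep hB 2) _ _).symm.trans (h3.trans (map_one _)),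
    (map_mul (ybRep hB 2) _ _).symm.trans (h4.trans (map_one _))⟩, rfl⟩

/-- The braid generator of an operator of BMW type. -/
def IsBMWType.unit (hB : IsBMWType q μ R) : (TensorMat ι 2 ℂ)ˣ := hB.isUnit.unit

theorem IsBMWType.unit_val (hB : IsBMWType q μ R) : (hB.unit : TensorMat ι 2 ℂ) = R := rfl

/-- The image of the contractor generator. -/
def kappaMat (q μ : ℂ) (R : TensorMat ι 2 ℂ) : TensorMat ι 2 ℂ :=
  (μ * (q - q⁻¹))⁻¹ • ((q • 1 - R) * (q⁻¹ • 1 + R))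

variable (A : Type*) [Ring A] [Algebra ℂ A]

/-- The representation by local operators in the factors `p, …, p + n - 1`. -/
def operRep (hB : IsBMWType q μ R) (p n : ℕ) : BMW q μ n →ₐ[ℂ] Oper ι A :=
  (num ι A p n).comp (ybRep hB n)

/-- The contractors as local operators. -/
def kap (q μ : ℂ) (R : TensorMat ι 2 ℂ) (i : ℕ) : Oper ι A := num ι A i 2 (kappaMat q μ R)

variable {A}

theorem operRep_sigma (hB : IsBMWType q μ R) (p n : ℕ) (i : Fin (n - 1)) :
    operRep A hB p n (BMW.sigma q μ n i) = gen A hB.unit (p + i) := by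
  have : operRep A hB p n (BMW.sigma q μ n i) = num ι A p n (ybRep hB n (BMW.sigma q μ n i)) := rfl
  rw [this, ybRep_sigma, twoLegs, num_embed]
  rfl

theorem kap_eq (hB : IsBMWType q μ R) (i : ℕ) :
    kap A q μ R i = (μ * (q - q⁻¹))⁻¹ •
      ((q • 1 - (gen A hB.unit i : Oper ι A)) * (q⁻¹ • 1 + (gen A hB.unit i : Oper ι A))) := by
  rw [kap, kappaMat]
  simp only [map_smul, map_mul, map_sub, map_add, map_one]
  rfl

variable (A) in
/-- The composite of the representation with the presentation. -/
def freeRep (hB : IsBMWType q μ R) (p n : ℕ) : FreeAlgebra ℂ (BMWGen n) →ₐ[ℂ] Oper ι A :=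
  (operRep A hB p n).comp (RingQuot.mkAlgHom ℂ (BMWRel q μ n))

theorem freeRep_rel (hB : IsBMWType q μ R) {p n : ℕ} {x y : FreeAlgebra ℂ (BMWGen n)}
    (h : BMWRel q μ n x y) : freeRep A hB p n x = freeRep A hB p n y :=
  congrArg (operRep A hB p n) (RingQuot.mkAlgHom_rel ℂ h)

theorem freeRep_S (hB : IsBMWType q μ R) {p n : ℕ} (i : Fin (n - 1)) :
    freeRep A hB p n (BMWGen.S i) = gen A hB.unit (p + i) := operRep_sigma hB p n i

theorem freeRep_T (hB : IsBMWType q μ R) {p n : ℕ} (i : Fin (n - 1)) :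
    freeRep A hB p n (BMWGen.T i) = (↑(gen A hB.unit (p + i))⁻¹ : Oper ι A) := by
  have h := freeRep_rel (A := A) (p := p) hB (BMWRel.s_sInv i)
  rw [map_mul, map_one, freeRep_S] at h
  exact (Units.inv_eq_of_mul_eq_one_right h).symm

theorem freeRep_K (hB : IsBMWType q μ R) {p n : ℕ} (i : Fin (n - 1)) :
    freeRep A hB p n (BMWGen.K i) = kap A q μ R (p + i) := by
  have h := freeRep_rel (A := A) (p := p) hB (BMWRel.kappa i)
  rw [h, kap_eq hB]
  simp only [map_smul, map_mul, map_sub, map_add, map_one, freeRep_S]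

theorem operRep_kappa (hB : IsBMWType q μ R) (p n : ℕ) (i : Fin (n - 1)) :
    operRep A hB p n (BMW.kappa q μ n i) = kap A q μ R (p + i) := freeRep_K hB i

/-- Each local relation holds in 𝒲_n once n is large, and the representation can be placed on the
first n strands; commutation of distant generators comes from disjoint supports. -/
theorem bmwSystem (hB : IsBMWType q μ R) :
    BMWSystem q μ (gen A hB.unit : ℕ → (Oper ι A)ˣ) (kap A q μ R) where
  braid i := by
    have h := freeRep_rel (A := A) (p := 0) hB (n := i + 3)
      (BMWRel.braid ⟨i, by omega⟩ ⟨i + 1, by omega⟩ (Or.inl rfl))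
    simpa only [map_mul, freeRep_S, zero_add] using h
  comm i j h := commute_gen_gen _ _ (Or.inl h)
  kappa i := kap_eq hB i
  s_e i := by
    have h := freeRep_rel (A := A) (p := 0) hB (n := i + 3) (BMWRel.s_k ⟨i, by omega⟩)
    simpa only [map_mul, map_smul, freeRep_S, freeRep_K, zero_add] using h
  e_s_adj i j hij := by
    have h := freeRep_rel (A := A) (p := 0) hB (n := i + j + 3)
      (BMWRel.k_s_adj ⟨i, by omega⟩ ⟨j, by omega⟩ hij)
    simpa only [map_mul, freeRep_S, freeRep_K, freeRep_T, zero_add] using h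
  e_t_adj i j hij := by
    have h := freeRep_rel (A := A) (p := 0) hB (n := i + j + 3)
      (BMWRel.k_sInv_adj ⟨i, by omega⟩ ⟨j, by omega⟩ hij)
    simpa only [map_mul, freeRep_S, freeRep_K, freeRep_T, zero_add] using h
  s_e_adj i j hij := by
    have h := freeRep_rel (A := A) (p := 0) hB (n := i + j + 3)
      (BMWRel.s_k_adj ⟨i, by omega⟩ ⟨j, by omega⟩ hij)
    simpa only [map_mul, freeRep_S, freeRep_K, freeRep_T, zero_add] using h
  t_e_adj i j hij := by
    have h := freeRep_rel (A := A) (p := 0) hB (n := i + j + 3)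
      (BMWRel.sInv_k_adj ⟨i, by omega⟩ ⟨j, by omega⟩ hij)
    simpa only [map_mul, freeRep_S, freeRep_K, freeRep_T, zero_add] using h
  e_e_e i j hij := by
    have h := freeRep_rel (A := A) (p := 0) hB (n := i + j + 3)
      (BMWRel.k_k_k ⟨i, by omega⟩ ⟨j, by omega⟩ hij)
    simpa only [map_mul, freeRep_K, zero_add] using h
  e_e i := by
    have h := freeRep_rel (A := A) (p := 0) hB (n := i + 3) (BMWRel.k_k ⟨i, by omega⟩)
    simpa only [map_mul, map_smul, freeRep_K, zero_add] using h

theorem operRep_antisymm (hB : IsBMWType q μ R) (p : ℕ) {n p' : ℕ} : ∀ (m : ℕ) (h : p' + m ≤ n),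
    operRep A hB p n (BMW.antisymm q μ n p' m h) =
      asym q μ (gen A hB.unit) (kap A q μ R) (p + p') m
  | 0, _ => map_one _
  | 1, _ => map_one _
  | m + 2, h => by
    rw [BMW.antisymm, asym, map_smul, map_mul, map_mul, operRep_antisymm hB p (m + 1),
      BMW.baxterMinus, bax, map_add, map_add, map_one, map_smul, map_smul, operRep_sigma,
      operRep_kappa, add_assoc p p' m]

/-- The matrix of the antisymmetrizer. -/
def antisymMat (hB : IsBMWType q μ R) (n : ℕ) : TensorMat ι n ℂ :=
  ybRep hB n (BMW.antisymmetrizer q μ n)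

theorem num_antisymMat (hB : IsBMWType q μ R) (p n : ℕ) :
    num ι A p n (antisymMat hB n) = asym q μ (gen A hB.unit) (kap A q μ R) p n :=
  operRep_antisymm hB p n (by omega)

theorem num_ybRep_kappa (hB : IsBMWType q μ R) :
    num ι A 0 2 (ybRep hB 2 (BMW.kappa q μ 2 ⟨0, by norm_num⟩)) = kap A q μ R 0 :=
  operRep_kappa hB 0 2 ⟨0, by norm_num⟩

end Representation

section RankOne

open Matrix

/-! ### The contractor has rank one -/

theorem vecMulVec_mul_mul_vecMulVec {X : Type*} [Fintype X] (c b : X → ℂ) (Z : Matrix X X ℂ) :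
    vecMulVec c b * Z * vecMulVec c b = (vecMulVec c b * Z).trace • vecMulVec c b := by
  rw [vecMulVec_mul, vecMulVec_mul_vecMulVec, trace_vecMulVec, dotProduct_comm]
  ext i j
  simp [vecMulVec_apply]
  ring

variable {ι : Type*} [Fintype ι] [DecidableEq ι] {q μ : ℂ} {R : TensorMat ι 2 ℂ}

/-- If κ acted by zero, R would be annihilated by (q - x)(q⁻¹ + x), whose roots differ from the
eigenvalue μ. -/
theorem kappaMat_ne_zero (hB : IsBMWType q μ R) (h1 : μ ≠ q) (h2 : μ ≠ -q⁻¹)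
    (hl : q - q⁻¹ ≠ 0) (hμ : μ ≠ 0) : kappaMat q μ R ≠ 0 := by
  intro h0
  have h3 : (q • (1 : TensorMat ι 2 ℂ) - R) * (q⁻¹ • 1 + R) = 0 := by
    rw [kappaMat] at h0
    exact (smul_eq_zero.1 h0).resolve_left (inv_ne_zero (mul_ne_zero hμ hl))
  -- Division of the annihilating polynomial by x - μ: the remainder is its value at μ, so μ - R
  -- would be invertible.
  have h4 : (algebraMap ℂ (TensorMat ι 2 ℂ) μ - R) * ((q - q⁻¹ - μ) • 1 - R) =
      ((q - μ) * (q⁻¹ + μ)) • 1 := by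
    rw [Algebra.algebraMap_eq_smul_one]
    simp only [sub_mul, mul_add, mul_sub, smul_mul_assoc, mul_smul_comm, one_mul, mul_one] at h3 ⊢
    linear_combination (norm := module) -h3
  have h5 : (q - μ) * (q⁻¹ + μ) ≠ 0 := mul_ne_zero (sub_ne_zero.2 h1.symm) fun h => h2 (by
    linear_combination h)
  have h6 : (algebraMap ℂ (TensorMat ι 2 ℂ) μ - R) *
      (((q - μ) * (q⁻¹ + μ))⁻¹ • ((q - q⁻¹ - μ) • 1 - R)) = 1 := by
    rw [mul_smul_comm, h4, smul_smul, inv_mul_cancel₀ h5, one_smul]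
  exact hB.spectral (IsUnit.of_mul_eq_one _ h6)

variable {D : Matrix ι ι ℂ} {A : Type*} [Ring A] [Algebra ℂ A]

theorem rtr_gen_right (hR : SkewData R D) (hB : IsBMWType q μ R) (E : Matrix ι ι ℂ) (i : ℕ) :
    ∃ Z, rtr A Z (i + 1) (gen A hB.unit i : Oper ι A) = site ι A i E := by
  obtain ⟨Z, hZ⟩ := hR.right E
  refine ⟨Z, ?_⟩
  rw [gen_val, rtr_num_right]
  congr 1
  ext b d
  exact hZ b d

theorem commute_kap_site {i j : ℕ} (h : j < i ∨ i + 1 < j) (Z : Matrix ι ι ℂ) :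
    Commute (kap A q μ R i) (site ι A j Z) :=
  commute_num_site (by omega) _ _

/-- An operator acting before a contraction can be moved to the other contracted factor. -/
theorem exists_kap_mul_site (hB : IsBMWType q μ R) (hR : SkewData R D) (E : Matrix ι ι ℂ) :
    ∃ G, kap A q μ R 0 * site ι A 0 E = kap A q μ R 0 * site ι A 1 G := by
  have hsys := bmwSystem (A := A) hB
  have h1 : ∀ E, ∃ G, kap A q μ R 0 * (site ι A 1 E * gen A hB.unit 0) =
      kap A q μ R 0 * site ι A 1 G := by
    intro E
    obtain ⟨Z, hZ⟩ := rtr_gen_right (A := A) hR hB E 1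
    -- Trace e_0 s_1 s_0 = e_0 e_1 over strand 2 with weight Z: the left side exposes the prescribed
    -- E on strand 1, the right side leaves an operator on strand 1.
    have h2 := congrArg (rtr A Z 2) (hsys.e_s_s (i := 0) (j := 1) (Or.inl rfl))
    rw [rtr_mul_right fun Z => commute_gen_site _ (by omega) Z,
      rtr_mul_left fun Z => commute_kap_site (by omega) Z,
      rtr_mul_left fun Z => commute_kap_site (by omega) Z, hZ, mul_assoc] at h2
    exact ⟨_, h2.trans (by rw [kap, kap, rtr_num_right])⟩
  choose G hG using h1
  obtain ⟨Z, hZ⟩ := rtr_gen_right (A := A) hR hB E 0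
  refine ⟨∑ x, ∑ y, G (single x y 1 * Z) * single y x 1, ?_⟩
  -- E on strand 0 becomes a weighted trace of s_0 over strand 1, a sum of terms X_1 s_0 Y_1; after
  -- e_0 each of them reduces to strand 1.
  rw [← hZ, rtr_apply, ptr_apply]
  simp only [Finset.mul_sum, map_sum, zero_add]
  refine Finset.sum_congr rfl fun x _ => Finset.sum_congr rfl fun y _ => ?_
  rw [map_mul, ← mul_assoc (kap A q μ R 0) (site ι A 1 (G _)), ← hG, map_mul]
  simp only [mul_assoc]

theorem site_zero_eq (E : Matrix ι ι ℂ) :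
    site ι A 0 E = num ι A 0 2 (tensorSnoc (oneLeg E) 1) := by
  rw [num_tensorSnoc, map_one, mul_one, site_eq]

theorem site_one_eq (E : Matrix ι ι ℂ) :
    site ι A 1 E = num ι A 0 2 (tensorSnoc 1 E) := by
  rw [num_tensorSnoc, map_one, one_mul]

theorem mul_tensorSnoc_left (K : TensorMat ι 2 ℂ) (E : Matrix ι ι ℂ) (x : Fin 2 → ι) (c d : ι) :
    (K * tensorSnoc (oneLeg E) 1 : TensorMat ι 2 ℂ) x ![c, d] = ∑ a, E a c * K x ![a, d] := by
  have l1 : ∀ x0 x1 : ι, (![x0, x1] : Fin 2 → ι) (Fin.last 1) = x1 := fun _ _ => rfl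
  have l2 : ∀ x0 x1 : ι, (Fin.init (![x0, x1] : Fin 2 → ι) : Fin 1 → ι) 0 = x0 := fun _ _ => rfl
  rw [Matrix.mul_apply, sum_fin_two]
  refine Finset.sum_congr rfl fun a _ => ?_
  simp only [tensorSnoc, Matrix.of_apply, oneLeg, l1, l2, Matrix.one_apply]
  simp [mul_comm]

theorem mul_tensorSnoc_right (K : TensorMat ι 2 ℂ) (G : Matrix ι ι ℂ) (x : Fin 2 → ι) (c d : ι) :
    (K * tensorSnoc 1 G : TensorMat ι 2 ℂ) x ![c, d] = ∑ b, K x ![c, b] * G b d := by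
  have l1 : ∀ x0 x1 : ι, (![x0, x1] : Fin 2 → ι) (Fin.last 1) = x1 := fun _ _ => rfl
  have l2 : ∀ x0 x1 y0 y1 : ι, (Fin.init (![x0, x1] : Fin 2 → ι) : Fin 1 → ι) =
      (Fin.init (![y0, y1] : Fin 2 → ι) : Fin 1 → ι) ↔ x0 = y0 := by
    intro x0 x1 y0 y1
    rw [funext_iff]
    exact ⟨fun h => h 0, fun h i => by fin_cases i; exact h⟩
  rw [Matrix.mul_apply, sum_fin_two, Finset.sum_comm]
  refine Finset.sum_congr rfl fun b _ => ?_
  simp only [tensorSnoc, Matrix.of_apply, l1, l2, Matrix.one_apply]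
  simp

/-- The contractor is a product of a column and a nondegenerate row. -/
theorem exists_kappaMat_eq [Nonempty ι] (hB : IsBMWType q μ R) (hR : SkewData R D)
    (hK : kappaMat q μ R ≠ 0) : ∃ (c : (Fin 2 → ι) → ℂ) (B : Matrix ι ι ℂ), IsUnit B ∧
      ∀ x a b, kappaMat q μ R x ![a, b] = c x * B a b := by
  set K := kappaMat q μ R
  let Bx : (Fin 2 → ι) → Matrix ι ι ℂ := fun x => Matrix.of fun a b => K x ![a, b]
  -- The rows of κ, read as bilinear forms B_x, satisfy E B_x = B_x G with G independent of the row.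
  have h1 : ∀ E : Matrix ι ι ℂ, ∃ G : Matrix ι ι ℂ, ∀ x, E * Bx x = Bx x * G := by
    intro E
    obtain ⟨G, hG⟩ := exists_kap_mul_site (A := ℂ) hB hR Eᵀ
    rw [kap, site_zero_eq, site_one_eq, ← map_mul, ← map_mul] at hG
    have h2 := num_injective 0 2 hG
    refine ⟨G, fun x => ?_⟩
    ext c d
    have h3 := congrFun (congrFun h2 x) ![c, d]
    rw [mul_tensorSnoc_left, mul_tensorSnoc_right] at h3
    exact h3
  choose G hG using h1
  obtain ⟨x0, a0, b0, h0⟩ : ∃ x a b, Bx x a b ≠ 0 := by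
    by_contra! hcon
    refine hK (Matrix.ext fun x y => ?_)
    have hy : y = ![y 0, y 1] := by ext i; fin_cases i <;> rfl
    rw [hy]
    exact hcon x _ _
  -- Letting E run over scaled matrix units produces the columns of a right inverse from a single
  -- nonzero entry.
  have hunit : Bx x0 * Matrix.of (fun b a => G (single a a0 (Bx x0 a0 b0)⁻¹) b b0) = 1 := by
    ext i a
    have h2 := congrFun (congrFun (hG (single a a0 (Bx x0 a0 b0)⁻¹) x0) i) b0
    rw [Matrix.mul_apply] at h2 ⊢
    rw [Matrix.mul_apply] at h2
    refine h2.symm.trans ?_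
    rw [Finset.sum_eq_single a0]
    · by_cases hia : a = i
      · subst hia
        simp [h0]
      · rw [single_apply_of_row_ne hia, zero_mul, Matrix.one_apply_ne (Ne.symm hia)]
    · intro b _ hb
      rw [single_apply_of_col_ne _ _ hb.symm, zero_mul]
    · simp
  have hu : IsUnit (Bx x0) := IsUnit.of_mul_eq_one _ hunit
  obtain ⟨u, hu0⟩ := hu
  have hsc : ∀ x, ∃ c : ℂ, Bx x = c • Bx x0 := by
    intro x
    -- Since G depends only on E, the quotient B_x B_{x0}⁻¹ commutes with all matrices and is
    -- scalar.
    have hc : ∀ E, Commute E (Bx x * (↑u⁻¹ : Matrix ι ι ℂ)) := by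
      intro E
      have e1 : G E = (↑u⁻¹ : Matrix ι ι ℂ) * E * u := by
        rw [mul_assoc, Units.eq_inv_mul_iff_mul_eq, hu0]
        exact (hG E x0).symm
      rw [commute_iff_eq, ← mul_assoc, hG, e1]
      simp [mul_assoc]
    obtain ⟨c, hc⟩ := Matrix.mem_range_scalar_iff_commute_single.2
      fun i j _ => (hc (single i j 1))
    refine ⟨c, ?_⟩
    rw [← hu0]
    have := congrArg (fun Z => Z * (u : Matrix ι ι ℂ)) hc
    simp only [Units.inv_mul_cancel_right] at this
    rw [← this, Matrix.scalar_apply, ← smul_eq_diagonal_mul]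
  choose c hc using hsc
  refine ⟨c, Bx x0, ⟨u, hu0⟩, fun x a b => ?_⟩
  exact congrFun (congrFun (hc x) a) b

theorem kappaMat_mul_mul [Nonempty ι] (hB : IsBMWType q μ R) (hR : SkewData R D)
    (hK : kappaMat q μ R ≠ 0) (Z : TensorMat ι 2 ℂ) :
    kappaMat q μ R * Z * kappaMat q μ R = (kappaMat q μ R * Z).trace • kappaMat q μ R := by
  obtain ⟨c, B, -, h⟩ := exists_kappaMat_eq hB hR hK
  have : kappaMat q μ R = vecMulVec c fun y => B (y 0) (y 1) := by
    ext x y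
    have hy : y = ![y 0, y 1] := by ext i; fin_cases i <;> rfl
    rw [hy, h]
    rfl
  rw [this, vecMulVec_mul_mul_vecMulVec]

variable [Nonempty ι] [Nontrivial A]

/-- Nondegeneracy of the row of κ allows it to be cancelled from operators on one contracted strand.
-/
theorem kap_mul_site_cancel (hB : IsBMWType q μ R) (hR : SkewData R D)
    (hK : kappaMat q μ R ≠ 0) {G H : Matrix ι ι ℂ}
    (h : kap A q μ R 0 * site ι A 1 G = kap A q μ R 0 * site ι A 1 H) : G = H := by
  obtain ⟨c, B, ⟨u, rfl⟩, hc⟩ := exists_kappaMat_eq hB hR hK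
  obtain ⟨x, hx⟩ : ∃ x, c x ≠ 0 := by
    by_contra! hcon
    refine hK (Matrix.ext fun x y => ?_)
    have hy : y = ![y 0, y 1] := by ext i; fin_cases i <;> rfl
    rw [hy, hc, hcon, zero_mul]
    rfl
  rw [kap, site_one_eq, site_one_eq, ← map_mul, ← map_mul] at h
  have h2 := num_injective 0 2 h
  have h3 : (u : Matrix ι ι ℂ) * G = u * H := by
    ext a d
    have h4 := congrFun (congrFun h2 x) ![a, d]
    simp only [mul_tensorSnoc_right, hc, mul_assoc, ← Finset.mul_sum] at h4
    exact mul_left_cancel₀ hx h4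
  exact u.isUnit.mul_left_cancel h3

/-- Trace e_0 s_1 s_0 = e_0 e_1 over strand 2: the left side becomes e_0 s_0 = μ e_0, and e_0 can be
cancelled. -/
theorem rtr_kap (hB : IsBMWType q μ R) (hR : SkewData R D)
    (hK : kappaMat q μ R ≠ 0) (i : ℕ) : rtr A D (i + 1) (kap A q μ R i) = μ • 1 := by
  have hsys := bmwSystem (A := A) hB
  have h2 := congrArg (rtr A D 2) (hsys.e_s_s (i := 0) (j := 1) (Or.inl rfl))
  rw [rtr_mul_right fun Z => commute_gen_site _ (by omega) Z,
    rtr_mul_left fun Z => commute_kap_site (by omega) Z,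
    rtr_mul_left fun Z => commute_kap_site (by omega) Z, rtr_gen (R := hB.unit) hR, mul_one,
    hsys.e_s, kap, kap, rtr_num_right] at h2
  have h3 : kap A q μ R 0 * site ι A 1 (μ • 1) = μ • kap A q μ R 0 := by
    rw [map_smul, map_one, mul_smul_comm, mul_one]
  have h4 := kap_mul_site_cancel hB hR hK (h3.trans h2)
  rw [kap, rtr_num_right, ← h4, map_smul, map_one]

theorem kap_ne_zero (hK : kappaMat q μ R ≠ 0) (i : ℕ) : kap A q μ R i ≠ 0 := fun h =>
  hK (num_injective i 2 (h.trans (map_zero _).symm))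

/-- Trace e_0 s_1 e_0 = μ⁻¹ e_0 over strand 2: the left side becomes e_0² = η e_0, the right side
μ⁻¹ Tr(D) e_0. -/
theorem trace_weight (hB : IsBMWType q μ R) (hR : SkewData R D) (hμ : μ ≠ 0)
    (hK : kappaMat q μ R ≠ 0) : D.trace = μ * eta q μ := by
  have hsys := bmwSystem (A := ℂ) hB
  have h2 := congrArg (rtr ℂ D 2) (hsys.e_s_e hμ (i := 0) (j := 1) (Or.inl rfl))
  rw [rtr_mul_right fun Z => commute_kap_site (by omega) Z,
    rtr_mul_left fun Z => commute_kap_site (by omega) Z, rtr_gen (R := hB.unit) hR, mul_one,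
    hsys.e_e, map_smul, rtr_of_commute fun Z => commute_kap_site (by omega) Z, smul_smul] at h2
  have h3 := smul_left_injective ℂ (kap_ne_zero hK 0) h2
  rw [h3, ← mul_assoc, mul_inv_cancel₀ hμ, one_mul]

/-- The rank-one operator κ commutes with D ⊗ D, so the product is a multiple of κ; the multiple is
the weighted trace μ² η of κ divided by η. This is the origin of μ² in the contraction g. -/
theorem kap_mul_weight (hB : IsBMWType q μ R) (hR : SkewData R D) (hμ : μ ≠ 0)
    (hη : eta q μ ≠ 0) (hK : kappaMat q μ R ≠ 0) :
    kap A q μ R 0 * weight A D 0 2 = μ ^ 2 • kap A q μ R 0 := by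
  have hsys := bmwSystem (A := A) hB
  have hcw : Commute (weight A D 0 2) (kap A q μ R 0) := by
    refine hsys.comm_e ?_
    have := commute_gen_weight_two (A := A) (R := hB.unit) hR (hsys.braid 0) 0
    exact (commute_gen_weight this le_rfl (n := 2) (by omega)).symm
  have h1 : kap A q μ R 0 * weight A D 0 2 * kap A q μ R 0 =
      (μ ^ 2 * eta q μ) • kap A q μ R 0 := by
    have e1 : rtrN A D 0 2 (kap A q μ R 0) = (μ ^ 2 * eta q μ) • 1 := by
      rw [rtrN_succ, rtr_kap hB hR hK, rtrN_succ, map_smul,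
        rtr_of_commute fun Z => Commute.one_left _, trace_weight hB hR hμ hK, rtrN_zero, smul_smul]
      congr 1
      ring
    rw [rtrN_eq, ← num_weightMat, kap, ← map_mul, ptr_one_map] at e1
    have e2 := smul_left_injective ℂ (one_ne_zero (α := Oper ι A)) e1
    rw [← num_weightMat, kap, ← map_mul, ← map_mul, kappaMat_mul_mul hB hR hK, trace_mul_comm, e2,
      map_smul]
  rw [mul_assoc, hcw.eq, ← mul_assoc, hsys.e_e, smul_mul_assoc, mul_comm (μ ^ 2), mul_smul] at h1
  exact smul_right_injective _ hη h1

end RankOne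

theorem SemiconjBy.commute_of_commute {B : Type*} [Monoid B] {u : Bˣ} {a a' b b' : B}
    (ha : SemiconjBy (u : B) a a') (hb : SemiconjBy (u : B) b b') (h : Commute a b) :
    Commute a' b' := by
  rw [commute_iff_eq, ← u.mul_left_inj, mul_assoc, ← hb.eq, ← mul_assoc, ← ha.eq, mul_assoc, h.eq,
    ← mul_assoc, hb.eq, mul_assoc, ha.eq, mul_assoc]

section Copies

open Matrix

variable {ι : Type*} [Fintype ι] [DecidableEq ι] {A : Type*} [Ring A] [Algebra ℂ A]

/-! ### Copies of a quantum matrix -/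

/-- The copies of a matrix as local operators. -/
def mcopy (F : (TensorMat ι 2 ℂ)ˣ) (M : Matrix ι ι A) : ℕ → Oper ι A
  | 0 => op ι A 0 1 (oneLeg M)
  | i + 1 => (gen A F i : Oper ι A) * mcopy F M i * (↑(gen A F i)⁻¹ : Oper ι A)

/-- Products of consecutive copies of a matrix. -/
def mprod (F : (TensorMat ι 2 ℂ)ˣ) (M : Matrix ι ι A) (p : ℕ) : ℕ → Oper ι A
  | 0 => 1
  | n + 1 => mprod F M p n * mcopy F M (p + n)

variable {F R : (TensorMat ι 2 ℂ)ˣ} {M : Matrix ι ι A}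

theorem op_copy (n : ℕ) : ∀ (i : ℕ) (h : i < n),
    op ι A 0 n (copy (F : TensorMat ι 2 ℂ) M n i h) = mcopy F M i
  | 0, h => by rw [copy, op_embed, mcopy]
  | i + 1, h => by
    rw [copy, map_mul, map_mul, op_copy n i, mcopy, op_scalars, op_scalars, twoLegs, twoLegs,
      num_embed, num_embed, zero_add, ← Matrix.coe_units_inv]
    rfl

theorem prod_ofFn_eq_mprod (n : ℕ) :
    (List.ofFn fun i : Fin n => mcopy F M i).prod = mprod F M 0 n := by
  induction n with
  | zero => rfl
  | succ n ih =>
    rw [List.ofFn_succ', List.concat_eq_append, List.prod_append, mprod, zero_add]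
    simp only [Fin.val_castSucc, ih, Fin.val_last, List.prod_singleton]

theorem op_copyProd (n : ℕ) :
    op ι A 0 n (copyProd (F : TensorMat ι 2 ℂ) M n) = mprod F M 0 n := by
  rw [copyProd, map_list_prod, List.map_ofFn, ← prod_ofFn_eq_mprod]
  congr 2
  funext i
  exact op_copy n i i.isLt

theorem mprod_add (p m : ℕ) : ∀ n : ℕ,
    mprod F M p (m + n) = mprod F M p m * mprod F M (p + m) n
  | 0 => (mul_one _).symm
  | n + 1 => by rw [← add_assoc, mprod, mprod_add p m n, mprod, mul_assoc, add_assoc]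

theorem mcopy_succ_mul (l : ℕ) :
    SemiconjBy (gen A F l : Oper ι A) (mcopy F M l) (mcopy F M (l + 1)) := by
  rw [SemiconjBy, mcopy, Units.inv_mul_cancel_right]

theorem commute_mcopy_site : ∀ {l j : ℕ} (_ : l < j) (Z : Matrix ι ι ℂ),
    Commute (mcopy F M l) (site ι A j Z)
  | 0, j, h, Z => commute_op_site (by omega) _ _
  | l + 1, j, h, Z =>
    ((commute_gen_site F (by omega) Z).mul_left (commute_mcopy_site (by omega) Z)).mul_left
      (commute_gen_inv_site F (by omega) Z)

theorem commute_mcopy_gen (u : (TensorMat ι 2 ℂ)ˣ) {l r : ℕ} (h : l < r) :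
    Commute (mcopy F M l) (gen A u r : Oper ι A) :=
  commute_num_two (fun Z => commute_mcopy_site h Z) (fun Z => commute_mcopy_site (by omega) Z) _

/-- For l = r + 2, conjugation by F_{r+1} F_r takes copy r to copy r + 2 and u_{r+1} to u_r, and
copy r commutes with u_{r+1} because their supports are disjoint. Higher copies add only factors of
F that commute with u_r. -/
theorem commute_mcopy_gen_of_lt {u : (TensorMat ι 2 ℂ)ˣ}
    (hu : ∀ r, SemiconjBy (gen A F (r + 1) * gen A F r : Oper ι A) (gen A u (r + 1) : Oper ι A)
      (gen A u r)) {r : ℕ} : ∀ {l : ℕ}, r + 1 < l → Commute (mcopy F M l) (gen A u r : Oper ι A)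
  | 0, h => by omega
  | 1, h => by omega
  | l + 2, h => by
    by_cases h1 : r + 1 < l + 1
    · have hc : Commute (gen A F (l + 1) : Oper ι A) (gen A u r) := commute_gen_gen _ _ (by omega)
      exact (hc.mul_left (commute_mcopy_gen_of_lt hu h1)).mul_left hc.units_inv_left
    · obtain rfl : r = l := by omega
      exact SemiconjBy.commute_of_commute (u := gen A F (r + 1) * gen A F r)
        ((mcopy_succ_mul (r + 1)).mul_left (mcopy_succ_mul r)) (hu r)
        (commute_mcopy_gen u (Nat.lt_succ_self r))

/-! ### Shifts along the chain of copies -/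

/-- Only the factor F_{p+i} moves the copy p + i; later factors commute with it, earlier ones with
the shifted copy. -/
theorem asc_mcopy
    (hF : ∀ r, SemiconjBy (gen A F (r + 1) * gen A F r : Oper ι A) (gen A F (r + 1) : Oper ι A)
      (gen A F r)) (p i : ℕ) : ∀ {n : ℕ}, i < n →
    SemiconjBy ((asc (gen A F) p n : (Oper ι A)ˣ) : Oper ι A) (mcopy F M (p + i))
      (mcopy F M (p + i + 1))
  | 0, h => by omega
  | n + 1, h => by
    rw [asc, Units.val_mul]
    by_cases h1 : i < n
    · exact (asc_mcopy hF p i h1).mul_left (commute_mcopy_gen F (by omega)).symm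
    · obtain rfl : i = n := by omega
      exact SemiconjBy.mul_left (commute_asc fun j h1 h2 =>
        commute_mcopy_gen_of_lt hF (by omega)).symm (mcopy_succ_mul _)

theorem asc_mprod
    (hF : ∀ r, SemiconjBy (gen A F (r + 1) * gen A F r : Oper ι A) (gen A F (r + 1) : Oper ι A)
      (gen A F r)) (p n : ℕ) : ∀ {m : ℕ}, m ≤ n →
    SemiconjBy ((asc (gen A F) p n : (Oper ι A)ˣ) : Oper ι A) (mprod F M p m) (mprod F M (p + 1) m)
  | 0, _ => SemiconjBy.one_right _
  | m + 1, h => by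
    rw [mprod, mprod, show p + 1 + m = p + m + 1 by ring]
    exact (asc_mprod hF p n (by omega)).mul_right (asc_mcopy hF p m (by omega))

theorem asc_gen
    (hR : ∀ r, SemiconjBy (gen A F r * gen A F (r + 1) : Oper ι A) (gen A R r : Oper ι A)
      (gen A R (r + 1))) (p i : ℕ) : ∀ {n : ℕ}, i + 1 < n →
    SemiconjBy ((asc (gen A F) p n : (Oper ι A)ˣ) : Oper ι A) (gen A R (p + i) : Oper ι A)
      (gen A R (p + i + 1))
  | 0, h => by omega
  | 1, h => by omega
  | n + 2, h => by
    rw [asc, Units.val_mul]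
    by_cases h1 : i + 1 < n + 1
    · exact (asc_gen hR p i h1).mul_left (commute_gen_gen _ _ (by omega))
    · obtain rfl : i = n := by omega
      rw [asc, Units.val_mul, mul_assoc]
      exact SemiconjBy.mul_left (commute_asc fun j h1 h2 => commute_gen_gen _ _ (by omega)).symm
        (hR _)

/-- The compatibility conditions of a pair of operators, on all strands. -/
structure ChainData (F R : (TensorMat ι 2 ℂ)ˣ) (M : Matrix ι ι A) : Prop where
  braid (r : ℕ) : SemiconjBy (gen A F (r + 1) * gen A F r : Oper ι A)
    (gen A F (r + 1) : Oper ι A) (gen A F r)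
  down (r : ℕ) : SemiconjBy (gen A F (r + 1) * gen A F r : Oper ι A)
    (gen A R (r + 1) : Oper ι A) (gen A R r)
  up (r : ℕ) : SemiconjBy (gen A F r * gen A F (r + 1) : Oper ι A)
    (gen A R r : Oper ι A) (gen A R (r + 1))
  rel : Commute (gen A R 0 : Oper ι A) (mprod F M 0 2)

/-- The defining relation on strands 0, 1 is carried along the chain: F_l F_{l+1} shifts both the
generator and the two copies. -/
theorem ChainData.commute_gen_mprod_two (h : ChainData F R M) : ∀ l : ℕ,
    Commute (gen A R l : Oper ι A) (mprod F M l 2)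
  | 0 => h.rel
  | l + 1 => by
    have ih := h.commute_gen_mprod_two l
    have h1 := asc_mprod (M := M) h.braid l 2 le_rfl
    have h2 := asc_gen h.up l 0 (n := 2) (by omega)
    rw [add_zero] at h2
    exact SemiconjBy.commute_of_commute h2 h1 ih

theorem ChainData.commute_gen_mprod (h : ChainData F R M) {l p : ℕ} (h1 : p ≤ l) : ∀ {n : ℕ},
    l + 2 ≤ p + n → Commute (gen A R l : Oper ι A) (mprod F M p n)
  | 0, h2 => by omega
  | 1, h2 => by omega
  | n + 2, h2 => by
    by_cases h3 : l + 2 ≤ p + (n + 1)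
    · rw [mprod]
      exact (h.commute_gen_mprod h1 h3).mul_right
        (commute_mcopy_gen_of_lt h.down (by omega)).symm
    · obtain rfl : l = p + n := by omega
      have h4 : ∀ {m : ℕ}, m ≤ n → Commute (gen A R (p + n) : Oper ι A) (mprod F M p m) := by
        intro m
        induction m with
        | zero => exact fun _ => Commute.one_right _
        | succ m ih => exact fun hm => (ih (by omega)).mul_right (commute_mcopy_gen R (by omega)).symm
      rw [mprod_add]
      exact (h4 le_rfl).mul_right (h.commute_gen_mprod_two _)

theorem commute_mprod_site {p j : ℕ} (Z : Matrix ι ι ℂ) : ∀ {n : ℕ}, p + n ≤ j →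
    Commute (mprod F M p n) (site ι A j Z)
  | 0, _ => Commute.one_left _
  | n + 1, h => (commute_mprod_site Z (by omega)).mul_left (commute_mcopy_site (by omega) Z)

/-! ### Characteristic elements -/

/-- The weighted trace of an operator multiplied by copies of the matrix. -/
def chi (D : Matrix ι ι ℂ) (F : (TensorMat ι 2 ℂ)ˣ) (M : Matrix ι ι A) (p n : ℕ) (X : Oper ι A) :
    Oper ι A := rtrN A D p n (mprod F M p n * X)

variable {D : Matrix ι ι ℂ}

theorem chi_smul (p n : ℕ) (c : ℂ) (X : Oper ι A) :
    chi D F M p n (c • X) = c • chi D F M p n X := by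
  rw [chi, mul_smul_comm, map_smul, chi]

theorem chi_num (n : ℕ) (X : TensorMat ι n ℂ) : chi D F M 0 n (num ι A 0 n X) =
    lmul ι A (rTrace D (copyProd (F : TensorMat ι 2 ℂ) M n * scalars A X)) := by
  rw [chi, ← rtrN_op, map_mul (op ι A 0 n), op_copyProd, op_scalars]

theorem chi_cyc {p n : ℕ} {X : Oper ι A} (hX : X ∈ (num ι A p n).range)
    (h1 : Commute X (weight A D p n)) (h2 : Commute X (mprod F M p n)) (T : Oper ι A) :
    chi D F M p n (X * T) = chi D F M p n (T * X) := by
  rw [chi, chi, ← mul_assoc, ← h2.eq, mul_assoc, rtrN_cyc hX h1, mul_assoc]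

/-- X passes through the later copies, so the trace over the second block can be taken first; its
value lies in A, commutes with numerical operators and leaves the first trace on the right. -/
theorem chi_mul {p m n : ℕ} {X Y : Oper ι A}
    (hX : ∀ j, p + m ≤ j → ∀ Z, Commute X (site ι A j Z))
    (hX' : Commute X (mprod F M (p + m) n)) {c : A} (hc : chi D F M (p + m) n Y = lmul ι A c) :
    chi D F M p (m + n) (X * Y) = chi D F M p m X * lmul ι A c := by
  have h1 : mprod F M p (m + n) * (X * Y) = mprod F M p m * X * (mprod F M (p + m) n * Y) := by
    rw [mprod_add, mul_assoc, ← mul_assoc _ X Y, ← hX'.eq]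
    simp only [mul_assoc]
  rw [chi, h1, rtrN_add, rtrN_mul_left fun j h2 h3 Z =>
    (commute_mprod_site Z (by omega)).mul_left (hX j h2 Z)]
  change rtrN A D p m (mprod F M p m * X * chi D F M (p + m) n Y) = _
  rw [hc, rtrN_mul_right (C := lmul ι A c) fun j h2 h3 Z => commute_lmul_num _ _ _ _, chi]

/-- Conjugation by F_p ⋯ F_{p+n-1} shifts all copies and the operator by one strand, and the
weighted trace absorbs it by `rtrN_twist`. -/
theorem chi_succ [Nonempty ι] [Nontrivial A] (h : ChainData F R M)
    (hR : SkewData (R : TensorMat ι 2 ℂ) D) {p n : ℕ} {X X' : Oper ι A}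
    (hX : ∀ j, p + n ≤ j → ∀ Z, Commute X (site ι A j Z))
    (hs : SemiconjBy ((asc (gen A F) p n : (Oper ι A)ˣ) : Oper ι A) X X') :
    chi D F M (p + 1) n X' = chi D F M p n X := by
  have hF : (gen A F 1 : Oper ι A) * gen A R 0 * (↑(gen A F 1)⁻¹ : Oper ι A) =
      (↑(gen A F 0)⁻¹ : Oper ι A) * gen A R 1 * gen A F 0 := by
    have := (h.up 0).eq
    rw [Units.mul_inv_eq_iff_eq_mul, mul_assoc, mul_assoc, Units.eq_inv_mul_iff_mul_eq, ← mul_assoc]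
    simpa only [mul_assoc] using this
  rw [chi, chi, ← rtrN_twist hR hF p n _ fun j hj Z =>
    (commute_mprod_site Z hj).mul_left (hX j hj Z)]
  congr 1
  rw [Units.eq_mul_inv_iff_mul_eq]
  exact ((asc_mprod h.braid p n le_rfl).mul_right hs).eq.symm

end Copies

open Matrix

/-! ### Matrices of rank one and idempotent matrices -/

theorem exists_eq_vecMulVec {X : Type*} [Fintype X] {P : Matrix X X ℂ} (hP : P.rank = 1) :
    ∃ c b : X → ℂ, P = vecMulVec c b := by
  classical
  obtain ⟨v, -, hv⟩ := finrank_eq_one_iff'.1 hP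
  have h1 : ∀ y, ∃ b : ℂ, b • (v : X → ℂ) = P *ᵥ Pi.single y 1 := by
    intro y
    obtain ⟨b, hb⟩ := hv ⟨P *ᵥ Pi.single y 1, ⟨Pi.single y 1, rfl⟩⟩
    exact ⟨b, congrArg Subtype.val hb⟩
  choose b hb using h1
  refine ⟨v, b, ?_⟩
  ext x y
  have := congrFun (hb y) x
  rw [mulVec_single_one] at this
  rw [vecMulVec_apply, mul_comm]
  exact this.symm

theorem mul_mul_of_rank_eq_one {X : Type*} [Fintype X] {P : Matrix X X ℂ} (hP : P.rank = 1)
    (Z : Matrix X X ℂ) : P * Z * P = (P * Z).trace • P := by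
  obtain ⟨c, b, rfl⟩ := exists_eq_vecMulVec hP
  exact vecMulVec_mul_mul_vecMulVec c b Z

theorem exists_trace_eq_natCast {X : Type*} [Fintype X] {P : Matrix X X ℂ}
    (hP : IsIdempotentElem P) : ∃ d : ℕ, P.trace = d := by
  classical
  have h1 : IsIdempotentElem (toLin' P) := by
    rw [IsIdempotentElem, Module.End.mul_eq_comp, ← toLin'_mul, hP]
  exact ⟨_, (trace_toLin'_eq P).symm.trans
    (LinearMap.IsIdempotentElem.isProj_range _ h1).trace⟩

theorem eq_zero_of_trace_eq_zero {X : Type*} [Fintype X] {P : Matrix X X ℂ}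
    (hP : IsIdempotentElem P) (h : P.trace = 0) : P = 0 := by
  classical
  have h1 : IsIdempotentElem (toLin' P) := by
    rw [IsIdempotentElem, Module.End.mul_eq_comp, ← toLin'_mul, hP]
  rw [← trace_toLin'_eq] at h
  exact toLin'.map_eq_zero_iff.1 ((LinearMap.IsIdempotentElem.trace_eq_zero_iff h1).1 h)

/-! ### Subalgebras containing the generators -/

section Membership

variable {B : Type*} [Ring B] [Algebra ℂ B] {q μ : ℂ} {s : ℕ → Bˣ} {e : ℕ → B}

theorem e_mem (h : BMWSystem q μ s e) {S : Subalgebra ℂ B} {i : ℕ} (hi : (s i : B) ∈ S) :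
    e i ∈ S := by
  rw [h.kappa]
  exact S.smul_mem (S.mul_mem (S.sub_mem (S.smul_mem S.one_mem _) hi)
    (S.add_mem (S.smul_mem S.one_mem _) hi)) _

theorem desc_mem {S : Subalgebra ℂ B} {p : ℕ} : ∀ {n : ℕ},
    (∀ i, p ≤ i → i < p + n → (s i : B) ∈ S ∧ (↑(s i)⁻¹ : B) ∈ S) →
    ((desc s p n : Bˣ) : B) ∈ S ∧ (↑(desc s p n)⁻¹ : B) ∈ S
  | 0, _ => by simp [desc, S.one_mem]
  | n + 1, hs => by
    have h1 := hs (p + n) (by omega) (by omega)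
    have h2 := desc_mem (S := S) (p := p) (n := n) fun i hi hi' => hs i hi (by omega)
    rw [desc, _root_.mul_inv_rev, Units.val_mul, Units.val_mul]
    exact ⟨S.mul_mem h1.1 h2.1, S.mul_mem h2.2 h1.2⟩

theorem cups_mem (h : BMWSystem q μ s e) {S : Subalgebra ℂ B} : ∀ {j p : ℕ},
    (∀ i, p ≤ i → i + 1 < p + 2 * j → (s i : B) ∈ S ∧ (↑(s i)⁻¹ : B) ∈ S) → cups s e j p ∈ S
  | 0, _, _ => S.one_mem
  | j + 1, p, hs => by
    have h1 := desc_mem (S := S) (p := p + 1) (n := 2 * j) fun i hi hi' =>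
      hs i (by omega) (by omega)
    exact S.mul_mem (S.mul_mem h1.1 (S.mul_mem (e_mem h (hs p le_rfl (by omega)).1)
      (cups_mem h fun i hi hi' => hs i (by omega) (by omega)))) h1.2

theorem swapBraid_mem {S : Subalgebra ℂ B} {k : ℕ} : ∀ {j : ℕ},
    (∀ i, i + 1 < j + k → (s i : B) ∈ S ∧ (↑(s i)⁻¹ : B) ∈ S) →
    ((swapBraid s k j : Bˣ) : B) ∈ S
  | 0, _ => S.one_mem
  | j + 1, hs => by
    rw [swapBraid, Units.val_mul]
    exact S.mul_mem (swapBraid_mem fun i hi => hs i (by omega))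
      (desc_mem fun i hi hi' => hs i (by omega)).1

end Membership

/-! ### Characteristic elements of antisymmetrizers and cups -/

section Characteristic

variable {ι : Type*} [Fintype ι] [DecidableEq ι] {A : Type*} [Ring A] [Algebra ℂ A]

theorem ptr_num_add (i m : ℕ) : ∀ (n : ℕ) (T : Oper ι A),
    ptr (num ι A i (m + n)) T = ptr (num ι A i m) (ptr (num ι A (i + m) n) T) := by
  intro n T
  rw [← rtrN_one, rtrN_add, rtrN_one, rtrN_one]

theorem ptr_num_op (n : ℕ) (X : TensorMat ι n A) :
    ptr (num ι A 0 n) (op ι A 0 n X) = lmul ι A X.trace := by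
  rw [op_eq_sum, Matrix.trace]
  simp only [map_sum]
  refine Finset.sum_congr rfl fun x _ => ?_
  rw [Finset.sum_eq_single x]
  · rw [ptr_mul_map fun Z => commute_lmul_num _ _ _ _, trace_single_eq_same, one_smul]
    rfl
  · intro y _ h
    rw [ptr_mul_map fun Z => commute_lmul_num _ _ _ _, trace_single_eq_of_ne _ _ _ h.symm, zero_smul]
  · simp

theorem gen_mem {u : (TensorMat ι 2 ℂ)ˣ} {i n l : ℕ} (h1 : i ≤ l) (h2 : l + 2 ≤ i + n) :
    (gen A u l : Oper ι A) ∈ (num ι A i n).range ∧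
      (↑(gen A u l)⁻¹ : Oper ι A) ∈ (num ι A i n).range :=
  ⟨num_mem_range h1 h2 _, num_mem_range h1 h2 _⟩

variable {q μ : ℂ} {R : TensorMat ι 2 ℂ} {F : (TensorMat ι 2 ℂ)ˣ} {M : Matrix ι ι A}
  {D : Matrix ι ι ℂ}

theorem commute_asym_site (hB : IsBMWType q μ R) {p n j : ℕ} (hj : j < p ∨ p + n ≤ j)
    (Z : Matrix ι ι ℂ) :
    Commute (asym q μ (gen A hB.unit) (kap A q μ R) p n) (site ι A j Z) :=
  num_antisymMat (A := A) hB p n ▸ commute_num_site (by omega) _ _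

theorem asym_mem (hB : IsBMWType q μ R) {i m p n : ℕ} (h1 : i ≤ p) (h2 : p + n ≤ i + m) :
    asym q μ (gen A hB.unit) (kap A q μ R) p n ∈ (num ι A i m).range :=
  num_antisymMat (A := A) hB p n ▸ num_mem_range h1 h2 _

theorem cups_mem_range (hB : IsBMWType q μ R) {i m p j : ℕ} (h1 : i ≤ p)
    (h2 : p + 2 * j ≤ i + m) :
    cups (gen A hB.unit) (kap A q μ R) j p ∈ (num ι A i m).range :=
  cups_mem (bmwSystem hB) fun l h3 h4 => gen_mem (by omega) (by omega)

theorem commute_cups_site (hB : IsBMWType q μ R) {p j l : ℕ} (hl : l < p ∨ p + 2 * j ≤ l)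
    (Z : Matrix ι ι ℂ) :
    Commute (cups (gen A hB.unit) (kap A q μ R) j p) (site ι A l Z) :=
  (commute_cups (bmwSystem hB) fun i h1 h2 => (commute_gen_site _ (by omega) Z).symm).symm

theorem ChainData.commute_gen_mprod_of_lt (h : ChainData F hB M) {r p : ℕ} (hr : r + 1 < p) :
    ∀ n : ℕ, Commute (gen A hB r : Oper ι A) (mprod F M p n)
  | 0 => Commute.one_right _
  | n + 1 => (h.commute_gen_mprod_of_lt hr n).mul_right
      (commute_mcopy_gen_of_lt h.down (by omega)).symm

variable [Nonempty ι] [Nontrivial A]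

/-- The invariance of the weight under a braid generator. -/
theorem commute_weight_gen (hB : IsBMWType q μ R) (hR : SkewData R D) {l i n : ℕ} (h1 : i ≤ l)
    (h2 : l + 2 ≤ i + n) : Commute (weight A D i n) (gen A hB.unit l : Oper ι A) :=
  (commute_gen_weight (commute_gen_weight_two (A := A) (R := hB.unit) hR
    ((bmwSystem hB).braid 0) l) h1 h2).symm

/-- The weights meet κ under the trace and become μ², which leaves the ordinary trace in the
definition of g. -/
theorem chi_kap (hB : IsBMWType q μ R) (hR : SkewData R D) (hμ : μ ≠ 0) (hη : eta q μ ≠ 0)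
    (hK : kappaMat q μ R ≠ 0) :
    chi D F M 0 2 (kap A q μ R 0) = lmul ι A (μ ^ 2 • (copyProd (F : TensorMat ι 2 ℂ) M 2 *
      scalars A (kappaMat q μ R)).trace) := by
  rw [chi, rtrN_eq, ← num_weightMat, ptr_cyc, num_weightMat, mul_assoc,
    kap_mul_weight hB hR hμ hη hK, mul_smul_comm, map_smul, map_smul, ← ptr_num_op, map_mul (op ι A 0 2),
    op_copyProd, op_scalars]
  rfl

variable {γ : A}

theorem chi_kap_shift (hB : IsBMWType q μ R) (hR : SkewData R D) (h : ChainData F hB.unit M)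
    (hγ : chi D F M 0 2 (kap A q μ R 0) = lmul ι A γ) : ∀ p : ℕ,
    chi D F M p 2 (kap A q μ R p) = lmul ι A γ
  | 0 => hγ
  | p + 1 => by
    rw [← chi_kap_shift hB hR h hγ p]
    exact chi_succ h hR (fun j hj Z => commute_kap_site (by omega) Z)
      ((bmwSystem hB).semiconj_e (asc_gen h.up p 0 (n := 2) (by omega)))

theorem chi_asym (hB : IsBMWType q μ R) (hR : SkewData R D) (h : ChainData F hB.unit M) (n : ℕ) :
    ∀ p : ℕ, chi D F M p n (asym q μ (gen A hB.unit) (kap A q μ R) p n) =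
      chi D F M 0 n (asym q μ (gen A hB.unit) (kap A q μ R) 0 n)
  | 0 => rfl
  | p + 1 => by
    rw [← chi_asym hB hR h n p]
    refine chi_succ h hR (fun j hj Z => commute_asym_site hB (by omega) Z)
      (semiconj_asym (bmwSystem hB) n fun i hi => ?_)
    rw [show p + 1 + i = p + i + 1 by ring]
    exact asc_gen h.up p i hi

/-- Cyclicity removes the braid that nests the outermost cup, leaving one cup beside j others, and
the trace is multiplicative on adjacent blocks. -/
theorem chi_cups (hB : IsBMWType q μ R) (hR : SkewData R D) (h : ChainData F hB.unit M)
    (hγ : chi D F M 0 2 (kap A q μ R 0) = lmul ι A γ) : ∀ j p : ℕ,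
    chi D F M p (2 * j) (cups (gen A hB.unit) (kap A q μ R) j p) = lmul ι A (γ ^ j)
  | 0, p => by
    rw [pow_zero, map_one]
    exact mul_one _
  | j + 1, p => by
    have hsys := bmwSystem (A := A) hB
    rw [cups, mul_assoc, chi_cyc, mul_assoc, Units.inv_mul, mul_one, show 2 * (j + 1) = 2 + 2 * j by ring,
      chi_mul, chi_kap_shift hB hR h hγ, ← map_mul, pow_succ']
    · exact fun l hl Z => commute_kap_site (by omega) Z
    · exact (hsys.comm_e (h.commute_gen_mprod_of_lt (by omega) _).symm).symm
    · exact chi_cups hB hR h hγ j (p + 2)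
    · exact (desc_mem fun i h1 h2 => gen_mem (by omega) (by omega)).1
    · exact (commute_desc fun i h1 h2 => commute_weight_gen hB hR (by omega) (by omega)).symm
    · exact (commute_desc fun i h1 h2 => (h.commute_gen_mprod (by omega) (by omega)).symm).symm

end Characteristic

open Matrix

/-! ### The projection cut out of the antisymmetrizer by nested cups -/

section Projection

variable {ι : Type*} [Fintype ι] [DecidableEq ι] {A : Type*} [Ring A] [Algebra ℂ A]

theorem ptr_num_zero_add (m n : ℕ) (T : Oper ι A) :
    ptr (num ι A 0 (m + n)) T = ptr (num ι A 0 m) (ptr (num ι A m n) T) := by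
  simpa only [zero_add] using ptr_num_add 0 m n T

theorem ptr_of_commute {B X : Type*} [Ring B] [Algebra ℂ B] [Fintype X] [DecidableEq X]
    {φ : Matrix X X ℂ →ₐ[ℂ] B} {C : B} (hC : ∀ Z, Commute C (φ Z)) :
    ptr φ C = (Fintype.card X : ℂ) • C := by
  have := ptr_mul_map hC 1
  rwa [map_one, mul_one, trace_one] at this

variable {q μ : ℂ} {R : TensorMat ι 2 ℂ} {D : Matrix ι ι ℂ}

theorem trace_kappaMat [Nonempty ι] (hB : IsBMWType q μ R) (hR : SkewData R D) (hK : kappaMat q μ R ≠ 0) :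
    (kappaMat q μ R).trace = eta q μ := by
  have h1 := kappaMat_mul_mul hB hR hK 1
  have h2 := (bmwSystem (A := ℂ) hB).e_e 0
  rw [kap, ← map_mul, ← map_smul] at h2
  have h3 := num_injective 0 2 h2
  rw [mul_one, h3] at h1
  exact (smul_left_injective ℂ hK h1).symm

theorem ptr_cups [Nonempty ι] [Nontrivial A] (hB : IsBMWType q μ R) (hR : SkewData R D) (hK : kappaMat q μ R ≠ 0) :
    ∀ j p : ℕ, ptr (num ι A p (2 * j)) (cups (gen A hB.unit) (kap A q μ R) j p) =
      eta q μ ^ j • 1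
  | 0, p => by
    rw [pow_zero, one_smul]
    exact ptr_num_zero p 1
  | j + 1, p => by
    obtain ⟨Z, hZ⟩ := (desc_mem (S := (num ι A p (2 * (j + 1))).range) (s := gen A hB.unit)
      (p := p + 1) (n := 2 * j) fun i h1 h2 => gen_mem (by omega) (by omega)).1
    have hZ' : num ι A p (2 * (j + 1)) Z = (desc (gen A hB.unit) (p + 1) (2 * j) : (Oper ι A)ˣ) := hZ
    rw [cups, mul_assoc, ← hZ', ptr_cyc, hZ', mul_assoc, Units.inv_mul, mul_one,
      show 2 * (j + 1) = 2 + 2 * j by ring, ptr_num_add,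
      ptr_mul_left (C := kap A q μ R p) fun Z => commute_num_num (by omega) _ _, ptr_cups hB hR hK j (p + 2),
      mul_smul_comm, mul_one, map_smul, kap, ptr_one_map, trace_kappaMat hB hR hK, smul_smul,
      pow_succ]

variable {j m : ℕ}

variable (A) in
/-- The trace of `p C` over the last factors, where `p` is the antisymmetrizer on the factors
`j, …, 2 j + m - 1` and `C` consists of `j` nested cups. -/
def cupTrace (hB : IsBMWType q μ R) (j m : ℕ) : Oper ι A :=
  ptr (num ι A j (j + m)) (asym q μ (gen A hB.unit) (kap A q μ R) j (j + m) *
    cups (gen A hB.unit) (kap A q μ R) j 0)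

variable (q μ) in
/-- The normalization of `cupTrace`. -/
def cupNorm (j m : ℕ) : ℂ := ∏ i ∈ Finset.range j, delta q μ (m + i + 1)

theorem cupNorm_ne_zero (hp : AdmissibleParameters q μ (j + m))
    (hμ : μ = q ^ (1 - ((j + m : ℕ) : ℤ))) : cupNorm q μ j m ≠ 0 :=
  Finset.prod_ne_zero_iff.2 fun i hi => delta_ne_zero hp hμ (by omega) (by
    have := Finset.mem_range.1 hi
    omega)

theorem commute_cupTrace (hB : IsBMWType q μ R) (Z : TensorMat ι (j + m) ℂ) :
    Commute (cupTrace A hB j m) (num ι A j (j + m) Z) := commute_ptr _ _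

theorem asym_idem (hB : IsBMWType q μ R) {k : ℕ} (hp : AdmissibleParameters q μ k) {n : ℕ}
    (hn : n ≤ k) (p : ℕ) : asym q μ (gen A hB.unit) (kap A q μ R) p n *
      asym q μ (gen A hB.unit) (kap A q μ R) p n = asym q μ (gen A hB.unit) (kap A q μ R) p n :=
  (isAntisymmetric_asym (bmwSystem hB) hp n hn p).1.idem

theorem isIdempotentElem_antisymMat [Nonempty ι] (hB : IsBMWType q μ R) {k : ℕ}
    (hp : AdmissibleParameters q μ k) {n : ℕ} (hn : n ≤ k) : IsIdempotentElem (antisymMat hB n) :=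
  num_injective (A := ℂ) 0 n (by
    rw [map_mul, num_antisymMat]
    exact asym_idem hB hp hn 0)

theorem trace_eq_one_of_rank_eq_one {X : Type*} [Fintype X] {P : Matrix X X ℂ} (hP : P.rank = 1)
    (hi : IsIdempotentElem P) : P.trace = 1 := by
  classical
  have h0 : P ≠ 0 := by
    rintro rfl
    simp at hP
  have h1 := mul_mul_of_rank_eq_one hP 1
  rw [mul_one, hi, ← one_smul ℂ P, smul_smul, mul_one] at h1
  rw [← one_smul ℂ P]
  exact (smul_left_injective ℂ h0 (by simpa using h1)).symm

theorem asym_cups_asym (hB : IsBMWType q μ R) (hr : (antisymMat hB (j + m)).rank = 1) :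
    asym q μ (gen A hB.unit) (kap A q μ R) j (j + m) *
        cups (gen A hB.unit) (kap A q μ R) j 0 *
        asym q μ (gen A hB.unit) (kap A q μ R) j (j + m) =
      cupTrace A hB j m * asym q μ (gen A hB.unit) (kap A q μ R) j (j + m) := by
  rw [cupTrace, ← num_antisymMat]
  exact map_mul_map_of_rank_one (mul_mul_of_rank_eq_one hr) _

/-- The antisymmetrizer has trace 1, being an idempotent of rank one, so tracing over its strands
recovers the coefficient in front of it. -/
theorem eq_of_mul_asym [Nonempty ι] (hB : IsBMWType q μ R) (hp : AdmissibleParameters q μ (j + m))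
    (hr : (antisymMat hB (j + m)).rank = 1) {x y : Oper ι A}
    (hx : ∀ Z, Commute x (num ι A j (j + m) Z)) (hy : ∀ Z, Commute y (num ι A j (j + m) Z))
    (h : x * asym q μ (gen A hB.unit) (kap A q μ R) j (j + m) =
      y * asym q μ (gen A hB.unit) (kap A q μ R) j (j + m)) : x = y := by
  rw [← num_antisymMat] at h
  have := congrArg (ptr (num ι A j (j + m))) h
  rwa [ptr_mul_map hx, ptr_mul_map hy,
    trace_eq_one_of_rank_eq_one hr (isIdempotentElem_antisymMat hB hp le_rfl), one_smul,
    one_smul] at this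

theorem cups_asym_cups_zero (hB : IsBMWType q μ R) (hp : AdmissibleParameters q μ (j + m)) :
    cups (gen A hB.unit) (kap A q μ R) j 0 * asym q μ (gen A hB.unit) (kap A q μ R) j (j + m) *
        cups (gen A hB.unit) (kap A q μ R) j 0 =
      cupNorm q μ j m • (cups (gen A hB.unit) (kap A q μ R) j 0 *
        asym q μ (gen A hB.unit) (kap A q μ R) (2 * j) m) := by
  have := cups_asym_cups (bmwSystem (A := A) hB) hp j 0 m le_rfl
  rwa [zero_add, zero_add] at this

/-- In terms of P and C one has t t P = P (C P C) P; contraction replaces C P C by α C a^(m), and P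
absorbs a^(m). -/
theorem cupTrace_mul_self [Nonempty ι] (hB : IsBMWType q μ R)
    (hp : AdmissibleParameters q μ (j + m)) (hr : (antisymMat hB (j + m)).rank = 1) :
    cupTrace A hB j m * cupTrace A hB j m = cupNorm q μ j m • cupTrace A hB j m := by
  have hsys := bmwSystem (A := A) hB
  refine eq_of_mul_asym hB hp hr
    (fun Z => (commute_cupTrace hB Z).mul_left (commute_cupTrace hB Z))
    (fun Z => (commute_cupTrace hB Z).smul_left _) ?_
  have h1 := asym_cups_asym (A := A) hB hr
  have h2 := cups_asym_cups_zero (A := A) hB hp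
  have h3 : asym q μ (gen A hB.unit) (kap A q μ R) (2 * j) m *
      asym q μ (gen A hB.unit) (kap A q μ R) j (j + m) =
        asym q μ (gen A hB.unit) (kap A q μ R) j (j + m) :=
    (isAntisymmetric_asym hsys hp _ le_rfl j).1.mul_asym hsys hp _ _ (by omega) (by omega)
      (by omega)
  generalize cupTrace A hB j m = t, asym q μ (gen A hB.unit) (kap A q μ R) j (j + m) = P,
    cups (gen A hB.unit) (kap A q μ R) j 0 = C at h1 h2 h3 ⊢
  calc t * t * P = t * (P * C * P) := by rw [h1, mul_assoc]
    _ = t * P * C * P := by simp only [mul_assoc]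
    _ = P * (C * P * C) * P := by rw [← h1]; simp only [mul_assoc]
    _ = cupNorm q μ j m • t * P := by
      rw [h2, mul_smul_comm, smul_mul_assoc, mul_assoc, mul_assoc, h3, ← mul_assoc, h1,
        smul_mul_assoc]

/-- The crossing slides through the cups to its mirror position 2j - 2 - i, which lies inside P,
where it acts by -q⁻¹. -/
theorem gen_mul_cupTrace [Nonempty ι] (hB : IsBMWType q μ R)
    (hp : AdmissibleParameters q μ (j + m)) (hr : (antisymMat hB (j + m)).rank = 1) {i : ℕ}
    (hi : i + 1 < j) : (gen A hB.unit i : Oper ι A) * cupTrace A hB j m =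
      -q⁻¹ • cupTrace A hB j m := by
  have hsys := bmwSystem (A := A) hB
  refine eq_of_mul_asym hB hp hr
    (fun Z => Commute.mul_left (commute_num_num (by omega) _ _) (commute_cupTrace hB Z))
    (fun Z => (commute_cupTrace hB Z).smul_left _) ?_
  have h1 := asym_cups_asym (A := A) hB hr
  have h2 := s_mul_cups hsys j 0 i (2 * j - 2 - i) hi (by omega)
  have h3 := (isAntisymmetric_asym hsys hp _ le_rfl j).1.right (2 * j - 2 - i) (by omega) (by omega)
  have h4 : Commute (gen A hB.unit i : Oper ι A)
      (asym q μ (gen A hB.unit) (kap A q μ R) j (j + m)) :=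
    commute_asym hsys _ fun l hl hl' => commute_gen_gen _ _ (by omega)
  rw [zero_add, zero_add] at h2
  rw [mul_assoc, ← h1, ← mul_assoc, ← mul_assoc, h4.eq, mul_assoc _ _ (cups _ _ _ _), h2,
    ← mul_assoc, h3]
  simp only [smul_mul_assoc, h1]

theorem asym_mul_cupTrace [Nonempty ι] (hB : IsBMWType q μ R)
    (hp : AdmissibleParameters q μ (j + m)) (hr : (antisymMat hB (j + m)).rank = 1) :
    asym q μ (gen A hB.unit) (kap A q μ R) 0 j * cupTrace A hB j m = cupTrace A hB j m :=
  asym_mul_of_left (bmwSystem hB) hp (p := 0) (m := j)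
    (fun i _ hi => gen_mul_cupTrace hB hp hr (by omega)) 0 j (by omega) le_rfl le_rfl

theorem cupTrace_mem (hB : IsBMWType q μ R) :
    cupTrace A hB j m ∈ (num ι A 0 (j + (j + m))).range := by
  rw [cupTrace, ptr_apply]
  refine Subalgebra.sum_mem _ fun x _ => Subalgebra.sum_mem _ fun y _ => ?_
  exact Subalgebra.mul_mem _ (Subalgebra.mul_mem _ (num_mem_range (by omega) (by omega) _)
    (Subalgebra.mul_mem _ (asym_mem hB (by omega) (by omega))
      (cups_mem_range hB (by omega) (by omega)))) (num_mem_range (by omega) (by omega) _)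

theorem ptr_cyc_mem {i n : ℕ} {X : Oper ι A} (hX : X ∈ (num ι A i n).range) (T : Oper ι A) :
    ptr (num ι A i n) (X * T) = ptr (num ι A i n) (T * X) := by
  obtain ⟨Z, rfl⟩ := hX
  exact ptr_cyc Z T

theorem ptr_asym (hB : IsBMWType q μ R) (j k : ℕ) :
    ptr (num ι A 0 (j + k)) (asym q μ (gen A hB.unit) (kap A q μ R) 0 j) =
      ((Fintype.card (Fin k → ι) : ℂ) * (antisymMat hB j).trace) • 1 := by
  rw [← num_antisymMat, ptr_num_zero_add,
    ptr_of_commute (φ := num ι A j k) fun Z => commute_num_num (by omega) _ _, map_smul,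
    ptr_one_map, smul_smul]

/-- The cardinality counts the last j + m strands, on which t acts trivially. The rest follows from
η^j Tr(P C) = Tr(C P C) = α Tr(C a^(m)) and Tr C = η^j on its own strands. -/
theorem ptr_cupTrace [Nonempty ι] [Nontrivial A] (hB : IsBMWType q μ R) (hR : SkewData R D)
    (hη : eta q μ ≠ 0) (hK : kappaMat q μ R ≠ 0) (hp : AdmissibleParameters q μ (j + m)) :
    ptr (num ι A 0 (j + (j + m))) (cupTrace A hB j m) =
      ((Fintype.card (Fin (j + m) → ι) : ℂ) * (cupNorm q μ j m * (antisymMat hB m).trace)) • 1 := by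
  have hsys := bmwSystem (A := A) hB
  have h0 : ptr (num ι A 0 (j + (j + m))) (cupTrace A hB j m) =
      (Fintype.card (Fin (j + m) → ι) : ℂ) • ptr (num ι A 0 (j + (j + m)))
        (asym q μ (gen A hB.unit) (kap A q μ R) j (j + m) *
          cups (gen A hB.unit) (kap A q μ R) j 0) := by
    rw [ptr_num_zero_add, ptr_of_commute fun Z => commute_cupTrace hB Z, map_smul, cupTrace,
      ← ptr_num_zero_add]
  have hC : cups (gen A hB.unit) (kap A q μ R) j 0 ∈ (num ι A 0 (j + (j + m))).range :=
    cups_mem_range hB (by omega) (by omega)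
  have h1 : eta q μ ^ j • ptr (num ι A 0 (j + (j + m)))
      (asym q μ (gen A hB.unit) (kap A q μ R) j (j + m) *
        cups (gen A hB.unit) (kap A q μ R) j 0) = cupNorm q μ j m •
      ptr (num ι A 0 (j + (j + m))) (cups (gen A hB.unit) (kap A q μ R) j 0 *
        asym q μ (gen A hB.unit) (kap A q μ R) (2 * j) m) := by
    rw [← map_smul, ← map_smul, ← cups_asym_cups_zero hB hp, mul_assoc, ptr_cyc_mem hC, mul_assoc,
      cups_mul_cups hsys, mul_smul_comm]
  have h2 : ptr (num ι A 0 (j + (j + m))) (cups (gen A hB.unit) (kap A q μ R) j 0 *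
      asym q μ (gen A hB.unit) (kap A q μ R) (2 * j) m) =
        eta q μ ^ j • (antisymMat hB m).trace • 1 := by
    obtain ⟨Z, hZ⟩ := cups_mem_range (A := A) hB (i := 0) (m := 2 * j) (p := 0) (j := j) le_rfl le_rfl
    have hc : ∀ Z, Commute (cups (gen A hB.unit) (kap A q μ R) j 0) (num ι A (2 * j) m Z) := by
      intro W
      rw [← hZ]
      exact commute_num_num (by omega) _ _
    rw [show j + (j + m) = 2 * j + m by ring, ptr_num_zero_add, ← num_antisymMat, ptr_mul_map hc,
      map_smul, ptr_cups hB hR hK, smul_comm]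
  rw [h2, smul_comm] at h1
  have h3 := smul_right_injective _ (pow_ne_zero j hη) h1
  rw [h0, h3, smul_smul, smul_smul, mul_assoc]

/-- The defect of the projection `cupTrace` inside the antisymmetrizer. -/
theorem exists_natCast_eq [Nonempty ι] [Nontrivial A] (hB : IsBMWType q μ R) (hR : SkewData R D)
    (hη : eta q μ ≠ 0) (hK : kappaMat q μ R ≠ 0) (hp : AdmissibleParameters q μ (j + m))
    (hμ : μ = q ^ (1 - ((j + m : ℕ) : ℤ))) (hr : (antisymMat hB (j + m)).rank = 1) :
    ∃ d : ℕ, (Fintype.card (Fin (j + m) → ι) : ℂ) *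
        ((antisymMat hB j).trace - (antisymMat hB m).trace) = d ∧
      (d = 0 → asym q μ (gen A hB.unit) (kap A q μ R) 0 j =
        (cupNorm q μ j m)⁻¹ • cupTrace A hB j m * asym q μ (gen A hB.unit) (kap A q μ R) 0 j) := by
  have hα := cupNorm_ne_zero hp hμ
  have h1 := cupTrace_mul_self (A := A) hB hp hr
  have h2 := asym_mul_cupTrace (A := A) hB hp hr
  have h3 := asym_idem (A := A) hB hp (n := j) (by omega) 0
  have h4 := ptr_cupTrace (A := A) (j := j) (m := m) hB hR hη hK hp
  have h5 := ptr_asym (A := A) hB j (j + m)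
  have m1 : asym q μ (gen A hB.unit) (kap A q μ R) 0 j ∈ (num ι A 0 (j + (j + m))).range :=
    asym_mem hB (by omega) (by omega)
  have m2 := cupTrace_mem (A := A) (j := j) (m := m) hB
  generalize cupTrace A hB j m = t, asym q μ (gen A hB.unit) (kap A q μ R) 0 j = a,
    cupNorm q μ j m = α at *
  -- From t² = α t and a t = t the element α⁻¹ t a is an idempotent absorbed by a on both sides, so
  -- the difference is idempotent too.
  have h6 : a - α⁻¹ • t * a ∈ (num ι A 0 (j + (j + m))).range :=
    Subalgebra.sub_mem _ m1 (Subalgebra.mul_mem _ (Subalgebra.smul_mem _ m2 _) m1)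
  obtain ⟨X, hX⟩ := h6
  change num ι A 0 (j + (j + m)) X = _ at hX
  have hi : IsIdempotentElem X := num_injective (A := A) 0 (j + (j + m)) (by
    rw [map_mul, hX]
    have e1 : t * (t * a) = α • (t * a) := by rw [← mul_assoc, h1, smul_mul_assoc]
    have e2 : a * (t * a) = t * a := by rw [← mul_assoc, h2]
    simp only [mul_sub, sub_mul, smul_mul_assoc, mul_smul_comm, mul_assoc, h3, e1, e2, smul_smul]
    rw [inv_mul_cancel₀ hα, one_smul, sub_self, smul_zero, sub_zero])
  have ht : X.trace = (Fintype.card (Fin (j + m) → ι) : ℂ) *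
      ((antisymMat hB j).trace - (antisymMat hB m).trace) := by
    have e1 : ptr (num ι A 0 (j + (j + m))) (num ι A 0 (j + (j + m)) X) = X.trace • 1 :=
      ptr_one_map X
    rw [hX, map_sub, smul_mul_assoc, map_smul, ← ptr_cyc_mem m1, h2, h4, h5, smul_smul,
      ← sub_smul] at e1
    have e2 := smul_left_injective ℂ (one_ne_zero (α := Oper ι A)) e1
    rw [← e2]
    field_simp
  -- Over ℂ the trace of an idempotent is its rank, so trace zero forces the defect itself to
  -- vanish.
  obtain ⟨d, hd⟩ := exists_trace_eq_natCast hi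
  refine ⟨d, ht.symm.trans hd, fun h0 => ?_⟩
  have h7 := eq_zero_of_trace_eq_zero hi (by rw [hd, h0, Nat.cast_zero])
  rw [h7, map_zero] at hX
  exact sub_eq_zero.1 hX.symm

/-- The antisymmetrizer is reproduced by a partial trace of cups. -/
theorem asym_eq_cupTrace_mul [Nonempty ι] [Nontrivial A] (hB : IsBMWType q μ R)
    (hR : SkewData R D) (hη : eta q μ ≠ 0) (hK : kappaMat q μ R ≠ 0)
    (hp : AdmissibleParameters q μ (j + m)) (hμ : μ = q ^ (1 - ((j + m : ℕ) : ℤ)))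
    (hr : (antisymMat hB (j + m)).rank = 1) :
    asym q μ (gen A hB.unit) (kap A q μ R) 0 j =
      (cupNorm q μ j m)⁻¹ • cupTrace A hB j m * asym q μ (gen A hB.unit) (kap A q μ R) 0 j := by
  obtain ⟨d, h1, h2⟩ := exists_natCast_eq (A := A) hB hR hη hK hp hμ hr
  -- The construction applied with j and m exchanged gives the opposite trace. Both are natural
  -- numbers, hence both are zero.
  rw [add_comm j m] at hp hμ hr
  obtain ⟨d', h3, -⟩ := exists_natCast_eq (A := A) hB hR hη hK hp hμ hr
  rw [add_comm m j] at h3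
  have h4 : (d : ℂ) + d' = 0 := by
    rw [← h1, ← h3]
    ring
  have h5 : d + d' = 0 := by exact_mod_cast h4
  exact h2 (by omega)

end Projection

open Matrix

/-! ### The reciprocal relations -/

section Reciprocal

variable {ι : Type*} [Fintype ι] [DecidableEq ι] {A : Type*} [Ring A] [Algebra ℂ A]
  {q μ : ℂ} {R : TensorMat ι 2 ℂ} {F : (TensorMat ι 2 ℂ)ˣ} {M : Matrix ι ι A} {D : Matrix ι ι ℂ}

theorem chi_zero_mul {m n : ℕ} {X Y : Oper ι A}
    (hX : ∀ j, m ≤ j → ∀ Z, Commute X (site ι A j Z)) (hX' : Commute X (mprod F M m n)) {c : A}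
    (hc : chi D F M m n Y = lmul ι A c) :
    chi D F M 0 (m + n) (X * Y) = chi D F M 0 m X * lmul ι A c :=
  chi_mul (by simpa only [zero_add] using hX) (by simpa only [zero_add] using hX')
    (by simpa only [zero_add] using hc)

variable [Nonempty ι] [Nontrivial A]

theorem chi_cyc_asym (hB : IsBMWType q μ R) (hR : SkewData R D) (h : ChainData F hB.unit M)
    {m p n : ℕ} (hn : p + n ≤ m) (T : Oper ι A) :
    chi D F M 0 m (asym q μ (gen A hB.unit) (kap A q μ R) p n * T) =
      chi D F M 0 m (T * asym q μ (gen A hB.unit) (kap A q μ R) p n) :=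
  chi_cyc (asym_mem hB (by omega) (by omega))
    (commute_asym (bmwSystem hB) n fun i h1 h2 =>
      commute_weight_gen hB hR (by omega) (by omega)).symm
    (commute_asym (bmwSystem hB) n fun i h1 h2 =>
      (h.commute_gen_mprod (by omega) (by omega)).symm).symm T

theorem chi_cyc_cups (hB : IsBMWType q μ R) (hR : SkewData R D) (h : ChainData F hB.unit M)
    {m p j : ℕ} (hn : p + 2 * j ≤ m) (T : Oper ι A) :
    chi D F M 0 m (cups (gen A hB.unit) (kap A q μ R) j p * T) =
      chi D F M 0 m (T * cups (gen A hB.unit) (kap A q μ R) j p) :=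
  chi_cyc (cups_mem_range hB (by omega) (by omega))
    (commute_cups (bmwSystem hB) fun i h1 h2 =>
      commute_weight_gen hB hR (by omega) (by omega)).symm
    (commute_cups (bmwSystem hB) fun i h1 h2 =>
      (h.commute_gen_mprod (by omega) (by omega)).symm).symm T

theorem chi_asym_mul_asym (hB : IsBMWType q μ R) (hR : SkewData R D)
    (h : ChainData F hB.unit M) {j k : ℕ} {c c' : A}
    (hc : chi D F M 0 j (asym q μ (gen A hB.unit) (kap A q μ R) 0 j) = lmul ι A c)
    (hc' : chi D F M 0 k (asym q μ (gen A hB.unit) (kap A q μ R) 0 k) = lmul ι A c') :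
    chi D F M 0 (j + k) (asym q μ (gen A hB.unit) (kap A q μ R) 0 j *
      asym q μ (gen A hB.unit) (kap A q μ R) j k) = lmul ι A (c * c') := by
  rw [chi_zero_mul (fun l hl Z => commute_asym_site hB (by omega) Z)
    (commute_asym (bmwSystem hB) j fun i h1 h2 =>
      (h.commute_gen_mprod_of_lt (by omega) _).symm).symm ((chi_asym hB hR h k j).trans hc'), hc,
    map_mul]

/-- Antisymmetrizers on neighbouring blocks of strands can be interchanged. -/
theorem chi_asym_mul_asym_comm (hB : IsBMWType q μ R) (hR : SkewData R D)
    (h : ChainData F hB.unit M) (j k : ℕ) :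
    chi D F M 0 (j + k) (asym q μ (gen A hB.unit) (kap A q μ R) 0 j *
      asym q μ (gen A hB.unit) (kap A q μ R) j k) =
    chi D F M 0 (k + j) (asym q μ (gen A hB.unit) (kap A q μ R) 0 k *
      asym q μ (gen A hB.unit) (kap A q μ R) k j) := by
  have hsys := bmwSystem (A := A) hB
  let W := swapBraid (gen A hB.unit) k j
  have h1 : SemiconjBy (W : Oper ι A) (asym q μ (gen A hB.unit) (kap A q μ R) j k)
      (asym q μ (gen A hB.unit) (kap A q μ R) 0 k) := semiconj_asym hsys k fun i hi => by
    rw [zero_add]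
    exact semiconj_swapBraid hsys hi j
  have h2 : SemiconjBy (W : Oper ι A) (asym q μ (gen A hB.unit) (kap A q μ R) 0 j)
      (asym q μ (gen A hB.unit) (kap A q μ R) k j) := semiconj_asym hsys j fun i hi => by
    rw [zero_add]
    exact semiconj_swapBraid' hsys j hi
  have h3 : Commute (asym q μ (gen A hB.unit) (kap A q μ R) 0 k)
      (asym q μ (gen A hB.unit) (kap A q μ R) k j) :=
    commute_asym hsys j fun i hi hi' => (commute_asym hsys k fun l hl hl' =>
      commute_gen_gen _ _ (by omega)).symm
  -- Cyclicity for the braid that exchanges the two blocks.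
  have h4 := chi_cyc (D := D) (F := F) (M := M) (p := 0) (n := j + k) (X := (W : Oper ι A))
    (swapBraid_mem fun i hi => gen_mem (by omega) (by omega))
    (commute_swapBraid fun i hi => commute_weight_gen hB hR (by omega) (by omega)).symm
    (commute_swapBraid fun i hi => (h.commute_gen_mprod (by omega) (by omega)).symm).symm
    (asym q μ (gen A hB.unit) (kap A q μ R) 0 j * asym q μ (gen A hB.unit) (kap A q μ R) j k *
      (↑W⁻¹ : Oper ι A))
  rw [Units.inv_mul_cancel_right] at h4
  rw [← h4, ← mul_assoc, (h2.mul_right h1).eq, Units.mul_inv_cancel_right, h3.eq, add_comm]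

/-- The reciprocal relations for the characteristic elements of a quantum matrix. -/
theorem reciprocal_relation (hB : IsBMWType q μ R) (hR : SkewData R D)
    (h : ChainData F hB.unit M) (hη : eta q μ ≠ 0) (hK : kappaMat q μ R ≠ 0) {j m : ℕ}
    (hp : AdmissibleParameters q μ (j + m)) (hμ : μ = q ^ (1 - ((j + m : ℕ) : ℤ)))
    (hr : (antisymMat hB (j + m)).rank = 1) {g : A}
    (hg : chi D F M 0 2 (kap A q μ R 0) = lmul ι A (eta q μ • g)) {c : ℕ → A}
    (hc : ∀ n, chi D F M 0 n (asym q μ (gen A hB.unit) (kap A q μ R) 0 n) = lmul ι A (c n)) :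
    g ^ j * c m = c (j + m) * c j := by
  have hsys := bmwSystem (A := A) hB
  have hα := cupNorm_ne_zero hp hμ
  refine lmul_injective (ι := ι) ?_
  -- The product c (j + m) c j, with its blocks exchanged, is the trace of a P; then a is replaced
  -- by α⁻¹ t a.
  rw [← chi_asym_mul_asym hB hR h (hc _) (hc _), ← chi_asym_mul_asym_comm hB hR h,
    asym_eq_cupTrace_mul hB hR hη hK hp hμ hr]
  have h1 : chi D F M 0 (j + (j + m)) (cups (gen A hB.unit) (kap A q μ R) j 0 *
      asym q μ (gen A hB.unit) (kap A q μ R) (2 * j) m) = eta q μ ^ j • lmul ι A (g ^ j * c m) := by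
    rw [show j + (j + m) = 2 * j + m by ring,
      chi_zero_mul (fun l hl Z => commute_cups_site hB (by omega) Z)
        (commute_cups hsys fun i h1 h2 => (h.commute_gen_mprod_of_lt (by omega) _).symm).symm
        ((chi_asym hB hR h m (2 * j)).trans (hc m)), chi_cups hB hR h hg, ← map_mul, smul_pow,
      smul_mul_assoc, map_smul]
  -- One factor C² = η^j C lets a copy of C move around to the other side of P, producing C P C. The
  -- η^j introduced here cancels the one coming from the loops η g.
  have h2 : eta q μ ^ j • chi D F M 0 (j + (j + m)) (cups (gen A hB.unit) (kap A q μ R) j 0 *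
      asym q μ (gen A hB.unit) (kap A q μ R) j (j + m)) =
        cupNorm q μ j m • eta q μ ^ j • lmul ι A (g ^ j * c m) := by
    rw [← h1, ← chi_smul, ← chi_smul, ← cups_asym_cups_zero hB hp,
      ← chi_cyc_cups hB hR h (by omega), ← mul_assoc, cups_mul_cups hsys, smul_mul_assoc]
  have h3 : Commute (asym q μ (gen A hB.unit) (kap A q μ R) 0 j)
      (asym q μ (gen A hB.unit) (kap A q μ R) j (j + m)) :=
    commute_asym hsys _ fun i hi hi' => (commute_asym hsys j fun l hl hl' =>
      commute_gen_gen _ _ (by omega)).symm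
  -- Under the trace t a P = t P a becomes a t P = t P = P C P, and then C P by cyclicity and P² =
  -- P.
  rw [smul_mul_assoc, smul_mul_assoc, chi_smul, mul_assoc, h3.eq, ← mul_assoc,
    ← chi_cyc_asym hB hR h (by omega), ← mul_assoc, asym_mul_cupTrace hB hp hr,
    ← asym_cups_asym hB hr, mul_assoc, chi_cyc_asym hB hR h (by omega), mul_assoc,
    asym_idem hB hp le_rfl]
  rw [smul_comm] at h2
  rw [smul_right_injective _ (pow_ne_zero j hη) h2, smul_smul, inv_mul_cancel₀ hα, one_smul]

end Reciprocal

open Matrix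

/-! ### Application to the quantum matrix algebra -/

section QuantumMatrixAlgebra

theorem copy_map {ι : Type*} [Fintype ι] [DecidableEq ι] {A A' : Type*} [Ring A] [Algebra ℂ A]
    [Ring A'] [Algebra ℂ A'] (φ : A →ₐ[ℂ] A') (F : TensorMat ι 2 ℂ) (M : Matrix ι ι A) (n : ℕ) :
    ∀ (i : ℕ) (h : i < n), φ.mapMatrix (copy F M n i h) = copy F (φ.mapMatrix M) n i h
  | 0, h => by
    ext x y
    simp only [copy, embed, oneLeg, AlgHom.mapMatrix_apply, Matrix.map_apply, Matrix.of_apply]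
    split_ifs <;> simp
  | i + 1, h => by
    have hs : ∀ X : TensorMat ι n ℂ, φ.mapMatrix (scalars A X) = scalars A' X := by
      intro X
      ext x y
      simp [scalars]
    rw [copy, copy, map_mul, map_mul, copy_map φ F M n i, hs, hs]

theorem copyProd_map {ι : Type*} [Fintype ι] [DecidableEq ι] {A A' : Type*} [Ring A]
    [Algebra ℂ A] [Ring A'] [Algebra ℂ A'] (φ : A →ₐ[ℂ] A') (F : TensorMat ι 2 ℂ)
    (M : Matrix ι ι A) (n : ℕ) :
    φ.mapMatrix (copyProd F M n) = copyProd F (φ.mapMatrix M) n := by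
  rw [copyProd, copyProd, map_list_prod, List.map_ofFn]
  congr 2
  funext i
  exact copy_map φ F M n i i.isLt

variable {ι : Type*} [Fintype ι] [DecidableEq ι]

/-- The defining relation of the quantum matrix algebra. -/
theorem quantumMatrix_rel (R F : TensorMat ι 2 ℂ) :
    scalars (QMAlgebra R F) R * copyProd F (quantumMatrix R F) 2 =
      copyProd F (quantumMatrix R F) 2 * scalars (QMAlgebra R F) R := by
  let φ : FreeAlgebra ℂ (ι × ι) →ₐ[ℂ] QMAlgebra R F := RingQuot.mkAlgHom ℂ (QMRel R F)
  have hM : quantumMatrix R F = φ.mapMatrix (freeMatrix ι) := rfl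
  have hs : scalars (QMAlgebra R F) R = φ.mapMatrix (scalars (FreeAlgebra ℂ (ι × ι)) R) := by
    ext x y
    simp [scalars]
  rw [hM, ← copyProd_map, hs, ← map_mul, ← map_mul]
  ext x y
  exact RingQuot.mkAlgHom_rel ℂ (QMRel.entry x y)

variable {q μ : ℂ} {R F : TensorMat ι 2 ℂ}

theorem num_three {A : Type*} [Ring A] [Algebra ℂ A] (u : (TensorMat ι 2 ℂ)ˣ) (r : ℕ) :
    num ι A r 3 (twoLegs (u : TensorMat ι 2 ℂ) 3 0) = gen A u r ∧
      num ι A r 3 (twoLegs (u : TensorMat ι 2 ℂ) 3 1) = gen A u (r + 1) :=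
  ⟨num_embed _ _, num_embed _ _⟩

theorem chainData (hB : IsBMWType q μ R) (hF : IsYangBaxter F) (hRF : IsCompatible R F) :
    ChainData hF.isUnit.unit hB.unit (quantumMatrix R F) where
  braid r := by
    have h := congrArg (num ι (QMAlgebra R F) r 3) hF.braid
    have h1 := num_three (A := QMAlgebra R F) hF.isUnit.unit r
    simp only [IsUnit.unit_spec] at h1
    simp only [map_mul, h1] at h
    rw [SemiconjBy, ← h, mul_assoc]
  down r := by
    have h := congrArg (num ι (QMAlgebra R F) r 3) hRF.twist₁
    have h1 := num_three (A := QMAlgebra R F) hF.isUnit.unit r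
    have h2 := num_three (A := QMAlgebra R F) hB.unit r
    simp only [IsUnit.unit_spec, IsBMWType.unit_val] at h1 h2
    simp only [map_mul, h1, h2] at h
    rw [SemiconjBy, ← h, mul_assoc]
  up r := by
    have h := congrArg (num ι (QMAlgebra R F) r 3) hRF.twist₂
    have h1 := num_three (A := QMAlgebra R F) hF.isUnit.unit r
    have h2 := num_three (A := QMAlgebra R F) hB.unit r
    simp only [IsUnit.unit_spec, IsBMWType.unit_val] at h1 h2
    simp only [map_mul, h1, h2] at h
    rw [SemiconjBy, ← h, mul_assoc]
  rel := by
    have h := congrArg (op ι (QMAlgebra R F) 0 2) (quantumMatrix_rel R F)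
    rw [map_mul, map_mul, op_scalars] at h
    have h1 := op_copyProd (F := hF.isUnit.unit) (M := quantumMatrix R F) 2
    rw [IsUnit.unit_spec] at h1
    rw [h1] at h
    exact h

theorem ybRep_kappa [Nonempty ι] (hB : IsBMWType q μ R) :
    ybRep hB 2 (BMW.kappa q μ 2 ⟨0, by norm_num⟩) = kappaMat q μ R :=
  num_injective (A := ℂ) 0 2 (num_ybRep_kappa hB)

theorem eta_smul_contraction [Nonempty ι] (hB : IsBMWType q μ R) (hη : eta q μ ≠ 0) :
    eta q μ • contraction hB F = μ ^ 2 • (copyProd F (quantumMatrix R F) 2 *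
      scalars (QMAlgebra R F) (kappaMat q μ R)).trace := by
  have hs : scalars (QMAlgebra R F) ((eta q μ)⁻¹ • kappaMat q μ R) =
      (eta q μ)⁻¹ • scalars (QMAlgebra R F) (kappaMat q μ R) := by
    ext x y
    change algebraMap ℂ (QMAlgebra R F) ((eta q μ)⁻¹ * kappaMat q μ R x y) =
      (eta q μ)⁻¹ • algebraMap ℂ (QMAlgebra R F) (kappaMat q μ R x y)
    rw [map_mul, Algebra.smul_def]
  rw [contraction, BMW.contractor2, map_smul, ybRep_kappa, hs, mul_smul_comm, trace_smul,
    smul_comm (μ ^ 2), smul_smul, mul_inv_cancel₀ hη, one_smul]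

theorem chi_antisymmetrizer [Nonempty ι] (hB : IsBMWType q μ R) (hS : IsSkewInvertible R)
    (hF : IsYangBaxter F) (n : ℕ) :
    chi (matrixD hS) hF.isUnit.unit (quantumMatrix R F) 0 n
        (asym q μ (gen (QMAlgebra R F) hB.unit) (kap (QMAlgebra R F) q μ R) 0 n) =
      lmul ι (QMAlgebra R F) (elementarySum hB hS F n) := by
  cases n with
  | zero => exact ((mul_one _).trans (map_one _).symm)
  | succ n =>
    rw [← num_antisymMat, chi_num, IsUnit.unit_spec]
    rfl

end QuantumMatrixAlgebra
end QuantumMatrix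
end

theorem mainTheorem1 {ι : Type*} [Fintype ι] [DecidableEq ι] (q μ : ℂ) (k : ℕ)
    (R F : QuantumMatrix.TensorMat ι 2 ℂ)
    (hR : QuantumMatrix.IsOrthogonalType q μ k R)
    (hF : QuantumMatrix.IsYangBaxter F)
    (hFs : QuantumMatrix.IsStrictSkewInvertible F)
    (hRF : QuantumMatrix.IsCompatible R F) :
    ∀ i : ℕ, i < k →
      QuantumMatrix.contraction hR.bmw F ^ (k - i) *
          QuantumMatrix.elementarySum hR.bmw hR.skew F i =
        QuantumMatrix.elementarySum hR.bmw hR.skew F k *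
          QuantumMatrix.elementarySum hR.bmw hR.skew F (k - i) := by
  intro i hi
  -- Numerical operators embed faithfully only over a nontrivial coefficient algebra; over the zero
  -- algebra nothing has to be proved.
  rcases subsingleton_or_nontrivial (QuantumMatrix.QMAlgebra R F) with hA | hA
  · exact Subsingleton.elim _ _
  have hk := hR.two_le
  have hp := hR.parameters
  -- On a zero-dimensional space all operators on V^{⊗k} vanish, which contradicts rank one.
  have hι : Nonempty ι := by
    by_contra hne
    rw [not_nonempty_iff] at hne
    have : Nonempty (Fin k) := ⟨⟨0, by omega⟩⟩
    have h0 : QuantumMatrix.ybRep hR.bmw k (QuantumMatrix.BMW.antisymmetrizer q μ k) = 0 :=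
      Subsingleton.elim _ _
    have h1 := hR.rank_one
    rw [h0, Matrix.rank_zero] at h1
    exact zero_ne_one h1
  have hη := hp.eta_ne (by omega)
  have hK : QuantumMatrix.kappaMat q μ R ≠ 0 :=
    QuantumMatrix.kappaMat_ne_zero hR.bmw hp.mu_ne_q
      (by simpa using hp.mu_ne 1 le_rfl (by omega)) (hp.sub_ne (by omega)) hp.mu_ne_zero
  -- The number of cups is j = k - i, and m = i strands of the antisymmetrizer remain uncontracted.
  obtain ⟨j, rfl⟩ : ∃ j, k = j + i := ⟨k - i, by omega⟩
  rw [Nat.add_sub_cancel]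
  have hS := QuantumMatrix.skewData hR.skew
  refine QuantumMatrix.reciprocal_relation hR.bmw hS (QuantumMatrix.chainData hR.bmw hF hRF) hη hK
    hp hR.mu_eq hR.rank_one ?_ (QuantumMatrix.chi_antisymmetrizer hR.bmw hR.skew hF)
  rw [QuantumMatrix.eta_smul_contraction hR.bmw hη,
    QuantumMatrix.chi_kap hR.bmw hS hp.mu_ne_zero hη hK, IsUnit.unit_spec]
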